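/- Work over $\mathbb C$. Let $\mathcal A$ be one of the following hearts of $D^b(\mathrm{Coh}\,\mathbb P^1)$: the category $\mathrm{Coh}\,\mathbb P^1$, or, for some $n\in\mathbb Z$, the heart with simple objects $\mathcal O(1-n)$ and $\mathcal O(-n)[1]$, identified with the category of finite-dimensional representations of the Kronecker quiver $1\leftleftarrows 2$ so that these are the simples at the vertices $1$ and $2$. (Up to shift these are all the hearts $\mathrm{Coh}^\nu$, $\nu\in\mathbb R$; $\nu=\frac12$ is $\mathrm{Coh}\,\mathbb P^1$.) Classes of objects are taken in $K_0(\mathbb P^1)=\mathbb Z^2$ by (rank, degree); let $K_0^+\subset\mathbb Z^2$ be the monoid of classes of objects of $\mathcal A$, i.e. $\{(r,d): r>0\}\cup\{(0,d): d\ge 0\}$ for $\mathrm{Coh}\,\mathbb P^1$ and $\{(r,d): nr+d\ge 0,\ (n-1)r+d\ge 0\}$ in the quiver case. An object of class $c$ over $\operatorname{Spec}R$ means a finitely presented $R$-flat family all of whose fibres have class $c$. For a sequence $\underline\alpha=(\alpha_1,\dots,\alpha_s)$ in $\mathbb Z^2$ with sum $\alpha$, let $\widetilde{Coh}_{\underline\alpha}$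 be the stack of filtrations $0=F_0\subseteq F_1\subseteq\dots\subseteq F_s=F$ with $F$ of class $\alpha$ and $F_i/F_{i-1}$ of class $\alpha_i$. For $\underline\alpha=(\alpha_i)_{i\le s}$, $\underline\alpha'=(\alpha'_j)_{j\le l}$ both of sum $\alpha$, let $Z_{\underline\alpha,\underline\alpha'}$ be the stack of pairs of filtrations, of types $\underline\alpha$ and $\underline\alpha'$, of the same object of class $\alpha$, and let $W(\underline\alpha,\underline\alpha')$ be the set of $s\times l$ matrices $w$ over $\mathbb Z^2$ with $\sum_j w_{ij}=\alpha_i$ and $\sum_i w_{ij}=\alpha'_j$. The cell $Z_{\underline\alpha,\underline\alpha'}(w)$ is the substack of pairs $(F_\cdot,G_\cdot)$ such that $F_i\cap G_j/(F_{i-1}\cap G_j+F_i\cap G_{j-1})$ is an object of class $w_{ij}$ for all $i,j$ (over $\operatorname{Spec} R$: flat of class $w_{ij}$). Put $w'\le w$ if $\sum_{i'\le i,\,j'\le j}(w'_{i'j'}-w_{i'j'})\in K_0^+$ for all $i,j$, and $Z_{\underline\alpha,\underline\alpha'}(\le w)=\bigsqcup_{w'\le w}Z_{\underline\alpha,\underline\alpha'}(w')$.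 Let $w\in W(\underline\alpha,\underline\alpha')$. For a tuple $\beta$ of classes subdivided into consecutive blocks, the associated split matrix has as its $i$-th row the $i$-th block, placed in the columns of that block, and zeros elsewhere; the merge matrix is its transpose. Choose any reduced decomposition, into exchanges of neighbours, of the permutation which brings $(1,1),(1,2),\dots,(1,l),(2,1),\dots,(s,l)$ into the order $(1,1),(2,1),\dots,(s,1),(1,2),\dots,(s,l)$. Let $\underline w=(w_1,\dots,w_t)$ be the sequence of matrices consisting of: the split of each $\alpha_i$ into $(w_{i1},\dots,w_{il})$; for every exchange in the reduced decomposition, the merge of the two neighbouring entries concerned followed by the split of their sum into the same two entries in the opposite order; and the merge of each $(w_{1j},\dots,w_{sj})$ into $\alpha'_j$. Let $\underline\beta_0=\underline\alpha,\underline\beta_1,\dots,\underline\beta_t=\underline\alpha'$ be the tuples with $w_k\in W(\underline\beta_{k-1},\underline\beta_k)$. Let $S(w)$ be the stack of tuples $(F,F^{(0)}_\cdot,\dots,F^{(t)}_\cdot)$ with $F$ of class $\alpha$, $F^{(k)}_\cdot$ a filtration of $F$ of type $\underline\beta_k$, and $(F^{(k-1)}_\cdot,F^{(k)}_\cdot)\in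 Z_{\underline\beta_{k-1},\underline\beta_k}(w_k)$ for $1\le k\le t$. Let $\Pi_{0,t}$ send such a tuple to $(F^{(0)}_\cdot,F^{(t)}_\cdot)$, and put $U(w)=\Pi_{0,t}^{-1}(Z_{\underline\alpha,\underline\alpha'}(w))$. Then 1. $\Pi_{0,t}(S(w))\subseteq Z_{\underline\alpha,\underline\alpha'}(\le w)$ (on points with values in any field containing $\mathbb C$); 2. $\Pi_{0,t}$ restricts to an isomorphism of stacks $U(w)\xrightarrow{\ \sim\ }Z_{\underline\alpha,\underline\alpha'}(w)$; 3. $U(w)$ is an open substack of $S(w)$. -/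

import Mathlib

open CategoryTheory TensorProduct Polynomial

universe u

namespace SteinbergStack

/-! ## Diagrams of modules over a ring -/

/-- A quiver: vertices, arrows, source and target. -/
structure Shape where
  V : Type
  E : Type
  src : E → V
  tgt : E → V

/-- A representation of the quiver `Q` in `R`-modules. -/
structure QRep (Q : Shape) (R : Type u) [CommRing R] where
  obj : Q.V → Type u
  [grp : ∀ v, AddCommGroup (obj v)]
  [mod : ∀ v, Module R (obj v)]
  map : ∀ e, obj (Q.src e) →ₗ[R] obj (Q.tgt e)

attribute [instance] QRep.grp QRep.mod

variable {Q : Shape} {R : Type u} [CommRing R]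

/-- A family of submodules stable under all arrows. -/
@[ext] structure SubRep (M : QRep Q R) where
  carrier : ∀ v, Submodule R (M.obj v)
  stable : ∀ e, carrier (Q.src e) ≤ (carrier (Q.tgt e)).comap (M.map e)

namespace SubRep

variable {M : QRep Q R}

theorem carrier_injective : Function.Injective (SubRep.carrier : SubRep M → _) :=
  fun _ _ h => SubRep.ext h

instance : LE (SubRep M) := ⟨fun A B => A.carrier ≤ B.carrier⟩
instance : LT (SubRep M) := ⟨fun A B => A.carrier < B.carrier⟩
/-- Intersection, vertex by vertex. -/
instance : Min (SubRep M) :=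
  ⟨fun A B => ⟨fun v => A.carrier v ⊓ B.carrier v,
    fun e _ hx => ⟨A.stable e hx.1, B.stable e hx.2⟩⟩⟩
/-- Sum, vertex by vertex. -/
instance : Max (SubRep M) :=
  ⟨fun A B => ⟨fun v => A.carrier v ⊔ B.carrier v, fun e =>
    sup_le ((A.stable e).trans (Submodule.comap_mono le_sup_left))
      ((B.stable e).trans (Submodule.comap_mono le_sup_right))⟩⟩
instance : Bot (SubRep M) := ⟨⟨fun _ => ⊥, fun _ => bot_le⟩⟩
instance : Top (SubRep M) := ⟨⟨fun _ => ⊤, fun _ => by simp⟩⟩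

instance : Lattice (SubRep M) :=
  carrier_injective.lattice _ Iff.rfl Iff.rfl (fun _ _ => rfl) (fun _ _ => rfl)

instance : BoundedOrder (SubRep M) where
  bot_le _ _ := bot_le
  le_top _ _ := le_top

/-- The subquotient `A / (A ∩ B)`; it is `A / B` when `B ≤ A`. -/
abbrev subquot (A B : SubRep M) : QRep Q R where
  obj v := A.carrier v ⧸ (B.carrier v).submoduleOf (A.carrier v)
  map e := Submodule.mapQ _ _ ((M.map e).restrict (A.stable e)) fun _ hx => B.stable e hx

end SubRep

/-- Extension of scalars along `R → R'`. -/
abbrev QRep.baseChange (R' : Type u) [CommRing R'] [Algebra R R'] (M : QRep Q R) : QRep Q R' where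
  obj v := R' ⊗[R] M.obj v
  map e := (M.map e).baseChange R'

/-- The image of `R' ⊗ A` in `R' ⊗ M`. -/
def SubRep.baseChange (R' : Type u) [CommRing R'] [Algebra R R'] {M : QRep Q R}
    (A : SubRep M) : SubRep (M.baseChange R') where
  carrier v := (A.carrier v).baseChange R'
  stable e := by
    rw [Submodule.baseChange_eq_span]
    refine Submodule.span_le.2 ?_
    rintro _ ⟨m, hm, rfl⟩
    exact Submodule.tmul_mem_baseChange_of_mem 1 (A.stable e hm)

/-! ## Diagrams with several flags, and their isomorphisms -/

/-- A representation `F` with increasing sequences of subrepresentations indexed by `ι`. -/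
structure Flagged (Q : Shape) (R : Type u) [CommRing R] (ι : Type) where
  F : QRep Q R
  flag : ι → ℕ →o SubRep F

namespace Flagged

variable {ι κ : Type}

/-- An isomorphism of the underlying representations carrying each flag to the
corresponding flag. -/
@[ext] structure Hom (X Y : Flagged Q R ι) where
  equiv : ∀ v, X.F.obj v ≃ₗ[R] Y.F.obj v
  comm : ∀ e x, equiv (Q.tgt e) (X.F.map e x) = Y.F.map e (equiv (Q.src e) x)
  flag : ∀ i n v, ((X.flag i n).carrier v).map (equiv v).toLinearMap = (Y.flag i n).carrier v

instance : Groupoid (Flagged Q R ι) where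
  Hom := Hom
  id X := ⟨fun _ => LinearEquiv.refl R _, fun _ _ => rfl, fun _ _ _ => Submodule.map_id _⟩
  comp f g := ⟨fun v => (f.equiv v).trans (g.equiv v),
    fun e x => by simp [f.comm, g.comm],
    fun i n v => by
      rw [← g.flag, ← f.flag, ← Submodule.map_comp]; rfl⟩
  inv f := ⟨fun v => (f.equiv v).symm,
    fun e x => by rw [LinearEquiv.symm_apply_eq, f.comm]; simp,
    fun i n v => by
      rw [← f.flag, ← Submodule.map_comp]; simp⟩
  id_comp _ := rfl
  comp_id _ := rfl
  assoc _ _ _ := rfl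
  inv_comp f := Hom.ext (funext fun v => (f.equiv v).symm_trans_self)
  comp_inv f := Hom.ext (funext fun v => (f.equiv v).self_trans_symm)

/-- Keep only the flags in the positions given by `σ`. -/
def proj (σ : κ → ι) : Flagged Q R ι ⥤ Flagged Q R κ where
  obj X := ⟨X.F, fun k => X.flag (σ k)⟩
  map f := ⟨f.equiv, f.comm, fun k => f.flag (σ k)⟩

theorem baseChange_mono (R' : Type u) [CommRing R'] [Algebra R R'] {M : QRep Q R} :
    Monotone (SubRep.baseChange R' : SubRep M → _) := by
  intro A B h v
  change (A.carrier v).baseChange R' ≤ (B.carrier v).baseChange R'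
  rw [Submodule.baseChange_eq_span]
  refine Submodule.span_le.2 ?_
  rintro _ ⟨m, hm, rfl⟩
  exact Submodule.tmul_mem_baseChange_of_mem 1 (h v hm)

/-- Pullback of a family along `Spec R' → Spec R`. -/
def baseChange (R' : Type u) [CommRing R'] [Algebra R R'] (X : Flagged Q R ι) :
    Flagged Q R' ι where
  F := X.F.baseChange R'
  flag i := ⟨fun n => (X.flag i n).baseChange R', fun _ _ h =>
    baseChange_mono R' ((X.flag i).monotone h)⟩

end Flagged

/-! ## Quasi-coherent sheaves on the projective line over `R`

A quasi-coherent sheaf on `ℙ¹_R` is given by its sections over the standard affine opens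
`U₀ = Spec R[x]`, `U_∞ = Spec R[y]` and over their intersection `Spec R[t, t⁻¹]` (where `x = t`,
`y = t⁻¹`), that is, by three `R`-modules with the operators of multiplication by the coordinate
functions and the two restriction maps, the latter being localizations. -/

inductive P1Vertex | zero | infty | overlap
inductive P1Arrow | x | y | t | tinv | res0 | resInfty

abbrev P1Shape : Shape where
  V := P1Vertex
  E := P1Arrow
  src | .x => .zero | .y => .infty | .t => .overlap | .tinv => .overlap
      | .res0 => .zero | .resInfty => .infty
  tgt | .x => .zero | .y => .infty | .t => .overlap | .tinv => .overlap
      | .res0 => .overlap | .resInfty => .overlap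

namespace P1

variable (M : QRep P1Shape R)

/-- Sections over `U₀`. -/
abbrev M0 : Type u := M.obj P1Vertex.zero
/-- Sections over `U_∞`. -/
abbrev MInfty : Type u := M.obj P1Vertex.infty
/-- Sections over `U₀ ∩ U_∞`. -/
abbrev MOverlap : Type u := M.obj P1Vertex.overlap

/-- Multiplication by the coordinate functions, and the restriction maps. -/
def x : Module.End R (M0 M) := M.map P1Arrow.x
def y : Module.End R (MInfty M) := M.map P1Arrow.y
def t : Module.End R (MOverlap M) := M.map P1Arrow.t
def tinv : Module.End R (MOverlap M) := M.map P1Arrow.tinv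
def res0 : M0 M →ₗ[R] MOverlap M := M.map P1Arrow.res0
def resInfty : MInfty M →ₗ[R] MOverlap M := M.map P1Arrow.resInfty

/-- The diagram is a quasi-coherent sheaf on `ℙ¹_R`: `MOverlap` is an `R[t, t⁻¹]`-module, and the
restriction maps identify it with `M0[x⁻¹]` and with `MInfty[y⁻¹]`. -/
structure IsQuasicoherent : Prop where
  t_tinv : t M * tinv M = 1
  tinv_t : tinv M * t M = 1
  res0_x : ∀ m, res0 M (x M m) = t M (res0 M m)
  resInfty_y : ∀ m, resInfty M (y M m) = tinv M (resInfty M m)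
  ker0 : ∀ m, res0 M m = 0 → ∃ n : ℕ, (x M ^ n) m = 0
  surj0 : ∀ z, ∃ (n : ℕ) (m : M0 M), (t M ^ n) z = res0 M m
  kerInfty : ∀ m, resInfty M m = 0 → ∃ n : ℕ, (y M ^ n) m = 0
  surjInfty : ∀ z, ∃ (n : ℕ) (m : MInfty M), (tinv M ^ n) z = resInfty M m

/-- Finite presentation on the two charts. (`Module.AEval' f` is the `R[X]`-module on which `X`
acts by `f`.) -/
def IsFinitelyPresented : Prop :=
  Module.FinitePresentation R[X] (Module.AEval' (x M)) ∧
    Module.FinitePresentation R[X] (Module.AEval' (y M))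

/-- The Čech differential `M(U₀) × M(U_∞) → M(U₀ ∩ U_∞)`, `(a, b) ↦ a - b`. -/
def cech : (M0 M × MInfty M) →ₗ[R] MOverlap M := (res0 M).coprod (-(resInfty M))

variable {K : Type u} [Field K] (N : QRep P1Shape K)

/-- The (generic) rank of a coherent sheaf on `ℙ¹_K`. -/
noncomputable def rank : ℤ := Module.finrank K[X] (Module.AEval' (x N))

/-- The Euler characteristic `dim H⁰ - dim H¹`. -/
noncomputable def euler : ℤ :=
  (Module.finrank K (LinearMap.ker (cech N)) : ℤ) -
    Module.finrank K (MOverlap N ⧸ LinearMap.range (cech N))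

/-- The degree, `deg = χ - rank`. -/
noncomputable def degree : ℤ := euler N - rank N

end P1

/-! ## Kronecker quiver representations -/

inductive KroneckerVertex | one | two
inductive KroneckerArrow | a | b

/-- The Kronecker quiver: two arrows from vertex `2` to vertex `1`. -/
abbrev KroneckerShape : Shape where
  V := KroneckerVertex
  E := KroneckerArrow
  src _ := .two
  tgt _ := .one

/-- The dimension vector. -/
noncomputable def KroneckerDim {K : Type u} [Field K] (M : QRep KroneckerShape K)
    (v : KroneckerVertex) : ℤ := Module.finrank K (M.obj v)

/-! ## The hearts -/

/-- The abelian hearts `Coh^ν` of `Dᵇ(Coh ℙ¹)`, up to shift: `coh` is the heart of coherent sheaves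
(`ν = 1/2`) and `rep n` is the heart `Coh^{νₙ}`, `νₙ = 1 - arctan(n)/π`, with simple objects
`𝒪(1-n)` and `𝒪(-n)[1]`, identified with the category of representations of the Kronecker
quiver so that these are the simples at the vertices `1` and `2`. -/
inductive Heart
  | coh
  | rep (n : ℤ)

namespace Heart

abbrev shape : Heart → Shape
  | coh => P1Shape
  | rep _ => KroneckerShape

/-- The finitely presented families of objects over `Spec R` (flatness is imposed separately). -/
def IsFamily : (H : Heart) → {R : Type u} → [CommRing R] → QRep H.shape R → Prop
  | coh, _, _, M => P1.IsQuasicoherent M ∧ P1.IsFinitelyPresented M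
  | rep _, R, _, M => ∀ v, Module.FinitePresentation R (M.obj v)

/-- The class in `K₀(ℙ¹) = ℤ²` (rank and degree) of an object over a field. -/
noncomputable def cls : (H : Heart) → {K : Type u} → [Field K] → QRep H.shape K → ℤ × ℤ
  | coh, _, _, M => (P1.rank M, P1.degree M)
  | rep n, _, _, M =>
      KroneckerDim M .one • ((1, 1 - n) : ℤ × ℤ) + KroneckerDim M .two • ((-1, n) : ℤ × ℤ)

/-- The monoid `K₀⁺` of classes of objects. -/
def pos : Heart → Set (ℤ × ℤ)
  | coh => {c | 0 < c.1 ∨ (c.1 = 0 ∧ 0 ≤ c.2)}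
  | rep n => {c | 0 ≤ n * c.1 + c.2 ∧ 0 ≤ (n - 1) * c.1 + c.2}

/-- `M` is an object over `Spec R` of the stack of objects of class `c`: a finitely presented family,
flat over `R`, all of whose fibres have class `c`. -/
structure HasClass (H : Heart) (M : QRep H.shape R) (c : ℤ × ℤ) : Prop where
  family : H.IsFamily M
  flat : ∀ v, Module.Flat R (M.obj v)
  fibre : ∀ (K : Type u) [Field K] [Algebra R K], H.cls (M.baseChange K) = c

end Heart

/-! ## Flags and relative positions -/

variable {H : Heart}

/-- `0 = f 0 ≤ f 1 ≤ ⋯ ≤ f s = F` is a filtration with `f i / f (i-1)` of class `α i`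
(entries of `α` are indexed from `0`). -/
structure IsFlag (H : Heart) {F : QRep H.shape R} {s : ℕ} (α : Fin s → ℤ × ℤ)
    (f : ℕ →o SubRep F) : Prop where
  zero : f 0 = ⊥
  last : f s = ⊤
  gr : ∀ i : Fin s, H.HasClass ((f (i + 1)).subquot (f i)) (α i)

/-- The subquotient `(fᵢ ∩ gⱼ) / (fᵢ₋₁ ∩ gⱼ + fᵢ ∩ gⱼ₋₁)`, with `i`, `j` shifted by one. -/
def relPos {M : QRep Q R} (f g : ℕ →o SubRep M) (i j : ℕ) : QRep Q R :=
  (f (i + 1) ⊓ g (j + 1)).subquot (f i ⊓ g (j + 1) ⊔ f (i + 1) ⊓ g j)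

/-- Sequences of total class `a`. -/
def IsSeq {s : ℕ} (a : ℤ × ℤ) (α : Fin s → ℤ × ℤ) : Prop := ∑ i, α i = a

/-- The set `W(α, α')` of matrices with row sums `α` and column sums `α'`. -/
def W {s l : ℕ} (α : Fin s → ℤ × ℤ) (α' : Fin l → ℤ × ℤ) :
    Set (Matrix (Fin s) (Fin l) (ℤ × ℤ)) :=
  {w | (∀ i, ∑ j, w i j = α i) ∧ ∀ j, ∑ i, w i j = α' j}

/-- `w([1:i],[1:j])`. -/
def cornerSum {s l : ℕ} (w : Matrix (Fin s) (Fin l) (ℤ × ℤ)) (i : Fin s) (j : Fin l) : ℤ × ℤ :=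
  ∑ i' ∈ Finset.Iic i, ∑ j' ∈ Finset.Iic j, w i' j'

/-- The order on matrices: `w' ≤ w` when every corner sum of `w'` exceeds that of `w` by an
element of `K₀⁺`. -/
def MatLE (H : Heart) {s l : ℕ} (w' w : Matrix (Fin s) (Fin l) (ℤ × ℤ)) : Prop :=
  ∀ i j, cornerSum w' i j - cornerSum w i j ∈ H.pos

/-- The pair of flags `(f, g)` of `F`, of types `α` and `α'`, is a family of pairs of relative
position `w`. -/
structure InCell (H : Heart) {F : QRep H.shape R} {s l : ℕ} (α : Fin s → ℤ × ℤ)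
    (α' : Fin l → ℤ × ℤ) (w : Matrix (Fin s) (Fin l) (ℤ × ℤ)) (f g : ℕ →o SubRep F) : Prop where
  left : IsFlag H α f
  right : IsFlag H α' g
  position : ∀ (i : Fin s) (j : Fin l), H.HasClass (relPos f g i j) (w i j)

/-- The objects over `Spec R` of the cell `Z_{α,α'}(w)` of the Steinberg stack `Z_{α,α'}`, `a` being
the class of the underlying object. -/
def ZCell (H : Heart) (a : ℤ × ℤ) {s l : ℕ} (α : Fin s → ℤ × ℤ) (α' : Fin l → ℤ × ℤ)
    (w : Matrix (Fin s) (Fin l) (ℤ × ℤ)) (R : Type u) [CommRing R] :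
    ObjectProperty (Flagged H.shape R (Fin 2)) :=
  fun X => H.HasClass X.F a ∧ InCell H α α' w (X.flag 0) (X.flag 1)

/-- The objects of the union `Z_{α,α'}(≤ w)` of the cells `Z_{α,α'}(w')`, `w' ≤ w`, over a field. -/
def ZLE (H : Heart) (a : ℤ × ℤ) {s l : ℕ} (α : Fin s → ℤ × ℤ) (α' : Fin l → ℤ × ℤ)
    (w : Matrix (Fin s) (Fin l) (ℤ × ℤ)) (K : Type u) [Field K] :
    ObjectProperty (Flagged H.shape K (Fin 2)) :=
  fun X => ∃ w' ∈ W α α', MatLE H w' w ∧ ZCell H a α α' w' K X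

/-! ## The sequence of elementary matrices -/

/-- A matrix of some size. -/
structure SizedMatrix where
  rows : ℕ
  cols : ℕ
  mat : Matrix (Fin rows) (Fin cols) (ℤ × ℤ)

/-- The matrix of the split of the tuple of sums of the blocks into the concatenation of the blocks:
row `i` contains the `i`-th block, in the columns occupied by that block. -/
def splitMatrix (B : List (List (ℤ × ℤ))) : SizedMatrix where
  rows := B.length
  cols := B.flatten.length
  mat i q :=
    if (B.take i).flatten.length ≤ q ∧ q < (B.take (i + 1)).flatten.length then B.flatten.get q
    else 0

/-- The transposed matrix, of the merge. -/
def mergeMatrix (B : List (List (ℤ × ℤ))) : SizedMatrix where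
  rows := (splitMatrix B).cols
  cols := (splitMatrix B).rows
  mat := (splitMatrix B).mat.transpose

/-- Exchange the entries in positions `p` and `p + 1` (counted from `0`). -/
def swapAt {A : Type} : ℕ → List A → List A
  | 0, a :: b :: L => b :: a :: L
  | p + 1, a :: L => a :: swapAt p L
  | _, L => L

/-- Group the entries in positions `p` and `p + 1`; every other entry is a block of its own. -/
def pairBlocks {A : Type} : ℕ → List A → List (List A)
  | 0, a :: b :: L => [a, b] :: L.map fun c => [c]
  | p + 1, a :: L => [a] :: pairBlocks p L
  | _, L => L.map fun c => [c]

/-- The pairs `(i, j)` in the order `(1,1), (1,2), …, (1,l), (2,1), …, (s,l)`. -/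
def rowOrder (s l : ℕ) : List (Fin s × Fin l) :=
  (List.finRange s).flatMap fun i => (List.finRange l).map fun j => (i, j)

/-- The pairs `(i, j)` in the order `(1,1), (2,1), …, (s,1), (1,2), …, (s,l)`. -/
def colOrder (s l : ℕ) : List (Fin s × Fin l) :=
  (List.finRange l).flatMap fun j => (List.finRange s).map fun i => (i, j)

/-- The word of adjacent exchanges brings `rowOrder` into `colOrder`. -/
def SortsTo (s l : ℕ) (word : List ℕ) : Prop :=
  (∀ p ∈ word, p + 1 < s * l) ∧ word.foldl (fun L p => swapAt p L) (rowOrder s l) = colOrder s l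

/-- A reduced decomposition of the permutation from `rowOrder` to `colOrder`. -/
def IsReducedWord (s l : ℕ) (word : List ℕ) : Prop :=
  SortsTo s l word ∧ ∀ word', SortsTo s l word' → word.length ≤ word'.length

/-- Each crossing is a merge of two neighbours followed by a split in the other order. -/
def crossings : List ℕ → List (ℤ × ℤ) → List SizedMatrix
  | [], _ => []
  | p :: ps, β =>
      mergeMatrix (pairBlocks p β) :: splitMatrix (pairBlocks p (swapAt p β)) ::
        crossings ps (swapAt p β)

/-- The sequence `(w₁, …, w_t)`: split every row, perform the crossings, merge every column. -/
def matrixSeq {s l : ℕ} (w : Matrix (Fin s) (Fin l) (ℤ × ℤ)) (word : List ℕ) :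
    List SizedMatrix :=
  splitMatrix ((List.finRange s).map fun i => (List.finRange l).map fun j => w i j) ::
    (crossings word ((rowOrder s l).map fun ij => w ij.1 ij.2) ++
      [mergeMatrix ((List.finRange l).map fun j => (List.finRange s).map fun i => w i j)])

/-! ## The convolution stack and its projection

A stack is described by its groupoid of objects over `Spec R` for every `ℂ`-algebra `R` (a full
subgroupoid of some `Flagged H.shape R ι`) with the pullbacks `Flagged.baseChange`. -/

variable {s l : ℕ}

/-- The objects over `Spec R` of `S(w)`: flags `F⁽⁰⁾, …, F⁽ᵗ⁾` of an object of class `a`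
such that `F⁽ᵏ⁻¹⁾, F⁽ᵏ⁾` are in relative position `w_k` (and are of the types
`β_{k-1}`, `β_k` given by the row and column sums of `w_k`). -/
def SStack (H : Heart) (a : ℤ × ℤ) (w : Matrix (Fin s) (Fin l) (ℤ × ℤ)) (word : List ℕ)
    (R : Type u) [CommRing R] :
    ObjectProperty (Flagged H.shape R (Fin ((matrixSeq w word).length + 1))) :=
  fun X => H.HasClass X.F a ∧ ∀ k : Fin (matrixSeq w word).length,
    let m := (matrixSeq w word).get k
    InCell H (fun i => ∑ j, m.mat i j) (fun j => ∑ i, m.mat i j) m.mat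
      (X.flag k.castSucc) (X.flag k.succ)

/-- `Π_{0,t}`: keep the first and the last flag. -/
def Pi0t (t : ℕ) : Flagged Q R (Fin (t + 1)) ⥤ Flagged Q R (Fin 2) :=
  Flagged.proj ![0, Fin.last t]

/-- `Π_{0,t}` commutes with pullback, i.e. it is a morphism of stacks. -/
theorem Pi0t_baseChange (t : ℕ) (R' : Type u) [CommRing R'] [Algebra R R']
    (X : Flagged Q R (Fin (t + 1))) :
    (Pi0t t).obj (X.baseChange R') = ((Pi0t t).obj X).baseChange R' := rfl

/-- `U(w) = Π_{0,t}⁻¹(Z(w))`, inside `S(w)`. -/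
def UStack (H : Heart) (a : ℤ × ℤ) (α : Fin s → ℤ × ℤ) (α' : Fin l → ℤ × ℤ)
    (w : Matrix (Fin s) (Fin l) (ℤ × ℤ)) (word : List ℕ) (R : Type u) [CommRing R] :
    ObjectProperty (Flagged H.shape R (Fin ((matrixSeq w word).length + 1))) :=
  fun X => SStack H a w word R X ∧ ZCell H a α α' w R ((Pi0t _).obj X)

/-- The restriction of `Π_{0,t}` to a functor from the groupoid `U(w)(R)` to `Z_{α,α'}(w)(R)`. -/
def PiU (H : Heart) (a : ℤ × ℤ) (α : Fin s → ℤ × ℤ) (α' : Fin l → ℤ × ℤ)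
    (w : Matrix (Fin s) (Fin l) (ℤ × ℤ)) (word : List ℕ) (R : Type u) [CommRing R] :
    (UStack H a α α' w word R).FullSubcategory ⥤ (ZCell H a α α' w R).FullSubcategory :=
  ObjectProperty.lift _ (ObjectProperty.ι _ ⋙ Pi0t _) fun X => X.property.2

end SteinbergStack

namespace SteinbergStack

/-! ## Words of adjacent exchanges -/

section Words

variable {ι : Type}

/-! Unwinding the splits and merges, a point of `S(w)` is a sequence of chains `h 0, h 1, …` in one
object, one chain for each list of pairs `(i, j)` met along the word. The graded piece of `h k` at
place `q` has class `w i j`, where `(i, j)` is the entry at place `q` of the `k`-th list. The first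
chain refines the first flag `f`, the last one refines the last flag `g`, and neighbouring chains
agree except at the single place between the two exchanged pairs (`linked_matrixSeq_iff`). Call such
a path transversal if, at every exchange, the two differing members intersect in the common member
below them and span the common member above. The theorem rests on `uStack_iff`: `U(w)` is the
transversal locus of `S(w)`.

Combinatorics. Since the word is as short as possible, each exchange moves a pair past one with
smaller row and larger column (`IsReducedWord.exchange`). Hence all lists met are linear extensions
of the product order on pairs.

Transversal paths. These are handled in a modular lattice. The flag `f` induces on each graded piece
of `h 0` a filtration with one jump, at the row of the entry. Transversality carries this through
every exchange, and the same holds for `g`, read from the last chain backwards. It follows that each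
step of each chain adds exactly `f (i+1) ⊓ g (j+1)` (`IsPath.succ_eq_sup`), and that its graded
piece is the subquotient which measures the relative position of `f` and `g`. So a transversal path
lies over `Z(w)` and is determined by its two ends. Conversely, for a pair in `Z(w)` the joins of
these intersections over initial segments of the lists form a path with the right graded pieces
(`isPathOfType_cellFlag`). As this recipe uses only lattice operations, it is respected by
isomorphisms, which gives the equivalence `piU_isEquivalence`.

Counting over a field. Compare the class of `f i ⊓ h k q` with the sum of the entries of row below
`i` among the first `q`. The difference, the `defect`, vanishes for the first chain and lies in the
positive cone afterwards (`IsPath.defect_mem_pos`). At the last chain this is the inequality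
defining `Z(≤ w)`. If the defects at the members of `g` vanish, then positivity squeezes all of them
to zero, and vanishing defects force transversality (`IsPath.isTransversal_of_defect`).

Passage to a base ring. The failure of an exchange to span is a quasi-coherent cokernel of finite
type, compatible with base change. By Nakayama and the properness of the projective line, it
vanishes over an open set, and everywhere if its fibres vanish. Once it vanishes, the corresponding
kernel vanishes too, being the kernel of an epimorphism between flat families of the same class. For
a pair in `Z(w)` the sums `f i ⊔ g j` are members of chains with flat graded pieces, so their
classes on fibres are known and the counting applies fibre by fibre. -/

theorem swapAt_append (L₁ : List ι) (a b : ι) (L₂ : List ι) :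
    swapAt L₁.length (L₁ ++ a :: b :: L₂) = L₁ ++ b :: a :: L₂ := by
  induction L₁ with
  | nil => rfl
  | cons c L ih => simp [swapAt, ih]

theorem exists_eq_append_of_lt {p : ℕ} {L : List ι} (h : p + 1 < L.length) :
    ∃ L₁ a b L₂, L = L₁ ++ a :: b :: L₂ ∧ L₁.length = p := by
  refine ⟨L.take p, L[p], L[p + 1], L.drop (p + 2), ?_, by simp; omega⟩
  rw [← List.drop_eq_getElem_cons, ← List.drop_eq_getElem_cons, List.take_append_drop]

theorem swapAt_perm (p : ℕ) (L : List ι) : (swapAt p L).Perm L := by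
  induction p, L using swapAt.induct with
  | case1 a b L => exact List.Perm.swap _ _ _
  | case2 p a L ih => exact ih.cons a
  | case3 p L h₁ h₂ => rw [swapAt]; exact h₁; exact h₂

@[simp] theorem length_swapAt (p : ℕ) (L : List ι) : (swapAt p L).length = L.length :=
  (swapAt_perm p L).length_eq

theorem swapAt_swapAt {p : ℕ} {L : List ι} (h : p + 1 < L.length) :
    swapAt p (swapAt p L) = L := by
  obtain ⟨L₁, a, b, L₂, rfl, rfl⟩ := exists_eq_append_of_lt h
  rw [swapAt_append, swapAt_append]

theorem map_swapAt {κ : Type} (f : ι → κ) (p : ℕ) (L : List ι) :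
    (swapAt p L).map f = swapAt p (L.map f) := by
  induction p, L using swapAt.induct with
  | case1 a b L => rfl
  | case2 p a L ih => simp [swapAt, ih]
  | case3 p L h₁ h₂ =>
    match p, L with
    | 0, [] => rfl
    | 0, [_] => rfl
    | 0, a :: b :: L => exact absurd rfl (h₁ a b L rfl)
    | _ + 1, [] => rfl
    | p + 1, a :: L => exact absurd rfl (h₂ p a L rfl)

/-- The result of performing a word of adjacent exchanges. -/
abbrev runWord (word : List ℕ) (L : List ι) : List ι := word.foldl (fun L p => swapAt p L) L

theorem runWord_perm (word : List ℕ) (L : List ι) : (runWord word L).Perm L := by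
  induction word generalizing L with
  | nil => exact List.Perm.refl _
  | cons p word ih => exact (ih _).trans (swapAt_perm p L)

theorem length_runWord (word : List ℕ) (L : List ι) : (runWord word L).length = L.length :=
  (runWord_perm word L).length_eq

/-- Exchanges are involutions. Read backwards, a word from `rowOrder` to `colOrder` sorts `colOrder`
into `rowOrder`, so the two orders play symmetric roles. -/
theorem runWord_reverse (word : List ℕ) (L : List ι) (h : ∀ p ∈ word, p + 1 < L.length) :
    runWord word.reverse (runWord word L) = L := by
  induction word generalizing L with
  | nil => rfl
  | cons p word ih =>
    have hw : ∀ q ∈ word, q + 1 < (swapAt p L).length := fun q hq => by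
      simpa using h q (List.mem_cons_of_mem _ hq)
    have := ih (swapAt p L) hw
    simp only [runWord, List.reverse_cons, List.foldl_append, List.foldl_cons,
      List.foldl_nil] at this ⊢
    rw [this, swapAt_swapAt (h p List.mem_cons_self)]

/-- The number of inversions of a list with respect to a numbering of its entries. -/
def inversions (key : ι → ℕ) : List ι → ℕ
  | [] => 0
  | a :: L => L.countP (fun b => key b < key a) + inversions key L

/-- Only the pair `a, b` changes its relative order: an entry of `L₁` has the same entries behind it
before and after the exchange. -/
theorem inversions_swap (key : ι → ℕ) (L₁ : List ι) {a b : ι} (L₂ : List ι)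
    (hab : key a < key b) :
    inversions key (L₁ ++ b :: a :: L₂) = inversions key (L₁ ++ a :: b :: L₂) + 1 := by
  induction L₁ with
  | nil => simp [inversions, hab, hab.le]; omega
  | cons c L ih =>
    have : (L ++ b :: a :: L₂).countP (fun x => decide (key x < key c)) =
        (L ++ a :: b :: L₂).countP (fun x => decide (key x < key c)) :=
      (List.Perm.append_left _ (List.Perm.swap _ _ _)).countP_eq _
    simp only [List.cons_append, inversions, ih, this]
    omega

theorem inversions_eq_zero (key : ι → ℕ) (L : List ι) :
    inversions key L = 0 ↔ L.Pairwise fun a b => key a ≤ key b := by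
  induction L with
  | nil => simp [inversions]
  | cons a L ih => simp [inversions, ih, List.countP_eq_zero]

theorem exists_descent (key : ι → ℕ) (L : List ι) (h : inversions key L ≠ 0) :
    ∃ L₁ a b L₂, L = L₁ ++ a :: b :: L₂ ∧ key b < key a := by
  induction L with
  | nil => exact absurd rfl h
  | cons a L ih =>
    by_cases hL : inversions key L = 0
    · match L with
      | [] => exact absurd rfl h
      | b :: L =>
        refine ⟨[], a, b, L, rfl, ?_⟩
        by_contra hab
        refine h ((inversions_eq_zero _ _).2 ?_)
        have hL' := (inversions_eq_zero _ _).1 hL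
        refine List.pairwise_cons.2 ⟨fun c hc => ?_, hL'⟩
        rcases List.mem_cons.1 hc with rfl | hc
        · omega
        · have := (List.pairwise_cons.1 hL').1 c hc
          omega
    · obtain ⟨L₁, c, d, L₂, rfl, hcd⟩ := ih hL
      exact ⟨a :: L₁, c, d, L₂, rfl, hcd⟩

/-- Bubble sort: while inversions remain, some neighbours are in descending order, and exchanging
them removes exactly one inversion. -/
theorem exists_sorting_word (key : ι → ℕ) (n : ℕ) (L : List ι) (h : inversions key L = n) :
    ∃ word : List ℕ, word.length = n ∧ (∀ p ∈ word, p + 1 < L.length) ∧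
      inversions key (runWord word L) = 0 := by
  induction n generalizing L with
  | zero => exact ⟨[], rfl, by simp, h⟩
  | succ n ih =>
    obtain ⟨L₁, a, b, L₂, rfl, hab⟩ := exists_descent key L (by omega)
    have hs := inversions_swap key L₁ L₂ hab
    obtain ⟨word, hlen, hp, hw⟩ := ih (L₁ ++ b :: a :: L₂) (by omega)
    refine ⟨L₁.length :: word, by simp [hlen], ?_, ?_⟩
    · intro p hp'
      rcases List.mem_cons.1 hp' with rfl | hp'
      · simp
      · simpa using hp p hp'
    · simpa [runWord, swapAt_append] using hw

theorem inversions_le_swapAt {key : ι → ℕ} (hkey : Function.Injective key) {L : List ι}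
    (hL : L.Nodup) (p : ℕ) (hp : p + 1 < L.length) :
    inversions key L ≤ inversions key (swapAt p L) + 1 := by
  obtain ⟨L₁, a, b, L₂, rfl, rfl⟩ := exists_eq_append_of_lt hp
  rw [swapAt_append]
  rcases lt_trichotomy (key a) (key b) with h | h | h
  · rw [inversions_swap key L₁ L₂ h]; omega
  · have := hkey h
    subst this
    exact absurd hL (by simp [List.nodup_append])
  · rw [inversions_swap key L₁ L₂ h]

theorem inversions_le_runWord {key : ι → ℕ} (hkey : Function.Injective key) {L : List ι}
    (hL : L.Nodup) (word : List ℕ) (hw : ∀ p ∈ word, p + 1 < L.length) :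
    inversions key L ≤ inversions key (runWord word L) + word.length := by
  induction word generalizing L with
  | nil => simp [runWord]
  | cons p word ih =>
    have h₁ := inversions_le_swapAt hkey hL p (hw p List.mem_cons_self)
    have h₂ := ih ((swapAt_perm p L).nodup_iff.2 hL) fun q hq => by
      simpa using hw q (List.mem_cons_of_mem _ hq)
    simp only [runWord, List.foldl_cons, List.length_cons] at h₂ ⊢
    omega

/-- In a shortest sorting word each exchange removes an inversion. -/
theorem exchange_of_length_le {key : ι → ℕ} (hkey : Function.Injective key) {L : List ι}
    (hL : L.Nodup) {u v : List ℕ} {p : ℕ} (hw : ∀ q ∈ u ++ p :: v, q + 1 < L.length)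
    (h0 : inversions key (runWord (u ++ p :: v) L) = 0)
    (hlen : (u ++ p :: v).length ≤ inversions key L) {L₁ L₂ : List ι} {a b : ι}
    (hu : runWord u L = L₁ ++ a :: b :: L₂) (hp : L₁.length = p) : key b < key a := by
  -- Otherwise this letter creates an inversion. One letter removes at most one inversion, so `u`
  -- and `v` together need at least one letter more than `inversions key L`, against the bound on
  -- the length.
  by_contra hab
  have hN : (L₁ ++ a :: b :: L₂).Nodup := hu ▸ (runWord_perm u L).nodup_iff.2 hL
  have hab' : key a < key b := lt_of_le_of_ne (not_lt.1 hab) fun h => by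
    have := hkey h
    subst this
    exact absurd hN (by simp [List.nodup_append])
  have h₁ := inversions_le_runWord hkey hL u fun q hq => hw q (by simp [hq])
  have hperm := runWord_perm (u ++ [p]) L
  have h₂ := inversions_le_runWord hkey (hperm.nodup_iff.2 hL) v fun q hq => by
    rw [hperm.length_eq]; exact hw q (by simp [hq])
  have h₃ : runWord (u ++ [p]) L = L₁ ++ b :: a :: L₂ := by
    have : runWord (u ++ [p]) L = swapAt p (runWord u L) := by simp [runWord]
    rw [this, hu, ← hp, swapAt_append]
  have h₄ : runWord v (runWord (u ++ [p]) L) = runWord (u ++ p :: v) L := by simp [runWord]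
  rw [h₄, h0, h₃, inversions_swap key L₁ L₂ hab', ← hu] at h₂
  simp only [List.length_append, List.length_cons] at hlen
  omega

end Words

/-! ### Row order, column order, and the pairs exchanged by a reduced word. -/

section Orders

variable {s l : ℕ}

/-- The position of a pair in `rowOrder`. -/
def rowKey (a : Fin s × Fin l) : ℕ := a.1 * l + a.2

/-- The position of a pair in `colOrder`. -/
def colKey (a : Fin s × Fin l) : ℕ := a.2 * s + a.1

theorem mul_add_lt_of_lt {i i' j j' l : ℕ} (h : i < i') (hj : j < l) : i * l + j < i' * l + j' := by
  have : (i + 1) * l ≤ i' * l := Nat.mul_le_mul_right _ h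
  rw [add_mul, one_mul] at this
  omega

theorem rowKey_lt_iff {a b : Fin s × Fin l} :
    rowKey a < rowKey b ↔ a.1 < b.1 ∨ a.1 = b.1 ∧ a.2 < b.2 := by
  unfold rowKey
  rcases lt_trichotomy a.1 b.1 with h | h | h
  · have := mul_add_lt_of_lt (j' := b.2) (Fin.lt_def.1 h) a.2.2
    simp [h, this]
  · simp [h]
  · have := mul_add_lt_of_lt (j' := a.2) (Fin.lt_def.1 h) b.2.2
    simp [h.not_gt, h.ne', this.le]

theorem colKey_eq_rowKey_swap (a : Fin s × Fin l) : colKey a = rowKey a.swap := rfl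

theorem colKey_lt_iff {a b : Fin s × Fin l} :
    colKey a < colKey b ↔ a.2 < b.2 ∨ a.2 = b.2 ∧ a.1 < b.1 := by
  simp [colKey_eq_rowKey_swap, rowKey_lt_iff]

theorem rowKey_injective : Function.Injective (rowKey : Fin s × Fin l → ℕ) := by
  intro a b h
  have h₁ := mt rowKey_lt_iff.2 h.not_lt
  have h₂ := mt rowKey_lt_iff.2 h.not_gt
  push Not at h₁ h₂
  have h₃ : a.1 = b.1 := le_antisymm h₂.1 h₁.1
  exact Prod.ext h₃ (le_antisymm (h₂.2 h₃.symm) (h₁.2 h₃))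

theorem colKey_injective : Function.Injective (colKey : Fin s × Fin l → ℕ) := fun _ _ h =>
  Prod.swap_injective (rowKey_injective h)

theorem colOrder_eq_map_swap : colOrder s l = (rowOrder l s).map Prod.swap := by
  simp [colOrder, rowOrder, List.map_flatMap, Function.comp_def]

theorem rowOrder_pairwise : (rowOrder s l).Pairwise fun a b => rowKey a < rowKey b := by
  rw [rowOrder, List.pairwise_flatMap]
  refine ⟨fun i _ => ?_, ?_⟩
  · rw [List.pairwise_map]
    refine (List.pairwise_lt_finRange l).imp fun {j j'} h => ?_
    exact rowKey_lt_iff.2 (Or.inr ⟨rfl, h⟩)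
  · refine (List.pairwise_lt_finRange s).imp fun {i j} h => ?_
    simp only [List.mem_map]
    rintro _ ⟨_, _, rfl⟩ _ ⟨_, _, rfl⟩
    exact rowKey_lt_iff.2 (Or.inl h)

theorem colOrder_pairwise : (colOrder s l).Pairwise fun a b => colKey a < colKey b := by
  rw [colOrder_eq_map_swap, List.pairwise_map]
  exact rowOrder_pairwise

theorem mem_rowOrder (a : Fin s × Fin l) : a ∈ rowOrder s l := by
  simp [rowOrder]

theorem rowOrder_nodup : (rowOrder s l).Nodup :=
  rowOrder_pairwise.imp fun h => by rintro rfl; exact lt_irrefl _ h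

theorem colOrder_nodup : (colOrder s l).Nodup :=
  colOrder_pairwise.imp fun h => by rintro rfl; exact lt_irrefl _ h

@[simp] theorem length_rowOrder : (rowOrder s l).length = s * l := by
  simp [rowOrder, List.length_flatMap]

@[simp] theorem length_colOrder : (colOrder s l).length = s * l := by
  simp [colOrder_eq_map_swap, mul_comm]

theorem colOrder_perm : (colOrder s l).Perm (rowOrder s l) :=
  (List.perm_ext_iff_of_nodup colOrder_nodup rowOrder_nodup).2 fun a => by
    simp [mem_rowOrder, colOrder]

theorem eq_of_inversions_eq_zero {ι : Type} {key : ι → ℕ} (hkey : Function.Injective key)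
    {L L' : List ι} (hp : L.Perm L') (h : inversions key L = 0) (h' : inversions key L' = 0) :
    L = L' :=
  hp.eq_of_pairwise (fun _ _ _ _ h₁ h₂ => hkey (le_antisymm h₁ h₂))
    ((inversions_eq_zero _ _).1 h) ((inversions_eq_zero _ _).1 h')

theorem inversions_rowOrder : inversions rowKey (rowOrder s l) = 0 :=
  (inversions_eq_zero _ _).2 (rowOrder_pairwise.imp le_of_lt)

theorem inversions_colOrder : inversions colKey (colOrder s l) = 0 :=
  (inversions_eq_zero _ _).2 (colOrder_pairwise.imp le_of_lt)

/-- In a reduced word, each exchange moves an entry past one which is in a higher row and in an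
earlier column. -/
theorem IsReducedWord.exchange {word : List ℕ} (h : IsReducedWord s l word) {u v : List ℕ} {p : ℕ}
    (hw : word = u ++ p :: v) {L₁ L₂ : List (Fin s × Fin l)} {a b : Fin s × Fin l}
    (hu : runWord u (rowOrder s l) = L₁ ++ a :: b :: L₂) (hp : L₁.length = p) :
    a.1 < b.1 ∧ b.2 < a.2 := by
  obtain ⟨⟨hlt, hrun⟩, hmin⟩ := h
  subst hw
  have hcol : colKey b < colKey a := by
    refine exchange_of_length_le colKey_injective rowOrder_nodup (u := u) (v := v) (p := p)
      (by simpa using hlt) ?_ ?_ hu hp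
    · simp only [runWord, hrun, inversions_colOrder]
    -- The bubble sort word is a competitor, so minimality bounds the length of `word` by the number
    -- of inversions.
    · obtain ⟨word', hlen, hlt', h0⟩ := exists_sorting_word colKey _ (rowOrder s l) rfl
      rw [← hlen]
      refine hmin word' ⟨by simpa using hlt', ?_⟩
      exact eq_of_inversions_eq_zero colKey_injective
        ((runWord_perm _ _).trans colOrder_perm.symm) h0 inversions_colOrder
  -- The same argument for the reversed word, which sorts `colOrder` into `rowOrder`, is also
  -- shortest, and meets this exchange with `b` in front of `a`.
  have hrow : rowKey a < rowKey b := by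
    have hM : runWord (u ++ [p]) (rowOrder s l) = L₁ ++ b :: a :: L₂ := by
      have : runWord (u ++ [p]) (rowOrder s l) = swapAt p (runWord u (rowOrder s l)) := by
        simp [runWord]
      rw [this, hu, ← hp, swapAt_append]
    have hv : runWord v.reverse (colOrder s l) = L₁ ++ b :: a :: L₂ := by
      have : colOrder s l = runWord v (runWord (u ++ [p]) (rowOrder s l)) := by
        rw [← hrun]; simp [runWord]
      rw [this, runWord_reverse, hM]
      intro q hq
      rw [length_runWord, length_rowOrder]
      exact hlt q (by simp [hq])
    have hrev : v.reverse ++ p :: u.reverse = (u ++ p :: v).reverse := by simp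
    have hback : runWord (v.reverse ++ p :: u.reverse) (colOrder s l) = rowOrder s l := by
      rw [hrev, ← hrun]
      exact runWord_reverse _ _ (by simpa using hlt)
    refine exchange_of_length_le rowKey_injective colOrder_nodup (u := v.reverse) (v := u.reverse)
      (p := p) ?_ ?_ ?_ hv hp
    · intro q hq
      rw [hrev, List.mem_reverse] at hq
      simpa using hlt q hq
    · rw [hback, inversions_rowOrder]
    · obtain ⟨word', hlen, hlt', h0⟩ := exists_sorting_word rowKey _ (colOrder s l) rfl
      rw [← hlen, hrev, List.length_reverse, ← List.length_reverse (as := word')]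
      refine hmin word'.reverse ⟨by simpa using hlt', ?_⟩
      have : runWord word' (colOrder s l) = rowOrder s l :=
        eq_of_inversions_eq_zero rowKey_injective
          ((runWord_perm _ _).trans colOrder_perm) h0 inversions_rowOrder
      rw [← this]
      exact runWord_reverse _ _ hlt'
  rw [rowKey_lt_iff] at hrow
  rw [colKey_lt_iff] at hcol
  -- The pair `a` precedes `b` in the row order and follows it in the column order; a common row or
  -- a common column would give the same order twice.
  omega

end Orders

end SteinbergStack

namespace SteinbergStack

/-! ## The lists of pairs met along a word -/

section Stages

variable {s l : ℕ}

/-- The keys are `s * l` distinct numbers below `s * l` in increasing order, so there is only one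
possibility. Thus `rowKey` is the position of a pair in `rowOrder`. -/
theorem map_rowKey_rowOrder : (rowOrder s l).map rowKey = List.range (s * l) := by
  have hlt : ∀ x ∈ (rowOrder s l).map rowKey, x < s * l := by
    simp only [List.mem_map]
    rintro _ ⟨a, _, rfl⟩
    have := mul_add_lt_of_lt (j' := 0) a.1.2 a.2.2
    simpa [rowKey] using this
  have hnd : ((rowOrder s l).map rowKey).Nodup := rowOrder_nodup.map rowKey_injective
  have hperm : ((rowOrder s l).map rowKey).Perm (List.range (s * l)) :=
    (hnd.subperm fun x hx => List.mem_range.2 (hlt x hx)).perm_of_length_le (by simp)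
  refine hperm.eq_of_pairwise (le := (· < ·)) (fun _ _ _ _ h₁ h₂ => absurd h₁ h₂.not_gt) ?_
    List.pairwise_lt_range
  rw [List.pairwise_map]
  exact rowOrder_pairwise

theorem getElem?_rowOrder {q : ℕ} {a : Fin s × Fin l} :
    (rowOrder s l)[q]? = some a ↔ q = rowKey a := by
  have key : ∀ {q : ℕ} {a : Fin s × Fin l}, (rowOrder s l)[q]? = some a → q = rowKey a := by
    intro q a h
    have h' : ((rowOrder s l).map rowKey)[q]? = some (rowKey a) := by simp [h]
    rw [map_rowKey_rowOrder] at h'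
    obtain ⟨hq, h'⟩ := List.getElem?_eq_some_iff.1 h'
    simpa using h'
  refine ⟨key, ?_⟩
  rintro rfl
  obtain ⟨q, hq⟩ := List.mem_iff_getElem?.1 (mem_rowOrder a)
  rwa [← key hq]

theorem getElem?_colOrder {q : ℕ} {a : Fin s × Fin l} :
    (colOrder s l)[q]? = some a ↔ q = colKey a := by
  rw [colOrder_eq_map_swap, List.getElem?_map, Option.map_eq_some_iff]
  constructor
  · rintro ⟨b, hb, rfl⟩
    exact getElem?_rowOrder.1 hb
  · exact fun h => ⟨a.swap, getElem?_rowOrder.2 h, by simp⟩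

/-- The order of the pairs after `k` exchanges. -/
def stage (s l : ℕ) (word : List ℕ) (k : ℕ) : List (Fin s × Fin l) :=
  runWord (word.take k) (rowOrder s l)

@[simp] theorem stage_zero (word : List ℕ) : stage s l word 0 = rowOrder s l := rfl

theorem stage_perm (word : List ℕ) (k : ℕ) : (stage s l word k).Perm (rowOrder s l) :=
  runWord_perm _ _

@[simp] theorem length_stage (word : List ℕ) (k : ℕ) : (stage s l word k).length = s * l := by
  rw [(stage_perm word k).length_eq, length_rowOrder]

theorem stage_succ {word : List ℕ} {k : ℕ} (hk : k < word.length) :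
    stage s l word (k + 1) = swapAt word[k] (stage s l word k) := by
  rw [stage, stage, List.take_add_one, List.getElem?_eq_getElem hk]
  simp only [runWord, Option.toList_some, List.foldl_append, List.foldl_cons, List.foldl_nil]

theorem IsReducedWord.stage_length {word : List ℕ} (h : IsReducedWord s l word) :
    stage s l word word.length = colOrder s l := by
  rw [stage, List.take_length]
  exact h.1.2

theorem IsReducedWord.exists_exchange {word : List ℕ} (h : IsReducedWord s l word) {k : ℕ}
    (hk : k < word.length) :
    ∃ L₁ a b L₂, stage s l word k = L₁ ++ a :: b :: L₂ ∧
      stage s l word (k + 1) = L₁ ++ b :: a :: L₂ ∧ L₁.length = word[k] ∧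
      a.1 < b.1 ∧ b.2 < a.2 := by
  have hlt : word[k] + 1 < (stage s l word k).length := by
    rw [length_stage]; exact h.1.1 _ (List.getElem_mem hk)
  obtain ⟨L₁, a, b, L₂, hL, hp⟩ := exists_eq_append_of_lt hlt
  refine ⟨L₁, a, b, L₂, hL, ?_, hp, ?_⟩
  · rw [stage_succ hk, hL, ← hp, swapAt_append]
  · refine h.exchange (u := word.take k) (v := word.drop (k + 1)) (p := word[k]) ?_ hL hp
    rw [← List.drop_eq_getElem_cons, List.take_append_drop]

/-- Earlier entries are not above later ones in the product order. -/
def Admissible (L : List (Fin s × Fin l)) : Prop := L.Pairwise fun x y => x.1 < y.1 ∨ x.2 < y.2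

theorem admissible_rowOrder : Admissible (rowOrder s l) :=
  rowOrder_pairwise.imp fun h => by
    rcases rowKey_lt_iff.1 h with h | h
    · exact Or.inl h
    · exact Or.inr h.2

/-- An exchange reverses the order of one pair of entries only, and these two are incomparable in
the product order. -/
theorem IsReducedWord.admissible_stage {word : List ℕ} (h : IsReducedWord s l word) {k : ℕ}
    (hk : k ≤ word.length) : Admissible (stage s l word k) := by
  induction k with
  | zero => exact admissible_rowOrder
  | succ k ih =>
    obtain ⟨L₁, a, b, L₂, h₁, h₂, -, -, hab⟩ := h.exists_exchange hk
    have := ih (by omega)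
    unfold Admissible at this ⊢
    rw [h₁] at this
    rw [h₂]
    simp only [List.pairwise_append, List.pairwise_cons, List.mem_cons, forall_eq_or_imp] at this ⊢
    obtain ⟨t₁, ⟨⟨-, t₂⟩, t₃, t₄⟩, t₅⟩ := this
    exact ⟨t₁, ⟨⟨Or.inr hab, t₃⟩, t₂, t₄⟩, fun x hx => ⟨(t₅ x hx).2.1, (t₅ x hx).1, (t₅ x hx).2.2⟩⟩

theorem Admissible.of_lt {L : List (Fin s × Fin l)} (h : Admissible L) {q q' : ℕ}
    {x y : Fin s × Fin l} (hx : L[q]? = some x) (hy : L[q']? = some y) (hq : q < q') :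
    x.1 < y.1 ∨ x.2 < y.2 := by
  obtain ⟨hq₁, rfl⟩ := List.getElem?_eq_some_iff.1 hx
  obtain ⟨hq₂, rfl⟩ := List.getElem?_eq_some_iff.1 hy
  exact List.pairwise_iff_getElem.1 h _ _ _ _ hq

end Stages

theorem getElem?_swap {ι : Type} {L₁ L₂ : List ι} {a b c : ι} {q : ℕ}
    (h : (L₁ ++ b :: a :: L₂)[q]? = some c) :
    (q = L₁.length ∧ c = b) ∨ (q = L₁.length + 1 ∧ c = a) ∨
      (q ≠ L₁.length ∧ q ≠ L₁.length + 1 ∧ (L₁ ++ a :: b :: L₂)[q]? = some c) := by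
  rcases lt_or_ge q L₁.length with hq | hq
  · refine Or.inr (Or.inr ⟨by omega, by omega, ?_⟩)
    rwa [List.getElem?_append_left hq] at h ⊢
  · obtain ⟨m, rfl⟩ := Nat.exists_eq_add_of_le hq
    rw [List.getElem?_append_right hq] at h ⊢
    match m with
    | 0 => left; simpa [eq_comm] using h
    | 1 => right; left; simpa [eq_comm] using h
    | m + 2 => right; right; simpa [add_assoc] using h

/-! ## Transversal chains in a modular lattice -/

section Lattice

variable {𝓛 : Type*} [Lattice 𝓛] {ι : Type}

/-- The filtration `f` induces on the quotient `h (q + 1) / h q` a filtration with the single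
jump at `r a`, where `a` is the entry of `L` in position `q`. -/
def InducedJumps (r : ι → ℕ) (f h : ℕ → 𝓛) (L : List ι) : Prop :=
  ∀ q a, L[q]? = some a → ∀ i, (i ≤ r a → f i ⊓ h (q + 1) ≤ h q) ∧
    (r a < i → h (q + 1) ≤ h q ⊔ f i ⊓ h (q + 1))

/-- Descend from the top of `h`. At a place `m ≥ q` one of the two flags has not yet reached its
jump, so the element, which lies in both `f i` and `g j`, drops from `h (m + 1)` into `h m`. -/
theorem le_of_forall_jumps {s l : ℕ} {f g h : ℕ → 𝓛} {L : List (Fin s × Fin l)}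
    (hf : InducedJumps (fun a : Fin s × Fin l => (a.1 : ℕ)) f h L)
    (hg : InducedJumps (fun a : Fin s × Fin l => (a.2 : ℕ)) g h L)
    {x : 𝓛} (htop : x ≤ h L.length) {i j q : ℕ} (hx : x ≤ f i ⊓ g j) (hq : q ≤ L.length)
    (hc : ∀ m c, q ≤ m → L[m]? = some c → i ≤ c.1 ∨ j ≤ c.2) : x ≤ h q := by
  refine Nat.decreasingInduction' (P := fun m => x ≤ h m) (fun m hm hqm ih => ?_) hq
    htop
  obtain ⟨c, hc'⟩ : ∃ c, L[m]? = some c := ⟨_, List.getElem?_eq_getElem hm⟩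
  rcases hc m c hqm hc' with hi | hj
  · exact (le_inf (hx.trans inf_le_left) ih).trans ((hf m c hc' i).1 hi)
  · exact (le_inf (hx.trans inf_le_right) ih).trans ((hg m c hc' j).1 hj)

variable [IsModularLattice 𝓛]

/-- With `p = L₁.length`, transversality identifies `h' (p + 1) / h p` with `h (p + 2) / h (p + 1)`,
and `h (p + 2) / h' (p + 1)` with `h (p + 1) / h p`, so the two jumps should trade places. The
inequality `r a < r b` matters: in the opposite case some `f i` could cut out a complement of `h (p
+ 1)` modulo `h p` other than `h' (p + 1)`. -/
theorem InducedJumps.exchange {r : ι → ℕ} {f h h' : ℕ → 𝓛} {L₁ L₂ : List ι} {a b : ι}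
    (hI : InducedJumps r f h (L₁ ++ a :: b :: L₂)) (hab : r a < r b) (hmono : Monotone h)
    (hmono' : Monotone h') (heq : ∀ q, q ≠ L₁.length + 1 → h' q = h q)
    (hinf : h (L₁.length + 1) ⊓ h' (L₁.length + 1) ≤ h L₁.length)
    (hsup : h (L₁.length + 2) ≤ h (L₁.length + 1) ⊔ h' (L₁.length + 1)) :
    InducedJumps r f h' (L₁ ++ b :: a :: L₂) := by
  set p := L₁.length with hp
  have ha := hI p a (by simp [hp])
  have hb := hI (p + 1) b (by simp [hp])
  have e₀ : h' p = h p := heq p (by omega)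
  have e₂ : h' (p + 2) = h (p + 2) := heq _ (by omega)
  have m₂ : h' (p + 1) ≤ h (p + 2) := e₂ ▸ hmono' (by omega)
  have m₀ : h p ≤ h' (p + 1) := e₀ ▸ hmono' (by omega)
  intro q c hq i
  rcases getElem?_swap hq with ⟨rfl, rfl⟩ | ⟨rfl, rfl⟩ | ⟨hq₀, hq₁, hq'⟩
  · rw [← hp, e₀]
    refine ⟨fun hi => ?_, fun hi => ?_⟩
    · have h₁ : f i ⊓ h' (p + 1) ≤ h (p + 1) :=
        (inf_le_inf_left _ m₂).trans ((hb i).1 hi)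
      exact (le_inf h₁ inf_le_right).trans hinf
    · have h₁ : h (p + 2) ≤ h p ⊔ f i ⊓ h (p + 2) := by
        refine ((hb i).2 hi).trans (sup_le (((ha i).2 (hab.trans hi)).trans ?_) le_sup_right)
        exact sup_le_sup_left (inf_le_inf_left _ (hmono (by omega))) _
      -- Past both jumps, `f i` spans all of `h (p + 2)` modulo `h p`; the modular law, applicable
      -- as `h p ≤ h' (p + 1)`, cuts this down to `h' (p + 1)`.
      calc h' (p + 1) ≤ (h p ⊔ f i ⊓ h (p + 2)) ⊓ h' (p + 1) := le_inf (m₂.trans h₁) le_rfl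
        _ = h p ⊔ f i ⊓ h (p + 2) ⊓ h' (p + 1) := sup_inf_assoc_of_le _ m₀
        _ ≤ h p ⊔ f i ⊓ h' (p + 1) := sup_le_sup_left (inf_le_inf_right _ inf_le_left) _
  · rw [← hp, add_assoc, e₂]
    refine ⟨fun hi => ?_, fun hi => ?_⟩
    · have h₁ : f i ⊓ h (p + 2) ≤ h (p + 1) := (hb i).1 (hi.trans hab.le)
      exact ((le_inf inf_le_left h₁).trans ((ha i).1 hi)).trans m₀
    · refine hsup.trans (sup_le (((ha i).2 hi).trans (sup_le (m₀.trans le_sup_left) ?_))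
        le_sup_left)
      exact (inf_le_inf_left _ (hmono (by omega))).trans le_sup_right
  · have := hI q c hq' i
    rwa [heq q (by omega), heq (q + 1) (by omega)]

/-- Two applications of the modular law. The denominator of a relative position is thereby the trace
of `f ⊔ g` on `f' ⊓ g'`. -/
theorem inf_inf_sup_eq {f f' g g' : 𝓛} (hf : f ≤ f') (hg : g ≤ g') :
    f' ⊓ g' ⊓ (f ⊔ g) = f ⊓ g' ⊔ f' ⊓ g := by
  rw [inf_comm f' g', inf_assoc, inf_comm f', sup_inf_assoc_of_le g hf, inf_comm g f', sup_comm,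
    inf_comm g', sup_inf_assoc_of_le f (inf_le_right.trans hg), sup_comm]

variable [BoundedOrder 𝓛] {s l : ℕ}

/-- The chains attached to a word of exchanges: the first refines `f`, the last one refines `g`, and
each differs from the next only in the position of the exchange. -/
structure IsPath (word : List ℕ) (f g : ℕ →o 𝓛) (h : ℕ → ℕ →o 𝓛) : Prop where
  zero : ∀ k ≤ word.length, h k 0 = ⊥
  top : ∀ k ≤ word.length, h k (s * l) = ⊤
  left : ∀ i ≤ s, f i = h 0 (i * l)
  right : ∀ j ≤ l, g j = h word.length (j * s)
  step : ∀ k (hk : k < word.length) q, q ≠ word[k] + 1 → h (k + 1) q = h k q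

/-- Consecutive chains are transversal in the positions of the exchanges. -/
structure IsTransversal (word : List ℕ) (h : ℕ → ℕ →o 𝓛) : Prop where
  inf_le : ∀ k (hk : k < word.length),
    h k (word[k] + 1) ⊓ h (k + 1) (word[k] + 1) ≤ h k word[k]
  le_sup : ∀ k (hk : k < word.length),
    h k (word[k] + 2) ≤ h k (word[k] + 1) ⊔ h (k + 1) (word[k] + 1)

/-- The intersection `f (i + 1) ⊓ g (j + 1)`. -/
def cellInf (f g : ℕ → 𝓛) (a : Fin s × Fin l) : 𝓛 := f (a.1 + 1) ⊓ g (a.2 + 1)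

/-! ### Transversal paths are determined by their two end flags. -/

namespace IsPath

variable {word : List ℕ} {f g : ℕ →o 𝓛} {h : ℕ → ℕ →o 𝓛}

/-- The first chain refines `f`, so there each step is inside or beyond any given `f i`. The
exchanges preserve the jumps because the entry moved to the right has the smaller row. -/
theorem jumps_left (hP : IsPath (s := s) (l := l) word f g h) (hT : IsTransversal word h)
    (hw : IsReducedWord s l word) {k : ℕ} (hk : k ≤ word.length) :
    InducedJumps (fun a : Fin s × Fin l => (a.1 : ℕ)) f (h k) (stage s l word k) := by
  induction k with
  | zero =>
    intro q a hq i
    rw [stage_zero, getElem?_rowOrder] at hq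
    subst hq
    have h₁ : f a.1 ≤ h 0 (rowKey a) := by
      rw [hP.left _ a.1.2.le]
      exact (h 0).monotone (Nat.le_add_right _ _)
    have h₂ : h 0 (rowKey a + 1) ≤ f (a.1 + 1) := by
      rw [hP.left _ a.1.2]
      refine (h 0).monotone ?_
      rw [rowKey, Nat.succ_mul]
      omega
    exact ⟨fun hi => inf_le_left.trans ((f.monotone hi).trans h₁), fun hi =>
      le_sup_of_le_right (le_inf (h₂.trans (f.monotone hi)) le_rfl)⟩
  | succ k ih =>
    obtain ⟨L₁, a, b, L₂, h₁, h₂, hp, hab, -⟩ := hw.exists_exchange hk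
    have := ih (by omega)
    rw [h₁] at this
    rw [h₂]
    refine this.exchange (by simpa using hab) (h k).monotone (h (k + 1)).monotone ?_ ?_ ?_
    · rw [hp]; exact hP.step k hk
    · rw [hp]; exact hT.inf_le k hk
    · rw [hp]; exact hT.le_sup k hk

/-- Mirror image of `jumps_left`: start from the last chain, which refines `g`, and undo the
exchanges. Backwards, it is the entry with the smaller column that moves to the right. -/
theorem jumps_right (hP : IsPath (s := s) (l := l) word f g h) (hT : IsTransversal word h)
    (hw : IsReducedWord s l word) {k : ℕ} (hk : k ≤ word.length) :
    InducedJumps (fun a : Fin s × Fin l => (a.2 : ℕ)) g (h k) (stage s l word k) := by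
  refine Nat.decreasingInduction' (P := fun k =>
    InducedJumps (fun a : Fin s × Fin l => (a.2 : ℕ)) g (h k) (stage s l word k)) ?_ hk ?_
  · intro k hk _ ih
    obtain ⟨L₁, a, b, L₂, h₁, h₂, hp, -, hab⟩ := hw.exists_exchange hk
    rw [h₂] at ih
    rw [h₁]
    refine ih.exchange (by simpa using hab) (h (k + 1)).monotone (h k).monotone ?_ ?_ ?_
    · rw [hp]; exact fun q hq => (hP.step k hk q hq).symm
    · rw [hp, inf_comm, hP.step k hk word[k] (by omega)]; exact hT.inf_le k hk
    · rw [hp, sup_comm, hP.step k hk (word[k] + 2) (by omega)]; exact hT.le_sup k hk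
  · intro q a hq i
    rw [hw.stage_length, getElem?_colOrder] at hq
    subst hq
    have h₁ : g a.2 ≤ h word.length (colKey a) := by
      rw [hP.right _ a.2.2.le]
      exact (h _).monotone (Nat.le_add_right _ _)
    have h₂ : h word.length (colKey a + 1) ≤ g (a.2 + 1) := by
      rw [hP.right _ a.2.2]
      refine (h _).monotone ?_
      rw [colKey, Nat.succ_mul]
      omega
    exact ⟨fun hi => inf_le_left.trans ((g.monotone hi).trans h₁), fun hi =>
      le_sup_of_le_right (le_inf (h₂.trans (g.monotone hi)) le_rfl)⟩

/-- An entry behind `a` in an admissible list has a larger row or a larger column than `a`, so no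
graded piece beyond `q` can see `f (a.1 + 1) ⊓ g (a.2 + 1)`. -/
theorem cellInf_le (hP : IsPath (s := s) (l := l) word f g h) (hT : IsTransversal word h)
    (hw : IsReducedWord s l word) {k : ℕ} (hk : k ≤ word.length) {q : ℕ} {a : Fin s × Fin l}
    (hq : (stage s l word k)[q]? = some a) : cellInf f g a ≤ h k (q + 1) := by
  refine le_of_forall_jumps (hP.jumps_left hT hw hk) (hP.jumps_right hT hw hk)
    (by rw [length_stage, hP.top k hk]; exact le_top) (i := a.1 + 1) (j := a.2 + 1) le_rfl
    (List.getElem?_eq_some_iff.1 hq).1 fun m c hm hc => ?_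
  have := (hw.admissible_stage hk).of_lt hq hc (by omega)
  omega

/-- In the first chain the step belonging to `a` lies in `f (a.1 + 1)`, and `g` has its jump there
at `a.2`. At an exchange, both new steps are compared with the two old ones: the intersection
condition, through the modular law, gives the lower step, and the spanning condition gives the upper
one. -/
theorem succ_eq_sup (hP : IsPath (s := s) (l := l) word f g h) (hT : IsTransversal word h)
    (hw : IsReducedWord s l word) {k : ℕ} (hk : k ≤ word.length) {q : ℕ} {a : Fin s × Fin l}
    (hq : (stage s l word k)[q]? = some a) : h k (q + 1) = h k q ⊔ cellInf f g a := by
  refine le_antisymm ?_ (sup_le ((h k).monotone (by omega)) (hP.cellInf_le hT hw hk hq))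
  induction k generalizing q a with
  | zero =>
    have h₁ := (hP.jumps_right hT hw hk q a hq (a.2 + 1)).2 (by simp)
    refine h₁.trans (sup_le_sup_left (le_inf (inf_le_right.trans ?_) inf_le_left) _)
    rw [stage_zero, getElem?_rowOrder] at hq
    rw [hq, hP.left _ a.1.2]
    refine (h 0).monotone ?_
    rw [rowKey, Nat.succ_mul]
    omega
  | succ k ih =>
    obtain ⟨L₁, b, c, L₂, h₁, h₂, hp, -⟩ := hw.exists_exchange hk
    have hb : (stage s l word k)[L₁.length]? = some b := by rw [h₁]; simp
    have hc : (stage s l word k)[L₁.length + 1]? = some c := by rw [h₁]; simp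
    have hc' : (stage s l word (k + 1))[L₁.length]? = some c := by rw [h₂]; simp
    have ib := ih (by omega) hb
    have ic := ih (by omega) hc
    have lb := hP.cellInf_le hT hw (by omega) hb
    have lc := hP.cellInf_le hT hw hk hc'
    have hinf := hT.inf_le k hk
    have hsup := hT.le_sup k hk
    have hst := hP.step k hk
    rw [← hp] at hinf hsup hst
    have m₀ : h k L₁.length ≤ h (k + 1) (L₁.length + 1) := by
      rw [← hst _ (by omega)]; exact (h (k + 1)).monotone (by omega)
    have m₂ : h (k + 1) (L₁.length + 1) ≤ h k (L₁.length + 2) := by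
      rw [← hst _ (by omega)]; exact (h (k + 1)).monotone (by omega)
    rw [h₂] at hq
    rcases getElem?_swap hq with ⟨rfl, rfl⟩ | ⟨rfl, rfl⟩ | ⟨hq₀, hq₁, hq'⟩
    · rw [hst _ (by omega : L₁.length ≠ L₁.length + 1)]
      have h₃ : h k (L₁.length + 2) ≤ (h k L₁.length ⊔ cellInf f g a) ⊔ cellInf f g b := by
        refine ic.trans (sup_le (ib.trans (sup_le ?_ le_sup_right)) ?_)
        · exact le_sup_left.trans le_sup_left
        · exact le_sup_right.trans le_sup_left
      calc h (k + 1) (L₁.length + 1)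
          ≤ ((h k L₁.length ⊔ cellInf f g a) ⊔ cellInf f g b) ⊓ h (k + 1) (L₁.length + 1) :=
            le_inf (m₂.trans h₃) le_rfl
        -- Modular law. The last term is contained in both of the transversal members, hence in
        -- their intersection, which is `h k L₁.length`.
        _ = (h k L₁.length ⊔ cellInf f g a) ⊔ cellInf f g b ⊓ h (k + 1) (L₁.length + 1) :=
            sup_inf_assoc_of_le _ (sup_le m₀ lc)
        _ ≤ h k L₁.length ⊔ cellInf f g a := by
            refine sup_le le_rfl (le_sup_of_le_left ((inf_le_inf_right _ lb).trans hinf))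
    · rw [add_assoc, hst _ (by omega : L₁.length + (1 + 1) ≠ L₁.length + 1)]
      exact hsup.trans (sup_le (ib.trans (sup_le_sup_right m₀ _)) le_sup_left)
    · rw [hst _ (by omega : q + 1 ≠ L₁.length + 1), hst _ (by omega : q ≠ L₁.length + 1)]
      exact ih (by omega) (h₁ ▸ hq')

/-- The member `h k q` is the join of the intersections attached to earlier entries, and by
admissibility each of these lies in `f a.1` or in `g a.2`. Together with `succ_eq_sup`, this
identifies the graded piece of `h k` at `q` with the relative position of `f` and `g` at `a`. -/
theorem cellInf_inf_eq (hP : IsPath (s := s) (l := l) word f g h) (hT : IsTransversal word h)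
    (hw : IsReducedWord s l word) {k : ℕ} (hk : k ≤ word.length) {q : ℕ} {a : Fin s × Fin l}
    (hq : (stage s l word k)[q]? = some a) :
    cellInf f g a ⊓ h k q = f a.1 ⊓ g (a.2 + 1) ⊔ f (a.1 + 1) ⊓ g a.2 := by
  have hlen : q < (stage s l word k).length := (List.getElem?_eq_some_iff.1 hq).1
  refine le_antisymm ?_ ?_
  · rw [← inf_inf_sup_eq (f.monotone (Nat.le_succ _)) (g.monotone (Nat.le_succ _))]
    refine inf_le_inf_left _ ?_
    suffices ∀ m ≤ q, h k m ≤ f a.1 ⊔ g a.2 from this q le_rfl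
    intro m
    induction m with
    | zero => intro _; rw [hP.zero k hk]; exact bot_le
    | succ m ih =>
      intro hm
      have hc : (stage s l word k)[m]? = some ((stage s l word k)[m]'(by omega)) :=
        List.getElem?_eq_getElem _
      rw [hP.succ_eq_sup hT hw hk hc]
      refine sup_le (ih (by omega)) ?_
      rcases (hw.admissible_stage hk).of_lt hc hq (by omega) with h₁ | h₁
      · exact (inf_le_left.trans (f.monotone h₁)).trans le_sup_left
      · exact (inf_le_right.trans (g.monotone h₁)).trans le_sup_right
  · refine sup_le (le_inf (inf_le_inf_right _ (f.monotone (Nat.le_succ _))) ?_)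
      (le_inf (inf_le_inf_left _ (g.monotone (Nat.le_succ _))) ?_)
    · refine le_of_forall_jumps (hP.jumps_left hT hw hk) (hP.jumps_right hT hw hk)
        (by rw [length_stage, hP.top k hk]; exact le_top) (i := a.1) (j := a.2 + 1) le_rfl hlen.le fun m c hm hc => ?_
      rcases hm.lt_or_eq with hm | rfl
      · have := (hw.admissible_stage hk).of_lt hq hc hm
        omega
      · rw [hq] at hc; simp_all
    · refine le_of_forall_jumps (hP.jumps_left hT hw hk) (hP.jumps_right hT hw hk)
        (by rw [length_stage, hP.top k hk]; exact le_top) (i := a.1 + 1) (j := a.2) le_rfl hlen.le fun m c hm hc => ?_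
      rcases hm.lt_or_eq with hm | rfl
      · have := (hw.admissible_stage hk).of_lt hq hc hm
        omega
      · rw [hq] at hc; simp_all

end IsPath

end Lattice

end SteinbergStack

namespace SteinbergStack

/-! ## The chain generated by the intersections of two chains -/

theorem mem_take_iff_getElem? {ι : Type} {L : List ι} {q : ℕ} {a : ι} :
    a ∈ L.take q ↔ ∃ m < q, L[m]? = some a := by
  rw [List.mem_iff_getElem?]
  constructor
  · rintro ⟨m, hm⟩
    rw [List.getElem?_take] at hm
    split_ifs at hm with h
    exact ⟨m, h, hm⟩
  · rintro ⟨m, h, hm⟩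
    exact ⟨m, by rw [List.getElem?_take, if_pos h, hm]⟩

theorem take_add_one_of_getElem? {ι : Type} {L : List ι} {q : ℕ} {a : ι} (h : L[q]? = some a) :
    L.take (q + 1) = L.take q ++ [a] := by
  rw [List.take_add_one, h, Option.toList_some]

theorem take_swap_perm {ι : Type} (L₁ : List ι) (a b : ι) (L₂ : List ι) {q : ℕ}
    (hq : q ≠ L₁.length + 1) :
    ((L₁ ++ b :: a :: L₂).take q).Perm ((L₁ ++ a :: b :: L₂).take q) := by
  rcases Nat.lt_or_ge L₁.length q with h | h
  · obtain ⟨m, rfl⟩ : ∃ m, q = L₁.length + (m + 2) := ⟨q - L₁.length - 2, by omega⟩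
    rw [List.take_length_add_append, List.take_length_add_append]
    exact List.Perm.append_left _ (List.Perm.swap _ _ _)
  · rw [List.take_append_of_le_length h, List.take_append_of_le_length h]

theorem mem_take_rowOrder {s l i : ℕ} {c : Fin s × Fin l} :
    c ∈ (rowOrder s l).take (i * l) ↔ (c.1 : ℕ) < i := by
  rw [mem_take_iff_getElem?]
  simp only [getElem?_rowOrder, exists_eq_right]
  constructor
  · intro h
    by_contra hi
    have : i * l ≤ c.1 * l := Nat.mul_le_mul_right _ (not_lt.1 hi)
    unfold rowKey at h
    omega
  · intro h
    have := mul_add_lt_of_lt (j' := 0) h c.2.2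
    simpa [rowKey] using this

theorem mem_take_colOrder {s l j : ℕ} {c : Fin s × Fin l} :
    c ∈ (colOrder s l).take (j * s) ↔ (c.2 : ℕ) < j := by
  rw [colOrder_eq_map_swap, ← List.map_take, List.mem_map]
  constructor
  · rintro ⟨b, hb, rfl⟩
    exact mem_take_rowOrder.1 hb
  · exact fun h => ⟨c.swap, mem_take_rowOrder.2 h, by simp⟩

section CellFlag

variable {𝓛 : Type*} [Lattice 𝓛] [BoundedOrder 𝓛] {s l : ℕ}

/-- The chain of the suprema of the intersections `f (i + 1) ⊓ g (j + 1)`, with `(i, j)` running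
through the initial segments of `L`. -/
def cellFlag (f g : ℕ → 𝓛) (L : List (Fin s × Fin l)) : ℕ →o 𝓛 where
  toFun q := (L.take q).toFinset.sup (cellInf f g)
  monotone' p q h := Finset.sup_mono fun a ha => by
    rw [List.mem_toFinset, mem_take_iff_getElem?] at ha ⊢
    obtain ⟨m, hm, e⟩ := ha
    exact ⟨m, hm.trans_le h, e⟩

variable {f g : ℕ →o 𝓛} {L : List (Fin s × Fin l)}

theorem cellFlag_apply (q : ℕ) :
    cellFlag f g L q = (L.take q).toFinset.sup (cellInf f g) := rfl

@[simp] theorem cellFlag_zero : cellFlag f g L 0 = ⊥ := by simp [cellFlag_apply]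

theorem cellFlag_succ {q : ℕ} {a : Fin s × Fin l} (h : L[q]? = some a) :
    cellFlag f g L (q + 1) = cellFlag f g L q ⊔ cellInf f g a := by
  rw [cellFlag_apply, cellFlag_apply, take_add_one_of_getElem? h, List.toFinset_append,
    Finset.sup_union]
  simp

theorem cellFlag_congr {L' : List (Fin s × Fin l)} {q : ℕ} (h : (L.take q).Perm (L'.take q)) :
    cellFlag f g L q = cellFlag f g L' q := by
  rw [cellFlag_apply, cellFlag_apply, List.toFinset_eq_of_perm _ _ h]

theorem cellFlag_le {q : ℕ} {x : 𝓛} (h : ∀ c ∈ L.take q, cellInf f g c ≤ x) :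
    cellFlag f g L q ≤ x :=
  Finset.sup_le fun c hc => h c (List.mem_toFinset.1 hc)

/-- For positive indices the left side is itself one of the joined intersections, that of the pair
`(i - 1, j - 1)`; otherwise it is `⊥`. -/
theorem inf_le_cellFlag (hf : f 0 = ⊥) (hg : g 0 = ⊥) {i j q : ℕ} (hi : i ≤ s) (hj : j ≤ l)
    (h : ∀ c : Fin s × Fin l, (c.1 : ℕ) < i → (c.2 : ℕ) < j → c ∈ L.take q) :
    f i ⊓ g j ≤ cellFlag f g L q := by
  match i, j with
  | 0, _ => rw [hf, bot_inf_eq]; exact bot_le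
  | _, 0 => rw [hg, inf_bot_eq]; exact bot_le
  | i + 1, j + 1 =>
    let c : Fin s × Fin l := (⟨i, hi⟩, ⟨j, hj⟩)
    exact Finset.le_sup (f := cellInf f g) (b := c)
      (List.mem_toFinset.2 (h c (Nat.lt_succ_self i) (Nat.lt_succ_self j)))

theorem cellFlag_eq_top (hf : f 0 = ⊥) (hg : g 0 = ⊥) (hf' : f s = ⊤) (hg' : g l = ⊤)
    (hL : L.Perm (rowOrder s l)) : cellFlag f g L (s * l) = ⊤ := by
  have hlen : s * l = L.length := by rw [hL.length_eq, length_rowOrder]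
  rw [eq_top_iff]
  calc (⊤ : 𝓛) = f s ⊓ g l := by rw [hf', hg', inf_idem]
    _ ≤ _ := inf_le_cellFlag hf hg le_rfl le_rfl fun c _ _ => by
        rw [hlen, List.take_length]; exact hL.mem_iff.2 (mem_rowOrder c)

theorem cellFlag_rowOrder (hf : f 0 = ⊥) (hg : g 0 = ⊥) (hg' : g l = ⊤) {i : ℕ} (hi : i ≤ s) :
    cellFlag f g (rowOrder s l) (i * l) = f i := by
  refine le_antisymm (cellFlag_le fun c hc => ?_) ?_
  · exact inf_le_left.trans (f.monotone (mem_take_rowOrder.1 hc))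
  · calc f i = f i ⊓ g l := by rw [hg', inf_top_eq]
      _ ≤ _ := inf_le_cellFlag hf hg hi le_rfl fun c h _ => mem_take_rowOrder.2 h

theorem cellFlag_colOrder (hf : f 0 = ⊥) (hg : g 0 = ⊥) (hf' : f s = ⊤) {j : ℕ} (hj : j ≤ l) :
    cellFlag f g (colOrder s l) (j * s) = g j := by
  refine le_antisymm (cellFlag_le fun c hc => ?_) ?_
  · exact inf_le_right.trans (g.monotone (mem_take_colOrder.1 hc))
  · calc g j = f s ⊓ g j := by rw [hf', top_inf_eq]
      _ ≤ _ := inf_le_cellFlag hf hg le_rfl hj fun c _ h => mem_take_colOrder.2 h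

/-- The join depends only on the set of pairs in an initial segment, and an exchange alters only the
segment which ends between the two exchanged pairs. -/
theorem isPath_cellFlag (hf : f 0 = ⊥) (hg : g 0 = ⊥) (hf' : f s = ⊤) (hg' : g l = ⊤)
    {word : List ℕ} (hw : IsReducedWord s l word) :
    IsPath (s := s) (l := l) word f g fun k => cellFlag f g (stage s l word k) where
  zero _ _ := cellFlag_zero
  top k _ := cellFlag_eq_top hf hg hf' hg' (stage_perm word k)
  left i hi := (cellFlag_rowOrder hf hg hg' hi).symm
  right j hj := by rw [hw.stage_length, cellFlag_colOrder hf hg hf' hj]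
  step k hk q hq := by
    obtain ⟨L₁, a, b, L₂, h₁, h₂, hp, -⟩ := hw.exists_exchange hk
    rw [h₁, h₂]
    exact cellFlag_congr (take_swap_perm _ _ _ _ (hp ▸ hq))

/-- Admissibility is used twice: the pairs strictly below `a` in the product order all precede it,
and any pair preceding it has a smaller row or a smaller column. Modularity alone suffices. -/
theorem cellInf_inf_cellFlag [IsModularLattice 𝓛] (hf : f 0 = ⊥) (hg : g 0 = ⊥)
    (hL : L.Perm (rowOrder s l)) (hadm : Admissible L) {q : ℕ} {a : Fin s × Fin l}
    (hq : L[q]? = some a) :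
    cellInf f g a ⊓ cellFlag f g L q = f a.1 ⊓ g (a.2 + 1) ⊔ f (a.1 + 1) ⊓ g a.2 := by
  have before : ∀ c : Fin s × Fin l, (c.1 : ℕ) < a.1 + 1 → (c.2 : ℕ) < a.2 + 1 → c ≠ a →
      c ∈ L.take q := by
    intro c h₁ h₂ hca
    obtain ⟨m, hm⟩ := List.mem_iff_getElem?.1 (hL.mem_iff.2 (mem_rowOrder c))
    refine mem_take_iff_getElem?.2 ⟨m, ?_, hm⟩
    by_contra hmq
    rcases (not_lt.1 hmq).lt_or_eq with h | rfl
    · have := hadm.of_lt hq hm h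
      omega
    · rw [hq] at hm
      exact hca (Option.some.inj hm).symm
  refine le_antisymm ?_ (sup_le (le_inf (inf_le_inf_right _ (f.monotone (Nat.le_succ _))) ?_)
      (le_inf (inf_le_inf_left _ (g.monotone (Nat.le_succ _))) ?_))
  · rw [← inf_inf_sup_eq (f.monotone (Nat.le_succ _)) (g.monotone (Nat.le_succ _))]
    refine inf_le_inf_left _ (cellFlag_le fun c hc => ?_)
    obtain ⟨m, hm, hc⟩ := mem_take_iff_getElem?.1 hc
    rcases hadm.of_lt hc hq hm with h₁ | h₁
    · exact (inf_le_left.trans (f.monotone h₁)).trans le_sup_left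
    · exact (inf_le_right.trans (g.monotone h₁)).trans le_sup_right
  · exact inf_le_cellFlag hf hg a.1.2.le a.2.2 fun c h₁ h₂ =>
      before c (by omega) h₂ (by rintro rfl; omega)
  · exact inf_le_cellFlag hf hg a.1.2 a.2.2.le fun c h₁ h₂ =>
      before c h₁ (by omega) (by rintro rfl; omega)

/-- The pairs `(i', j')` with `i' < i` or `j' < j` first, then the remaining ones. -/
def hookOrder (s l i j : ℕ) : List (Fin s × Fin l) :=
  (rowOrder s l).filter (fun c => decide ((c.1 : ℕ) < i ∨ (c.2 : ℕ) < j)) ++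
    (rowOrder s l).filter (fun c => !decide ((c.1 : ℕ) < i ∨ (c.2 : ℕ) < j))

theorem hookOrder_perm (i j : ℕ) : (hookOrder s l i j).Perm (rowOrder s l) :=
  List.filter_append_perm _ _

theorem admissible_hookOrder (i j : ℕ) : Admissible (hookOrder s l i j) := by
  rw [Admissible, hookOrder, List.pairwise_append]
  refine ⟨admissible_rowOrder.filter _, admissible_rowOrder.filter _, fun x hx y hy => ?_⟩
  simp only [List.mem_filter, decide_eq_true_eq, Bool.not_eq_true', decide_eq_false_iff_not]
    at hx hy
  omega

/-- This makes `f i ⊔ g j` a member of a chain with known graded pieces. Over a base ring its class,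
the flatness of its quotient and its compatibility with base change are read off from that chain. -/
theorem cellFlag_hookOrder (hf : f 0 = ⊥) (hg : g 0 = ⊥) (hf' : f s = ⊤) (hg' : g l = ⊤)
    {i j : ℕ} (hi : i ≤ s) (hj : j ≤ l) :
    cellFlag f g (hookOrder s l i j)
      ((rowOrder s l).filter (fun c => decide ((c.1 : ℕ) < i ∨ (c.2 : ℕ) < j))).length =
        f i ⊔ g j := by
  have hmem : ∀ c : Fin s × Fin l, c ∈ (hookOrder s l i j).take
      ((rowOrder s l).filter (fun c => decide ((c.1 : ℕ) < i ∨ (c.2 : ℕ) < j))).length ↔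
        (c.1 : ℕ) < i ∨ (c.2 : ℕ) < j := fun c => by
    rw [hookOrder, List.take_left]
    simp [mem_rowOrder]
  refine le_antisymm (cellFlag_le fun c hc => ?_) (sup_le ?_ ?_)
  · rcases (hmem c).1 hc with h | h
    · exact (inf_le_left.trans (f.monotone h)).trans le_sup_left
    · exact (inf_le_right.trans (g.monotone h)).trans le_sup_right
  · calc f i = f i ⊓ g l := by rw [hg', inf_top_eq]
      _ ≤ _ := inf_le_cellFlag hf hg hi le_rfl fun c h _ => (hmem c).2 (Or.inl h)
  · calc g j = f s ⊓ g j := by rw [hf', top_inf_eq]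
      _ ≤ _ := inf_le_cellFlag hf hg le_rfl hj fun c _ h => (hmem c).2 (Or.inr h)

end CellFlag

/-! ## Counting classes -/

section Counting

variable {𝓛 : Type*} [Lattice 𝓛] [BoundedOrder 𝓛] {s l : ℕ}

/-- An additive function on a sublattice, monotone for the order with positive cone `pos`. -/
structure IsClassFunction (good : 𝓛 → Prop) (pos : Set (ℤ × ℤ)) (γ : 𝓛 → ℤ × ℤ) : Prop where
  zero_mem : (0 : ℤ × ℤ) ∈ pos
  add_mem : ∀ x ∈ pos, ∀ y ∈ pos, x + y ∈ pos
  eq_zero : ∀ x ∈ pos, -x ∈ pos → x = 0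
  good_inf : ∀ A B, good A → good B → good (A ⊓ B)
  good_sup : ∀ A B, good A → good B → good (A ⊔ B)
  map_bot : γ ⊥ = 0
  mono : ∀ A B, good A → good B → A ≤ B → γ B - γ A ∈ pos
  modular : ∀ A B, good A → good B → γ (A ⊓ B) + γ (A ⊔ B) = γ A + γ B
  eq_of_le : ∀ A B, good A → good B → A ≤ B → γ A = γ B → A = B

/-- The sum of the values of `u` on the first `q` entries. -/
def headSum {ι : Type} (u : ι → ℤ × ℤ) (L : List ι) (q : ℕ) : ℤ × ℤ := ((L.take q).map u).sum

theorem headSum_succ {ι : Type} {u : ι → ℤ × ℤ} {L : List ι} {q : ℕ} {a : ι}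
    (h : L[q]? = some a) : headSum u L (q + 1) = headSum u L q + u a := by
  simp [headSum, take_add_one_of_getElem? h]

theorem headSum_swap {ι : Type} {u : ι → ℤ × ℤ} {L₁ : List ι} {a b : ι} {L₂ : List ι} {q : ℕ}
    (hq : q ≠ L₁.length + 1) :
    headSum u (L₁ ++ b :: a :: L₂) q = headSum u (L₁ ++ a :: b :: L₂) q :=
  ((take_swap_perm L₁ a b L₂ hq).map u).sum_eq

variable {good : 𝓛 → Prop} {pos : Set (ℤ × ℤ)} {γ : 𝓛 → ℤ × ℤ}

/-- The excess of the class of `f i ⊓ h q` over the sum of the entries expected in it. -/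
def defect (γ : 𝓛 → ℤ × ℤ) (w : Fin s × Fin l → ℤ × ℤ) (f h : ℕ → 𝓛) (L : List (Fin s × Fin l))
    (i q : ℕ) : ℤ × ℤ :=
  γ (f i ⊓ h q) - headSum (fun a : Fin s × Fin l => if (a.1 : ℕ) < i then w a else 0) L q

/-- The quotient of `A ⊓ C` by `A ⊓ B` embeds into that of `C` by `B`; the difference of classes is
that of `C` over `A ⊓ C ⊔ B`. -/
theorem IsClassFunction.sub_le (hγ : IsClassFunction good pos γ) {A B C : 𝓛} (hA : good A)
    (hB : good B) (hC : good C) (h : B ≤ C) :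
    (γ C - γ B) - (γ (A ⊓ C) - γ (A ⊓ B)) ∈ pos := by
  have h₁ := hγ.modular (A ⊓ C) B (hγ.good_inf _ _ hA hC) hB
  have h₂ : A ⊓ C ⊓ B = A ⊓ B := by rw [inf_assoc, inf_eq_right.2 h]
  rw [h₂] at h₁
  have h₃ := hγ.mono (A ⊓ C ⊔ B) C (hγ.good_sup _ _ (hγ.good_inf _ _ hA hC) hB) hC
    (sup_le inf_le_right h)
  convert h₃ using 1
  linear_combination h₁

section Defect

variable {w : Fin s × Fin l → ℤ × ℤ} {f h : ℕ →o 𝓛} {L : List (Fin s × Fin l)} {q i : ℕ}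
  {a : Fin s × Fin l}

/-- A graded piece of class `w a` adds at most `w a` to the trace on `f i`, whereas all of `w a` is
expected. -/
theorem defect_succ_of_lt (hγ : IsClassFunction good pos γ) (hf : ∀ i, good (f i))
    (hh : ∀ q, good (h q)) (ha : L[q]? = some a) (hw : γ (h (q + 1)) - γ (h q) = w a)
    (hi : (a.1 : ℕ) < i) : defect γ w f h L i q - defect γ w f h L i (q + 1) ∈ pos := by
  have := hγ.sub_le (hf i) (hh q) (hh (q + 1)) (h.monotone (Nat.le_succ q))
  rw [hw] at this
  convert this using 1
  simp only [defect, headSum_succ ha, if_pos hi]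
  abel

/-- Here nothing is expected to be added to the trace on `f i`, and what is added is positive. -/
theorem defect_succ_of_le (hγ : IsClassFunction good pos γ) (hf : ∀ i, good (f i))
    (hh : ∀ q, good (h q)) (ha : L[q]? = some a)
    (hi : i ≤ a.1) : defect γ w f h L i (q + 1) - defect γ w f h L i q ∈ pos := by
  have := hγ.mono (f i ⊓ h q) (f i ⊓ h (q + 1)) (hγ.good_inf _ _ (hf i) (hh _))
    (hγ.good_inf _ _ (hf i) (hh _)) (inf_le_inf_left _ (h.monotone (Nat.le_succ q)))
  convert this using 1
  simp only [defect, headSum_succ ha, if_neg (not_lt.2 hi)]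
  abel

end Defect

/-! ### Defects along a path: positivity, vanishing, and transversality. -/

namespace IsPath

variable {word : List ℕ} {f g : ℕ →o 𝓛} {h : ℕ → ℕ →o 𝓛} {w : Fin s × Fin l → ℤ × ℤ}

theorem defect_step (hP : IsPath (s := s) (l := l) word f g h) (hw : IsReducedWord s l word) {k : ℕ}
    (hk : k < word.length) {q : ℕ} (hq : q ≠ word[k] + 1) (i : ℕ) :
    defect γ w f (h (k + 1)) (stage s l word (k + 1)) i q =
      defect γ w f (h k) (stage s l word k) i q := by
  obtain ⟨L₁, a, b, L₂, h₁, h₂, hp, -⟩ := hw.exists_exchange hk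
  rw [defect, defect, hP.step k hk q hq, h₁, h₂, headSum_swap (hp ▸ hq)]

/-- The first chain refines `f`, so each of its steps either lies in `f i` or starts beyond it; the
trace on `f i` grows by the whole step or not at all. -/
theorem defect_row_eq_zero (hP : IsPath (s := s) (l := l) word f g h)
    (hγ : IsClassFunction good pos γ)
    (hcls : ∀ q a, (rowOrder s l)[q]? = some a → γ (h 0 (q + 1)) - γ (h 0 q) = w a)
    {i q : ℕ} (hq : q ≤ s * l) :
    defect γ w f (h 0) (rowOrder s l) i q = 0 := by
  induction q with
  | zero => simp [defect, headSum, hP.zero 0 (Nat.zero_le _), hγ.map_bot]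
  | succ q ih =>
    obtain ⟨a, ha⟩ : ∃ a, (rowOrder s l)[q]? = some a :=
      ⟨_, List.getElem?_eq_getElem (by simpa using hq)⟩
    have hq' := getElem?_rowOrder.1 ha
    have h₁ : f a.1 ≤ h 0 q := by
      rw [hP.left _ a.1.2.le, hq']
      exact (h 0).monotone (Nat.le_add_right _ _)
    have h₂ : h 0 (q + 1) ≤ f (a.1 + 1) := by
      rw [hP.left _ a.1.2, hq']
      refine (h 0).monotone ?_
      rw [rowKey, Nat.succ_mul]
      omega
    rw [← ih (by omega), defect, defect, headSum_succ ha]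
    rcases Nat.lt_or_ge a.1 i with hi | hi
    · have h₃ : h 0 (q + 1) ≤ f i := h₂.trans (f.monotone hi)
      rw [inf_eq_right.2 h₃, inf_eq_right.2 (((h 0).monotone (Nat.le_succ q)).trans h₃),
        if_pos hi, ← hcls q a ha]
      abel
    · have h₃ : f i ≤ h 0 q := (f.monotone hi).trans h₁
      rw [inf_eq_left.2 h₃, inf_eq_left.2 (h₃.trans ((h 0).monotone (Nat.le_succ q))),
        if_neg (not_lt.2 hi), add_zero]

/-- An exchange changes only the defect at the place `p + 1` between the two entries. If the new
first entry `b` has row below `i`, so has the new second entry `a`, and the defect at `p + 1`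
dominates the one at `p + 2`. If not, it dominates the one at `p`. Both of these are inherited from
the previous chain. -/
theorem defect_mem_pos (hP : IsPath (s := s) (l := l) word f g h)
    (hw : IsReducedWord s l word) (hγ : IsClassFunction good pos γ) (hf : ∀ i, good (f i))
    (hh : ∀ k ≤ word.length, ∀ q, good (h k q))
    (hcls : ∀ k ≤ word.length, ∀ q a, (stage s l word k)[q]? = some a →
      γ (h k (q + 1)) - γ (h k q) = w a)
    {k : ℕ} (hk : k ≤ word.length) (i : ℕ) {q : ℕ} (hq : q ≤ s * l) :
    defect γ w f (h k) (stage s l word k) i q ∈ pos := by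
  induction k generalizing q with
  | zero =>
    rw [stage_zero, hP.defect_row_eq_zero hγ (fun q a => hcls 0 hk q a) hq]
    exact hγ.zero_mem
  | succ k ih =>
    by_cases hq' : q = word[k] + 1
    · subst hq'
      obtain ⟨L₁, a, b, L₂, h₁, h₂, hp, hab, -⟩ := hw.exists_exchange hk
      have hb' : (stage s l word (k + 1))[word[k]]? = some b := by rw [h₂, ← hp]; simp
      have ha' : (stage s l word (k + 1))[word[k] + 1]? = some a := by rw [h₂, ← hp]; simp
      have hlen := (List.getElem?_eq_some_iff.1 ha').1
      rw [length_stage] at hlen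
      rcases Nat.lt_or_ge b.1 i with hi | hi
      · have h₃ := defect_succ_of_lt hγ hf (hh _ hk) ha' (hcls _ hk _ _ ha')
          ((Fin.lt_def.1 hab).trans hi)
        have h₄ := ih (by omega) (q := word[k] + 2) hlen
        rw [← hP.defect_step hw hk (by omega)] at h₄
        simpa using hγ.add_mem _ h₃ _ h₄
      · have h₃ := defect_succ_of_le (w := w) hγ hf (hh _ hk) hb' hi
        have h₄ := ih (by omega) (q := word[k]) (by omega)
        rw [← hP.defect_step hw hk (by omega)] at h₄
        simpa using hγ.add_mem _ h₃ _ h₄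
    · rw [hP.defect_step hw hk hq']
      exact ih (by omega) hq

/-- In the column order the rows run through `0, …, s - 1` inside each column. The defect is
therefore nonincreasing for the first `i` steps of a column and nondecreasing afterwards. Starting
and ending at zero while staying positive, it vanishes throughout. -/
theorem defect_last_eq_zero (hP : IsPath (s := s) (l := l) word f g h)
    (hw : IsReducedWord s l word) (hγ : IsClassFunction good pos γ) (hf : ∀ i, good (f i))
    (hh : ∀ k ≤ word.length, ∀ q, good (h k q))
    (hcls : ∀ k ≤ word.length, ∀ q a, (stage s l word k)[q]? = some a →
      γ (h k (q + 1)) - γ (h k q) = w a)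
    (i : ℕ)
    (hcol : ∀ j ≤ l, defect γ w f (h word.length) (colOrder s l) i (j * s) = 0) {q : ℕ}
    (hq : q ≤ s * l) :
    defect γ w f (h word.length) (colOrder s l) i q = 0 := by
  have hpos : ∀ {q}, q ≤ s * l → defect γ w f (h word.length) (colOrder s l) i q ∈ pos :=
    fun hq => by
      have := hP.defect_mem_pos hw hγ hf hh hcls le_rfl i hq
      rwa [hw.stage_length] at this
  have hcls' := hcls _ le_rfl
  rw [hw.stage_length] at hcls'
  rcases Nat.eq_zero_or_pos s with rfl | hs
  · have : q = 0 := by omega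
    subst this
    simpa using hcol 0 (Nat.zero_le _)
  have entry : ∀ j < l, ∀ m (hm : m < s), ∃ a : Fin s × Fin l, (a.1 : ℕ) = m ∧
      (colOrder s l)[j * s + m]? = some a := fun j hj m hm =>
    ⟨(⟨m, hm⟩, ⟨j, hj⟩), rfl, getElem?_colOrder.2 rfl⟩
  have bound : ∀ j < l, ∀ m ≤ s, j * s + m ≤ s * l := fun j hj m hm => by
    have : (j + 1) * s ≤ l * s := Nat.mul_le_mul_right _ hj
    rw [add_mul, one_mul, mul_comm l] at this
    omega
  have up : ∀ j < l, ∀ m ≤ s, m ≤ i →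
      defect γ w f (h word.length) (colOrder s l) i (j * s + m) = 0 := by
    intro j hj m
    induction m with
    | zero => intro _ _; exact hcol j hj.le
    | succ m ih =>
      intro hm hmi
      obtain ⟨a, ha, hq⟩ := entry j hj m hm
      have h₁ := defect_succ_of_lt hγ hf (hh _ le_rfl) hq (hcls' _ _ hq) (i := i) (by omega)
      rw [ih (by omega) (by omega), zero_sub] at h₁
      exact hγ.eq_zero _ (hpos (bound j hj _ hm)) h₁
  have down : ∀ j < l, ∀ m ≤ s, i ≤ m →
      defect γ w f (h word.length) (colOrder s l) i (j * s + m) = 0 := by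
    intro j hj m hm
    refine Nat.decreasingInduction' (P := fun m => i ≤ m →
      defect γ w f (h word.length) (colOrder s l) i (j * s + m) = 0) (fun m hm _ ih him => ?_)
      hm (fun _ => ?_)
    · obtain ⟨a, ha, hq⟩ := entry j hj m hm
      have h₁ := defect_succ_of_le (w := w) hγ hf (hh _ le_rfl) hq (i := i) (by omega)
      have h₂ := ih (by omega)
      rw [← add_assoc] at h₂
      rw [h₂, zero_sub] at h₁
      exact hγ.eq_zero _ (hpos (bound j hj _ hm.le)) h₁
    · have := hcol (j + 1) hj
      rwa [add_mul, one_mul] at this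
  rcases hq.lt_or_eq with hq | rfl
  · have hj : q / s < l := Nat.div_lt_of_lt_mul hq
    have hm : q % s < s := Nat.mod_lt _ hs
    have hqe : q = q / s * s + q % s := (Nat.div_add_mod' q s).symm
    rw [hqe]
    rcases Nat.le_total (q % s) i with hi | hi
    · exact up _ hj _ hm.le hi
    · exact down _ hj _ hm.le hi
  · rw [mul_comm]; exact hcol l le_rfl

/-- Undo the exchanges. At the one disturbed place, the defect is positive and is dominated by a
neighbouring defect already known to vanish: the lower neighbour if `a` has row below `i`, the upper
one otherwise. -/
theorem defect_eq_zero (hP : IsPath (s := s) (l := l) word f g h)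
    (hw : IsReducedWord s l word) (hγ : IsClassFunction good pos γ) (hf : ∀ i, good (f i))
    (hh : ∀ k ≤ word.length, ∀ q, good (h k q))
    (hcls : ∀ k ≤ word.length, ∀ q a, (stage s l word k)[q]? = some a →
      γ (h k (q + 1)) - γ (h k q) = w a)
    (i : ℕ)
    (hcol : ∀ j ≤ l, defect γ w f (h word.length) (colOrder s l) i (j * s) = 0) {k : ℕ}
    (hk : k ≤ word.length) {q : ℕ} (hq : q ≤ s * l) :
    defect γ w f (h k) (stage s l word k) i q = 0 := by
  refine Nat.decreasingInduction' (P := fun k => ∀ q ≤ s * l,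
    defect γ w f (h k) (stage s l word k) i q = 0) (fun k hk _ ih q hq => ?_) hk
    (fun q hq => ?_) q hq
  · by_cases hq' : q = word[k] + 1
    · subst hq'
      obtain ⟨L₁, a, b, L₂, h₁, h₂, hp, hab, -⟩ := hw.exists_exchange hk
      have ha' : (stage s l word k)[word[k]]? = some a := by rw [h₁, ← hp]; simp
      have hb' : (stage s l word k)[word[k] + 1]? = some b := by rw [h₁, ← hp]; simp
      have hlen := (List.getElem?_eq_some_iff.1 hb').1
      rw [length_stage] at hlen
      have hpos := hP.defect_mem_pos hw hγ hf hh hcls hk.le i hq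
      rcases Nat.lt_or_ge a.1 i with hi | hi
      · have h₃ := defect_succ_of_lt hγ hf (hh _ hk.le) ha' (hcls _ hk.le _ _ ha') hi
        have h₄ := ih word[k] (by omega)
        rw [hP.defect_step hw hk (by omega)] at h₄
        rw [h₄, zero_sub] at h₃
        exact hγ.eq_zero _ hpos h₃
      · have h₃ := defect_succ_of_le (w := w) hγ hf (hh _ hk.le) hb' (i := i)
          (hi.trans (Fin.lt_def.1 hab).le)
        have h₄ := ih (word[k] + 2) hlen
        rw [hP.defect_step hw hk (by omega)] at h₄
        rw [h₄, zero_sub] at h₃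
        exact hγ.eq_zero _ hpos h₃
    · rw [← hP.defect_step hw hk hq']
      exact ih q hq
  · rw [hw.stage_length]
    exact hP.defect_last_eq_zero hw hγ hf hh hcls i hcol hq

theorem isTransversal_of_defect (hP : IsPath (s := s) (l := l) word f g h)
    (hw : IsReducedWord s l word) (hγ : IsClassFunction good pos γ) (hf : ∀ i, good (f i))
    (hh : ∀ k ≤ word.length, ∀ q, good (h k q))
    (hcls : ∀ k ≤ word.length, ∀ q a, (stage s l word k)[q]? = some a →
      γ (h k (q + 1)) - γ (h k q) = w a)
    [IsModularLattice 𝓛]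
    (hcol : ∀ i ≤ s, ∀ j ≤ l, defect γ w f (h word.length) (colOrder s l) i (j * s) = 0) :
    IsTransversal word h := by
  have key : ∀ k (hk : k < word.length),
      h k (word[k] + 1) ⊓ h (k + 1) (word[k] + 1) = h k word[k] ∧
      h k (word[k] + 1) ⊔ h (k + 1) (word[k] + 1) = h k (word[k] + 2) := by
    intro k hk
    obtain ⟨L₁, a, b, L₂, h₁, h₂, hp, hab, -⟩ := hw.exists_exchange hk
    have ha : (stage s l word k)[word[k]]? = some a := by rw [h₁, ← hp]; simp
    have hb : (stage s l word k)[word[k] + 1]? = some b := by rw [h₁, ← hp]; simp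
    have hb' : (stage s l word (k + 1))[word[k]]? = some b := by rw [h₂, ← hp]; simp
    have hlen := (List.getElem?_eq_some_iff.1 hb).1
    rw [length_stage] at hlen
    set p := word[k] with hpdef
    have e₀ : h (k + 1) p = h k p := hP.step k hk _ (by omega)
    have e₂ : h (k + 1) (p + 2) = h k (p + 2) := hP.step k hk _ (by omega)
    have m₀ : h k p ≤ h (k + 1) (p + 1) := e₀ ▸ (h (k + 1)).monotone (by omega)
    have m₂ : h (k + 1) (p + 1) ≤ h k (p + 2) := e₂ ▸ (h (k + 1)).monotone (by omega)
    have ca := hcls k hk.le p a ha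
    have cb := hcls k hk.le (p + 1) b hb
    have cb' := hcls (k + 1) hk p b hb'
    rw [e₀] at cb'
    -- This `i` separates the exchanged entries: the row of `a` is below it, that of `b` is not.
    set i := (a.1 : ℕ) + 1 with hi
    have hz : ∀ {k' q}, k' ≤ word.length → q ≤ s * l →
        defect γ w f (h k') (stage s l word k') i q = 0 := fun hk' hq =>
      hP.defect_eq_zero hw hγ hf hh hcls i (hcol i a.1.2) hk' hq
    have d₀ := hz (k' := k) (q := p) hk.le (by omega)
    have d₁ := hz (k' := k) (q := p + 1) hk.le (by omega)
    have d₀' := hz (k' := k + 1) (q := p) hk (by omega)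
    have d₁' := hz (k' := k + 1) (q := p + 1) hk (by omega)
    have hbi : ¬ (b.1 : ℕ) < i := by have := Fin.lt_def.1 hab; omega
    rw [defect] at d₀ d₁ d₀' d₁'
    rw [headSum_succ ha, if_pos (by omega)] at d₁
    rw [headSum_succ hb', if_neg hbi, add_zero] at d₁'
    rw [e₀] at d₀'
    have hgf := hf i
    have g₀ := hh k hk.le p
    have g₁ := hh k hk.le (p + 1)
    have g₂ := hh k hk.le (p + 2)
    have g₁' := hh (k + 1) hk (p + 1)
    -- Vanishing defects say that `f i` gains nothing in the step of `b` in the new chain, and, in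
    -- `eq₂`, that it spans the whole step of `a` in the old one. The two steps are then independent
    -- by the modular law, and they span because the classes add up.
    have eq₁ : f i ⊓ h k p = f i ⊓ h (k + 1) (p + 1) :=
      hγ.eq_of_le _ _ (hγ.good_inf _ _ hgf g₀) (hγ.good_inf _ _ hgf g₁') (inf_le_inf_left _ m₀)
        (by linear_combination d₀' - d₁')
    have eq₂ : h k p ⊔ f i ⊓ h k (p + 1) = h k (p + 1) := by
      refine hγ.eq_of_le _ _ (hγ.good_sup _ _ g₀ (hγ.good_inf _ _ hgf g₁)) g₁
        (sup_le ((h k).monotone (by omega)) inf_le_right) ?_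
      have h₃ := hγ.modular (h k p) (f i ⊓ h k (p + 1)) g₀ (hγ.good_inf _ _ hgf g₁)
      have h₄ : h k p ⊓ (f i ⊓ h k (p + 1)) = f i ⊓ h k p := by
        rw [inf_left_comm, inf_eq_left.2 ((h k).monotone (by omega : p ≤ p + 1))]
      rw [h₄] at h₃
      linear_combination h₃ + d₁ - d₀ - ca
    have eq₃ : h k (p + 1) ⊓ h (k + 1) (p + 1) = h k p := by
      refine le_antisymm ?_ (le_inf ((h k).monotone (by omega)) m₀)
      calc h k (p + 1) ⊓ h (k + 1) (p + 1)
          = (h k p ⊔ f i ⊓ h k (p + 1)) ⊓ h (k + 1) (p + 1) := by rw [eq₂]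
        _ = h k p ⊔ f i ⊓ h k (p + 1) ⊓ h (k + 1) (p + 1) := sup_inf_assoc_of_le _ m₀
        _ ≤ h k p ⊔ f i ⊓ h (k + 1) (p + 1) :=
            sup_le_sup_left (inf_le_inf_right _ inf_le_left) _
        _ ≤ h k p := by rw [← eq₁]; exact sup_le le_rfl inf_le_right
    refine ⟨eq₃, hγ.eq_of_le _ _ (hγ.good_sup _ _ g₁ g₁') g₂
      (sup_le ((h k).monotone (by omega)) m₂) ?_⟩
    have h₅ := hγ.modular _ _ g₁ g₁'
    rw [eq₃] at h₅
    linear_combination h₅ + cb' - cb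
  exact ⟨fun k hk => (key k hk).1.le, fun k hk => (key k hk).2.ge⟩

end IsPath

end Counting

end SteinbergStack

namespace SteinbergStack

/-! ## Modules with an endomorphism -/

section AEval

variable {R : Type*} [CommRing R] {M N P : Type*} [AddCommGroup M] [Module R M] [AddCommGroup N]
  [Module R N] [AddCommGroup P] [Module R P]

/-- A map commuting with the given endomorphisms is linear over the polynomial ring. -/
noncomputable def aevalMap {f : Module.End R M} {g : Module.End R N} (φ : M →ₗ[R] N)
    (h : ∀ m, φ (f m) = g (φ m)) : Module.AEval' f →ₗ[R[X]] Module.AEval' g :=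
  LinearMap.ofAEval f ((Module.AEval'.of g).toLinearMap ∘ₗ φ) fun m => by
    simp [Module.AEval'.X_smul_of, h]

theorem aevalMap_injective {f : Module.End R M} {g : Module.End R N} {φ : M →ₗ[R] N}
    (h : ∀ m, φ (f m) = g (φ m)) (hφ : Function.Injective φ) :
    Function.Injective (aevalMap φ h) := hφ

theorem aevalMap_surjective {f : Module.End R M} {g : Module.End R N} {φ : M →ₗ[R] N}
    (h : ∀ m, φ (f m) = g (φ m)) (hφ : Function.Surjective φ) :
    Function.Surjective (aevalMap φ h) := hφ

theorem aevalMap_exact {f : Module.End R M} {g : Module.End R N} {k : Module.End R P}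
    {φ : M →ₗ[R] N} {ψ : N →ₗ[R] P} (h : ∀ m, φ (f m) = g (φ m)) (h' : ∀ m, ψ (g m) = k (ψ m))
    (hex : Function.Exact φ ψ) : Function.Exact (aevalMap φ h) (aevalMap ψ h') := hex

theorem AEval'_pow_smul_of (f : Module.End R M) (n : ℕ) (m : M) :
    (X ^ n : R[X]) • Module.AEval'.of f m = Module.AEval'.of f ((f ^ n) m) :=
  Module.AEval'.X_pow_smul_of f m n

variable (R' : Type*) [CommRing R'] [Algebra R R']

attribute [local instance] Polynomial.algebra

/-- Extension of scalars commutes with the passage to modules over the polynomial ring. -/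
noncomputable def aevalBaseChange (f : Module.End R M) :
    Module.AEval' (f.baseChange R' : Module.End R' (R' ⊗[R] M)) ≃ₗ[R'[X]]
      R'[X] ⊗[R[X]] Module.AEval' f :=
  LinearEquiv.ofAEval (f.baseChange R' : Module.End R' (R' ⊗[R] M))
    ((LinearEquiv.baseChange R R' _ _ (Module.AEval'.of f)).trans
      (Algebra.IsPushout.cancelBaseChange R R' R[X] R'[X] (Module.AEval' f)).symm) fun u => by
    induction u with
    | zero => simp
    | add u v hu hv => simp only [smul_add, map_add, hu, hv]
    | tmul r m =>
      have h₁ : (f.baseChange R' : Module.End R' (R' ⊗[R] M)) • (r ⊗ₜ[R] m) = r ⊗ₜ[R] f m := rfl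
      rw [h₁]
      simp only [LinearEquiv.trans_apply, LinearEquiv.baseChange_tmul,
        Algebra.IsPushout.cancelBaseChange_symm_tmul]
      have h₂ : Module.AEval'.of f (f m) = (X : R[X]) • Module.AEval'.of f m :=
        (Module.AEval'.X_smul_of f m).symm
      rw [h₂, ← TensorProduct.smul_tmul, TensorProduct.smul_tmul', Algebra.smul_def]
      simp

theorem finitePresentation_aeval_baseChange (f : Module.End R M)
    [Module.FinitePresentation R[X] (Module.AEval' f)] :
    Module.FinitePresentation R'[X]
      (Module.AEval' (f.baseChange R' : Module.End R' (R' ⊗[R] M))) := by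
  exact Module.FinitePresentation.of_equiv (R := R'[X]) (M := R'[X] ⊗[R[X]] Module.AEval' f)
    (N := Module.AEval' (f.baseChange R' : Module.End R' (R' ⊗[R] M))) (aevalBaseChange R' f).symm

theorem finite_aeval_baseChange (f : Module.End R M) [Module.Finite R[X] (Module.AEval' f)] :
    Module.Finite R'[X] (Module.AEval' (f.baseChange R' : Module.End R' (R' ⊗[R] M))) :=
  Module.Finite.equiv (aevalBaseChange R' f).symm

end AEval

/-! ### Extensions of finitely presented and of flat modules. -/

section Exact

variable {R : Type u} [CommRing R] {M N P : Type*} [AddCommGroup M] [Module R M] [AddCommGroup N]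
  [Module R N] [AddCommGroup P] [Module R P] {f : M →ₗ[R] N} {g : N →ₗ[R] P}

theorem finitePresentation_of_exact (hf : Function.Injective f) (hex : Function.Exact f g)
    (hg : Function.Surjective g) (hM : Module.FinitePresentation R M)
    (hP : Module.FinitePresentation R P) : Module.FinitePresentation R N := by
  have e : M ≃ₗ[R] LinearMap.ker g :=
    (LinearEquiv.ofInjective f hf).trans (LinearEquiv.ofEq _ _ hex.linearMap_ker_eq.symm)
  have : Module.FinitePresentation R (LinearMap.ker g) := Module.FinitePresentation.of_equiv e
  exact Module.finitePresentation_of_ker g hg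

/-- An element of `A ⊗ N` which dies in `B ⊗ N` dies in `A ⊗ P` by flatness of `P`, so it comes from
`A ⊗ M`. Flatness of `P` also makes `B ⊗ M → B ⊗ N` injective, and flatness of `M` finishes the
chase. -/
theorem flat_of_exact (hf : Function.Injective f) (hex : Function.Exact f g)
    (hg : Function.Surjective g) [Module.Flat R M] [Module.Flat R P] : Module.Flat R N := by
  refine Module.Flat.iff_rTensor_preserves_injective_linearMap'.2 fun (A B : Type u) _ _ _ _ i hi => ?_
  rw [injective_iff_map_eq_zero]
  intro u hu
  have h₁ : g.lTensor A u = 0 := by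
    refine Module.Flat.rTensor_preserves_injective_linearMap (M := P) i hi ?_
    rw [map_zero, ← LinearMap.comp_apply, LinearMap.rTensor_comp_lTensor,
      ← LinearMap.lTensor_comp_rTensor, LinearMap.comp_apply, hu, map_zero]
  obtain ⟨v, rfl⟩ := (lTensor_exact A hex hg u).1 h₁
  have h₂ : i.rTensor M v = 0 := by
    refine LinearMap.lTensor_injective_of_exact_of_flat g hg f hf hex B ?_
    rw [map_zero, ← LinearMap.comp_apply, LinearMap.lTensor_comp_rTensor,
      ← LinearMap.rTensor_comp_lTensor, LinearMap.comp_apply, hu]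
  rw [Module.Flat.rTensor_preserves_injective_linearMap (M := M) i hi (h₂.trans (map_zero _).symm),
    map_zero]

end Exact

/-! ## Localization at an endomorphism -/

section Chart

variable {R : Type*} [CommRing R] {M N : Type*} [AddCommGroup M] [Module R M] [AddCommGroup N]
  [Module R N]

/-- The map `r` identifies `N`, on which `t` is bijective, with the localization of `M` at `x`. -/
structure IsChart (x : Module.End R M) (t : Module.End R N) (r : M →ₗ[R] N) : Prop where
  comm : ∀ m, r (x m) = t (r m)
  ker : ∀ m, r m = 0 → ∃ n : ℕ, (x ^ n) m = 0
  surj : ∀ z, ∃ (n : ℕ) (m : M), (t ^ n) z = r m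

theorem map_pow_of_comm {x : Module.End R M} {t : Module.End R N} {r : M →ₗ[R] N}
    (h : ∀ m, r (x m) = t (r m)) (n : ℕ) (m : M) : r ((x ^ n) m) = (t ^ n) (r m) := by
  induction n with
  | zero => rfl
  | succ n ih => rw [pow_succ', pow_succ', Module.End.mul_apply, Module.End.mul_apply, h, ih]

theorem IsChart.surj_le {x : Module.End R M} {t : Module.End R N} {r : M →ₗ[R] N}
    (h : IsChart x t r) {z : N} {n : ℕ} (hn : ∃ m, (t ^ n) z = r m) {n' : ℕ} (hnn : n ≤ n') :
    ∃ m, (t ^ n') z = r m := by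
  obtain ⟨k, rfl⟩ := Nat.exists_eq_add_of_le' hnn
  obtain ⟨m, hm⟩ := hn
  exact ⟨(x ^ k) m, by rw [map_pow_of_comm h.comm, pow_add, Module.End.mul_apply, hm]⟩

/-- Translates the elementwise conditions into a localization of `R[X]`-modules at the powers of
`X`, for which stability under tensor products is available. -/
theorem IsChart.isLocalizedModule {x : Module.End R M} {t : Module.End R N} {r : M →ₗ[R] N}
    (h : IsChart x t r) (ht : IsUnit t) :
    IsLocalizedModule (Submonoid.powers (X : R[X])) (aevalMap r h.comm) where
  map_units := by
    rintro ⟨_, n, rfl⟩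
    rw [Module.End.isUnit_iff]
    have h₁ : ⇑(algebraMap R[X] (Module.End R[X] (Module.AEval' t)) (X ^ n)) =
        Module.AEval'.of t ∘ (t ^ n) ∘ (Module.AEval'.of t).symm := by
      funext z
      exact AEval'_pow_smul_of t n ((Module.AEval'.of t).symm z)
    change Function.Bijective ⇑(algebraMap R[X] (Module.End R[X] (Module.AEval' t)) (X ^ n))
    rw [h₁]
    exact (Module.AEval'.of t).bijective.comp
      (((Module.End.isUnit_iff _).1 (ht.pow n)).comp (Module.AEval'.of t).symm.bijective)
  surj z := by
    obtain ⟨n, m, hm⟩ := h.surj ((Module.AEval'.of t).symm z)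
    refine ⟨(Module.AEval'.of x m, ⟨X ^ n, n, rfl⟩), ?_⟩
    have := AEval'_pow_smul_of t n ((Module.AEval'.of t).symm z)
    rw [hm, LinearEquiv.apply_symm_apply] at this
    exact this
  exists_of_eq := by
    intro a b hab
    obtain ⟨n, hn⟩ := h.ker ((Module.AEval'.of x).symm (a - b)) (by
      rw [map_sub, map_sub, sub_eq_zero]; exact hab)
    refine ⟨⟨X ^ n, n, rfl⟩, ?_⟩
    have := AEval'_pow_smul_of x n ((Module.AEval'.of x).symm (a - b))
    rw [hn, LinearEquiv.apply_symm_apply, map_zero, smul_sub, sub_eq_zero] at this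
    exact this

theorem pow_baseChange (R' : Type*) [CommRing R'] [Algebra R R'] (x : Module.End R M) (n : ℕ) :
    (x.baseChange R' : Module.End R' (R' ⊗[R] M)) ^ n = (x ^ n).baseChange R' := by
  induction n with
  | zero => rw [pow_zero, pow_zero]; exact (LinearMap.baseChange_id).symm
  | succ n ih => rw [pow_succ, pow_succ, ih]; exact (LinearMap.baseChange_comp _ _).symm

theorem IsChart.baseChange {x : Module.End R M} {t : Module.End R N} {r : M →ₗ[R] N}
    (h : IsChart x t r) (ht : IsUnit t) (R' : Type*) [CommRing R'] [Algebra R R'] :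
    IsChart (x.baseChange R') (t.baseChange R') (r.baseChange R') where
  comm u := by
    have : r.baseChange R' ∘ₗ x.baseChange R' = t.baseChange R' ∘ₗ r.baseChange R' := by
      rw [← LinearMap.baseChange_comp, ← LinearMap.baseChange_comp]
      congr 1
      exact LinearMap.ext h.comm
    exact LinearMap.congr_fun this u
  ker u hu := by
    have := h.isLocalizedModule ht
    -- The new scalars are moved to the right factor so that `R[X]` acts on the left one.
    let τ : R' ⊗[R] M ≃ₗ[R] Module.AEval' x ⊗[R] R' :=
      (TensorProduct.comm R R' M).trans (LinearEquiv.rTensor R' (Module.AEval'.of x))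
    let τ' : R' ⊗[R] N ≃ₗ[R] Module.AEval' t ⊗[R] R' :=
      (TensorProduct.comm R R' N).trans (LinearEquiv.rTensor R' (Module.AEval'.of t))
    have key : ∀ u : R' ⊗[R] M,
        AlgebraTensorModule.rTensor R R' (aevalMap r h.comm) (τ u) = τ' (r.baseChange R' u) := by
      intro u
      induction u with
      | zero => simp
      | add u v hu hv => rw [map_add, map_add, hu, hv, map_add, map_add]
      | tmul a m => rfl
    have key' : ∀ (n : ℕ) (u : R' ⊗[R] M),
        (X ^ n : R[X]) • τ u = τ ((x ^ n).baseChange R' u) := by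
      intro n u
      induction u with
      | zero => simp
      | add u v hu hv => rw [map_add, smul_add, hu, hv, map_add, map_add]
      | tmul a m => exact congrArg (· ⊗ₜ[R] a) (AEval'_pow_smul_of x n m)
    have h0 : AlgebraTensorModule.rTensor R R' (aevalMap r h.comm) (τ u) =
        AlgebraTensorModule.rTensor R R' (aevalMap r h.comm) 0 := by
      rw [key, hu, map_zero, map_zero]
    obtain ⟨⟨_, n, rfl⟩, hn⟩ := IsLocalizedModule.exists_of_eq
      (S := Submonoid.powers (X : R[X])) h0
    refine ⟨n, ?_⟩
    rw [smul_zero] at hn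
    rw [pow_baseChange]
    refine τ.injective ?_
    rw [map_zero]
    exact (key' n u).symm.trans hn
  surj z := by
    induction z with
    | zero => exact ⟨0, 0, by simp⟩
    | tmul a z =>
      obtain ⟨n, m, hm⟩ := h.surj z
      exact ⟨n, a ⊗ₜ m, by rw [pow_baseChange]; simp [hm]⟩
    | add z z' hz hz' =>
      obtain ⟨n, m, hm⟩ := hz
      obtain ⟨n', m', hm'⟩ := hz'
      have hc : ∀ u, r.baseChange R' (x.baseChange R' u) = t.baseChange R' (r.baseChange R' u) := by
        intro u
        have : r.baseChange R' ∘ₗ x.baseChange R' = t.baseChange R' ∘ₗ r.baseChange R' := by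
          rw [← LinearMap.baseChange_comp, ← LinearMap.baseChange_comp]
          congr 1
          exact LinearMap.ext h.comm
        exact LinearMap.congr_fun this u
      have e : ∀ (f : Module.End R' (R' ⊗[R] N)) (a b : ℕ) (u : R' ⊗[R] N),
          (f ^ (a + b)) u = (f ^ a) ((f ^ b) u) := fun f a b u => by
        rw [pow_add, Module.End.mul_apply]
      refine ⟨n + n', ((x.baseChange R' : Module.End R' _) ^ n') m +
        ((x.baseChange R' : Module.End R' _) ^ n) m', ?_⟩
      rw [map_add, map_add, map_pow_of_comm hc, map_pow_of_comm hc, ← hm, ← hm', ← e, ← e,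
        add_comm n' n]

end Chart

end SteinbergStack

namespace SteinbergStack

/-! ### Localization at an endomorphism is stable under extensions. -/

section ChartExact

variable {R : Type*} [CommRing R] {M₁ M₂ M₃ N₁ N₂ N₃ : Type*} [AddCommGroup M₁] [Module R M₁]
  [AddCommGroup M₂] [Module R M₂] [AddCommGroup M₃] [Module R M₃] [AddCommGroup N₁] [Module R N₁]
  [AddCommGroup N₂] [Module R N₂] [AddCommGroup N₃] [Module R N₃]
  {x₁ : Module.End R M₁} {x₂ : Module.End R M₂} {x₃ : Module.End R M₃}
  {t₁ : Module.End R N₁} {t₂ : Module.End R N₂} {t₃ : Module.End R N₃}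
  {r₁ : M₁ →ₗ[R] N₁} {r₂ : M₂ →ₗ[R] N₂} {r₃ : M₃ →ₗ[R] N₃}

theorem IsChart.of_exact (h₁ : IsChart x₁ t₁ r₁) (h₃ : IsChart x₃ t₃ r₃)
    (hr : ∀ m, r₂ (x₂ m) = t₂ (r₂ m)) {φ : M₁ →ₗ[R] M₂} {ψ : M₂ →ₗ[R] M₃} {φ' : N₁ →ₗ[R] N₂}
    {ψ' : N₂ →ₗ[R] N₃} (hφx : ∀ m, φ (x₁ m) = x₂ (φ m)) (hψx : ∀ m, ψ (x₂ m) = x₃ (ψ m))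
    (hφt : ∀ m, φ' (t₁ m) = t₂ (φ' m)) (hψt : ∀ m, ψ' (t₂ m) = t₃ (ψ' m))
    (hφr : ∀ m, φ' (r₁ m) = r₂ (φ m)) (hψr : ∀ m, ψ' (r₂ m) = r₃ (ψ m))
    (hex : Function.Exact φ ψ) (hs : Function.Surjective ψ) (hi' : Function.Injective φ')
    (hex' : Function.Exact φ' ψ') : IsChart x₂ t₂ r₂ where
  comm := hr
  ker m hm := by
    obtain ⟨n, hn⟩ := h₃.ker (ψ m) (by rw [← hψr, hm, map_zero])
    rw [← map_pow_of_comm hψx] at hn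
    obtain ⟨a, ha⟩ := (hex _).1 hn
    obtain ⟨k, hk⟩ := h₁.ker a (hi' (by
      rw [hφr, ha, map_pow_of_comm hr, hm, map_zero, map_zero]))
    refine ⟨k + n, ?_⟩
    rw [pow_add, Module.End.mul_apply, ← ha, ← map_pow_of_comm hφx, hk, map_zero]
  surj z := by
    obtain ⟨n, c, hc⟩ := h₃.surj (ψ' z)
    obtain ⟨b, rfl⟩ := hs c
    obtain ⟨a', ha'⟩ := (hex' ((t₂ ^ n) z - r₂ b)).1 (by
      rw [map_sub, map_pow_of_comm hψt, hc, hψr, sub_self])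
    obtain ⟨k, a, ha⟩ := h₁.surj a'
    refine ⟨k + n, (x₂ ^ k) b + φ a, ?_⟩
    rw [map_add, map_pow_of_comm hr, ← hφr, ← ha, map_pow_of_comm hφt, ha', ← map_add,
      add_sub_cancel, pow_add, Module.End.mul_apply]

end ChartExact

/-! ## Short exact sequences of representations -/

variable {Q : Shape} {R : Type u} [CommRing R]

/-- A short exact sequence of representations. -/
structure ShortExact (A B C : QRep Q R) where
  f : ∀ v, A.obj v →ₗ[R] B.obj v
  g : ∀ v, B.obj v →ₗ[R] C.obj v
  f_comm : ∀ e x, f _ (A.map e x) = B.map e (f _ x)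
  g_comm : ∀ e x, g _ (B.map e x) = C.map e (g _ x)
  inj : ∀ v, Function.Injective (f v)
  exact : ∀ v, Function.Exact (f v) (g v)
  surj : ∀ v, Function.Surjective (g v)

theorem baseChange_comm {M₁ M₂ N₁ N₂ : Type*} [AddCommGroup M₁] [Module R M₁]
    [AddCommGroup M₂] [Module R M₂] [AddCommGroup N₁] [Module R N₁] [AddCommGroup N₂] [Module R N₂]
    (R' : Type*) [CommRing R'] [Algebra R R']
    {a : M₁ →ₗ[R] M₂} {b : N₁ →ₗ[R] N₂} {c : M₁ →ₗ[R] N₁} {d : M₂ →ₗ[R] N₂}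
    (h : ∀ m, d (a m) = b (c m)) (u : R' ⊗[R] M₁) :
    d.baseChange R' (a.baseChange R' u) = b.baseChange R' (c.baseChange R' u) := by
  have : d.baseChange R' ∘ₗ a.baseChange R' = b.baseChange R' ∘ₗ c.baseChange R' := by
    rw [← LinearMap.baseChange_comp, ← LinearMap.baseChange_comp]
    congr 1
    exact LinearMap.ext h
  exact LinearMap.congr_fun this u

/-- Extension of scalars preserves short exact sequences with flat cokernel. -/
noncomputable def ShortExact.baseChange {A B C : QRep Q R} (S : ShortExact A B C)
    (hC : ∀ v, Module.Flat R (C.obj v)) (R' : Type u) [CommRing R'] [Algebra R R'] :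
    ShortExact (A.baseChange R') (B.baseChange R') (C.baseChange R') where
  f v := (S.f v).baseChange R'
  g v := (S.g v).baseChange R'
  f_comm e := baseChange_comm R' (S.f_comm e)
  g_comm e := baseChange_comm R' (S.g_comm e)
  inj v := by
    have := hC v
    exact LinearMap.lTensor_injective_of_exact_of_flat (S.g v) (S.surj v) (S.f v) (S.inj v)
      (S.exact v) R'
  exact v := lTensor_exact R' (S.exact v) (S.surj v)
  surj v := LinearMap.lTensor_surjective R' (S.surj v)

/-- An isomorphism, as a short exact sequence with cokernel zero. -/
def ShortExact.ofEquiv {A B C : QRep Q R} (e : ∀ v, A.obj v ≃ₗ[R] B.obj v)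
    (he : ∀ a x, e _ (A.map a x) = B.map a (e _ x)) (hC : ∀ v, Subsingleton (C.obj v)) :
    ShortExact A B C where
  f v := (e v).toLinearMap
  g _ := 0
  f_comm := he
  g_comm _ _ := Subsingleton.elim _ _
  inj v := (e v).injective
  exact v y := by
    constructor
    · exact fun _ => ⟨(e v).symm y, (e v).apply_symm_apply y⟩
    · exact fun _ => rfl
  surj v y := ⟨0, Subsingleton.elim _ _⟩

/-- The zero representation. -/
abbrev zeroRep (Q : Shape) (R : Type u) [CommRing R] : QRep Q R where
  obj _ := PUnit
  map _ := 0

/-! ## Families -/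

namespace P1

variable (M : QRep P1Shape R)

/-- The identities between the operators of a quasi-coherent sheaf. -/
structure Relations : Prop where
  t_tinv : t M * tinv M = 1
  tinv_t : tinv M * t M = 1
  res0_x : ∀ m, res0 M (x M m) = t M (res0 M m)
  resInfty_y : ∀ m, resInfty M (y M m) = tinv M (resInfty M m)

variable {M}

theorem isQuasicoherent_iff : IsQuasicoherent M ↔ Relations M ∧
    IsChart (x M) (t M) (res0 M) ∧ IsChart (y M) (tinv M) (resInfty M) :=
  ⟨fun h => ⟨⟨h.t_tinv, h.tinv_t, h.res0_x, h.resInfty_y⟩, ⟨h.res0_x, h.ker0, h.surj0⟩,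
    ⟨h.resInfty_y, h.kerInfty, h.surjInfty⟩⟩,
   fun ⟨h, h₀, h₁⟩ => ⟨h.t_tinv, h.tinv_t, h.res0_x, h.resInfty_y, h₀.ker, h₀.surj, h₁.ker,
    h₁.surj⟩⟩

theorem Relations.isUnit_t (h : Relations M) : IsUnit (t M) :=
  ⟨⟨t M, tinv M, h.t_tinv, h.tinv_t⟩, rfl⟩

theorem Relations.isUnit_tinv (h : Relations M) : IsUnit (tinv M) :=
  ⟨⟨tinv M, t M, h.tinv_t, h.t_tinv⟩, rfl⟩

end P1

namespace Heart

/-- The identities between the maps of a family of objects. -/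
def Relations : (H : Heart) → {R : Type u} → [CommRing R] → QRep H.shape R → Prop
  | coh, _, _, M => P1.Relations M
  | rep _, _, _, _ => True

variable {H : Heart}

theorem IsFamily.relations {M : QRep H.shape R} (h : H.IsFamily M) : H.Relations M := by
  cases H with
  | coh => exact (P1.isQuasicoherent_iff.1 h.1).1
  | rep n => trivial

theorem Relations.of_surjective {M N : QRep H.shape R} (h : H.Relations M)
    (g : ∀ v, M.obj v →ₗ[R] N.obj v) (hg : ∀ e x, g _ (M.map e x) = N.map e (g _ x))
    (hs : ∀ v, Function.Surjective (g v)) : H.Relations N := by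
  cases H with
  | rep n => trivial
  | coh =>
    constructor
    · refine LinearMap.ext fun z => ?_
      obtain ⟨z, rfl⟩ := hs P1Vertex.overlap z
      have h₁ := hg P1Arrow.t (P1.tinv M z)
      have h₂ := hg P1Arrow.tinv z
      have h₃ : P1.t M (P1.tinv M z) = z := LinearMap.congr_fun h.t_tinv z
      change P1.t N (P1.tinv N (g _ z)) = g _ z
      exact (congrArg _ h₂.symm).trans (h₁.symm.trans (congrArg _ h₃))
    · refine LinearMap.ext fun z => ?_
      obtain ⟨z, rfl⟩ := hs P1Vertex.overlap z
      have h₁ := hg P1Arrow.tinv (P1.t M z)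
      have h₂ := hg P1Arrow.t z
      have h₃ : P1.tinv M (P1.t M z) = z := LinearMap.congr_fun h.tinv_t z
      change P1.tinv N (P1.t N (g _ z)) = g _ z
      exact (congrArg _ h₂.symm).trans (h₁.symm.trans (congrArg _ h₃))
    · intro m
      obtain ⟨m, rfl⟩ := hs P1Vertex.zero m
      have h₁ := hg P1Arrow.res0 (P1.x M m)
      have h₂ := hg P1Arrow.x m
      have h₃ := hg P1Arrow.res0 m
      have h₄ := hg P1Arrow.t (P1.res0 M m)
      have h₅ := h.res0_x m
      exact (congrArg (N.map P1Arrow.res0) h₂.symm).trans (h₁.symm.trans ((congrArg _ h₅).trans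
        (h₄.trans (congrArg (N.map P1Arrow.t) h₃))))
    · intro m
      obtain ⟨m, rfl⟩ := hs P1Vertex.infty m
      have h₁ := hg P1Arrow.resInfty (P1.y M m)
      have h₂ := hg P1Arrow.y m
      have h₃ := hg P1Arrow.resInfty m
      have h₄ := hg P1Arrow.tinv (P1.resInfty M m)
      have h₅ := h.resInfty_y m
      exact (congrArg (N.map P1Arrow.resInfty) h₂.symm).trans (h₁.symm.trans ((congrArg _ h₅).trans
        (h₄.trans (congrArg (N.map P1Arrow.tinv) h₃))))

theorem Relations.of_injective {M N : QRep H.shape R} (h : H.Relations N)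
    (f : ∀ v, M.obj v →ₗ[R] N.obj v) (hf : ∀ e x, f _ (M.map e x) = N.map e (f _ x))
    (hi : ∀ v, Function.Injective (f v)) : H.Relations M := by
  cases H with
  | rep n => trivial
  | coh =>
    constructor
    · refine LinearMap.ext fun z => hi P1Vertex.overlap ?_
      have h₁ := hf P1Arrow.t (P1.tinv M z)
      have h₂ := hf P1Arrow.tinv z
      have h₃ : P1.t N (P1.tinv N (f _ z)) = f _ z := LinearMap.congr_fun h.t_tinv (f _ z)
      exact h₁.trans ((congrArg (N.map P1Arrow.t) h₂).trans h₃)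
    · refine LinearMap.ext fun z => hi P1Vertex.overlap ?_
      have h₁ := hf P1Arrow.tinv (P1.t M z)
      have h₂ := hf P1Arrow.t z
      have h₃ : P1.tinv N (P1.t N (f _ z)) = f _ z := LinearMap.congr_fun h.tinv_t (f _ z)
      exact h₁.trans ((congrArg (N.map P1Arrow.tinv) h₂).trans h₃)
    · intro m
      refine hi P1Vertex.overlap ?_
      have h₁ := hf P1Arrow.res0 (P1.x M m)
      have h₂ := hf P1Arrow.x m
      have h₃ := hf P1Arrow.res0 m
      have h₄ := hf P1Arrow.t (P1.res0 M m)
      have h₅ := h.res0_x (f _ m)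
      exact h₁.trans ((congrArg (N.map P1Arrow.res0) h₂).trans (h₅.trans
        ((congrArg (N.map P1Arrow.t) h₃.symm).trans h₄.symm)))
    · intro m
      refine hi P1Vertex.overlap ?_
      have h₁ := hf P1Arrow.resInfty (P1.y M m)
      have h₂ := hf P1Arrow.y m
      have h₃ := hf P1Arrow.resInfty m
      have h₄ := hf P1Arrow.tinv (P1.resInfty M m)
      have h₅ := h.resInfty_y (f _ m)
      exact h₁.trans ((congrArg (N.map P1Arrow.resInfty) h₂).trans (h₅.trans
        ((congrArg (N.map P1Arrow.tinv) h₃.symm).trans h₄.symm)))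

/-- The relations between the operators of `B` must be assumed, since they do not pass to
extensions: `t * tinv` could be a nontrivial unipotent. In the applications `B` is a subquotient of
an object for which they hold. -/
theorem IsFamily.of_shortExact {A B C : QRep H.shape R} (S : ShortExact A B C)
    (hB : H.Relations B) (hA : H.IsFamily A) (hC : H.IsFamily C) : H.IsFamily B := by
  cases H with
  | rep n =>
    intro v
    exact finitePresentation_of_exact (S.inj v) (S.exact v) (S.surj v) (hA v) (hC v)
  | coh =>
    obtain ⟨hA, hA₀, hA₁⟩ := hA
    obtain ⟨hC, hC₀, hC₁⟩ := hC
    obtain ⟨-, hA, hA'⟩ := P1.isQuasicoherent_iff.1 hA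
    obtain ⟨-, hC, hC'⟩ := P1.isQuasicoherent_iff.1 hC
    refine ⟨P1.isQuasicoherent_iff.2 ⟨hB, ?_, ?_⟩, ?_, ?_⟩
    · exact hA.of_exact hC hB.res0_x (S.f_comm P1Arrow.x) (S.g_comm P1Arrow.x)
        (S.f_comm P1Arrow.t) (S.g_comm P1Arrow.t) (S.f_comm P1Arrow.res0) (S.g_comm P1Arrow.res0)
        (S.exact P1Vertex.zero) (S.surj P1Vertex.zero) (S.inj P1Vertex.overlap)
        (S.exact P1Vertex.overlap)
    · exact hA'.of_exact hC' hB.resInfty_y (S.f_comm P1Arrow.y) (S.g_comm P1Arrow.y)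
        (S.f_comm P1Arrow.tinv) (S.g_comm P1Arrow.tinv) (S.f_comm P1Arrow.resInfty)
        (S.g_comm P1Arrow.resInfty) (S.exact P1Vertex.infty) (S.surj P1Vertex.infty)
        (S.inj P1Vertex.overlap) (S.exact P1Vertex.overlap)
    · exact finitePresentation_of_exact
        (M := Module.AEval' (P1.x A)) (N := Module.AEval' (P1.x B)) (P := Module.AEval' (P1.x C))
        (aevalMap_injective (S.f_comm P1Arrow.x) (S.inj P1Vertex.zero))
        (aevalMap_exact (S.f_comm P1Arrow.x) (S.g_comm P1Arrow.x) (S.exact P1Vertex.zero))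
        (aevalMap_surjective (S.g_comm P1Arrow.x) (S.surj P1Vertex.zero)) hA₀ hC₀
    · exact finitePresentation_of_exact
        (M := Module.AEval' (P1.y A)) (N := Module.AEval' (P1.y B)) (P := Module.AEval' (P1.y C))
        (aevalMap_injective (S.f_comm P1Arrow.y) (S.inj P1Vertex.infty))
        (aevalMap_exact (S.f_comm P1Arrow.y) (S.g_comm P1Arrow.y) (S.exact P1Vertex.infty))
        (aevalMap_surjective (S.g_comm P1Arrow.y) (S.surj P1Vertex.infty)) hA₁ hC₁

theorem Relations.baseChange {M : QRep H.shape R} (h : H.Relations M) (R' : Type u) [CommRing R']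
    [Algebra R R'] : H.Relations (M.baseChange R') := by
  cases H with
  | rep n => trivial
  | coh =>
    constructor
    · change (P1.t M).baseChange R' ∘ₗ (P1.tinv M).baseChange R' = LinearMap.id
      rw [← LinearMap.baseChange_comp, ← LinearMap.baseChange_id]
      exact congrArg _ h.t_tinv
    · change (P1.tinv M).baseChange R' ∘ₗ (P1.t M).baseChange R' = LinearMap.id
      rw [← LinearMap.baseChange_comp, ← LinearMap.baseChange_id]
      exact congrArg _ h.tinv_t
    · exact baseChange_comm R' h.res0_x
    · exact baseChange_comm R' h.resInfty_y

theorem IsFamily.baseChange {M : QRep H.shape R} (h : H.IsFamily M) (R' : Type u) [CommRing R']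
    [Algebra R R'] : H.IsFamily (M.baseChange R') := by
  cases H with
  | rep n =>
    intro v
    have := h v
    exact inferInstanceAs (Module.FinitePresentation R' (R' ⊗[R] M.obj v))
  | coh =>
    have hR := h.relations.baseChange R'
    obtain ⟨h, h₀, h₁⟩ := h
    obtain ⟨hr, hc₀, hc₁⟩ := P1.isQuasicoherent_iff.1 h
    exact ⟨P1.isQuasicoherent_iff.2 ⟨hR, hc₀.baseChange hr.isUnit_t R',
      hc₁.baseChange hr.isUnit_tinv R'⟩, finitePresentation_aeval_baseChange R' (P1.x M),
      finitePresentation_aeval_baseChange R' (P1.y M)⟩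

theorem isFamily_of_subsingleton {M : QRep H.shape R} (h : ∀ v, Subsingleton (M.obj v)) :
    H.IsFamily M := by
  cases H with
  | rep n =>
    intro v
    have := h v
    infer_instance
  | coh =>
    have h₀ : Subsingleton (P1.M0 M) := h P1Vertex.zero
    have h₁ : Subsingleton (P1.MInfty M) := h P1Vertex.infty
    have h₂ : Subsingleton (P1.MOverlap M) := h P1Vertex.overlap
    have i₀ : Subsingleton (Module.AEval' (P1.x M)) := h₀
    have i₁ : Subsingleton (Module.AEval' (P1.y M)) := h₁
    refine ⟨⟨Subsingleton.elim _ _, Subsingleton.elim _ _, fun _ => Subsingleton.elim _ _,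
      fun _ => Subsingleton.elim _ _, fun m _ => ⟨0, Subsingleton.elim _ _⟩,
      fun z => ⟨0, 0, Subsingleton.elim _ _⟩, fun m _ => ⟨0, Subsingleton.elim _ _⟩,
      fun z => ⟨0, 0, Subsingleton.elim _ _⟩⟩, ?_, ?_⟩
    · exact inferInstanceAs (Module.FinitePresentation R[X] (Module.AEval' (P1.x M)))
    · exact inferInstanceAs (Module.FinitePresentation R[X] (Module.AEval' (P1.y M)))

end Heart

end SteinbergStack

namespace SteinbergStack

/-! ## Linear algebra over a polynomial ring -/

section PolynomialModules

variable {R : Type*} [CommRing R] {M : Type*} [AddCommGroup M] [Module R M]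

/-- `M` is a finite module over `R[X] / (p)`, which is itself finite over `R`. -/
theorem finite_of_monic_smul [Module R[X] M] [IsScalarTower R R[X] M]
    (hM : Module.Finite R[X] M) {p : R[X]} (hp : p.Monic) (h : ∀ m : M, p • m = 0) :
    Module.Finite R M := by
  have htor : Module.IsTorsionBySet R[X] M (Ideal.span {p} : Set R[X]) :=
    (Module.isTorsionBySet_span_singleton_iff p).2 fun m => h m
  let := htor.module
  have : IsScalarTower R[X] (R[X] ⧸ Ideal.span {p}) M := htor.isScalarTower
  have : IsScalarTower R (R[X] ⧸ Ideal.span {p}) M := htor.isScalarTower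
  have : Module.Finite (R[X] ⧸ Ideal.span {p}) M :=
    Module.Finite.of_restrictScalars_finite R[X] _ _
  have : Module.Finite R (R[X] ⧸ Ideal.span {p}) := hp.finite_quotient
  exact Module.Finite.trans (R := R) (R[X] ⧸ Ideal.span {p}) M

/-- Induction over the elements of a module generated, over the polynomial ring, by `S`. -/
theorem aeval_span_induction {f : Module.End R M} {S : Set (Module.AEval' f)}
    (hS : Submodule.span R[X] S = ⊤) {P : M → Prop}
    (mem : ∀ s ∈ S, P ((Module.AEval'.of f).symm s)) (zero : P 0)
    (add : ∀ a b, P a → P b → P (a + b)) (smul : ∀ (c : R) a, P a → P (c • a))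
    (map : ∀ a, P a → P (f a)) (m : M) : P m := by
  have hm : Module.AEval'.of f m ∈ Submodule.span R[X] S := hS ▸ Submodule.mem_top
  suffices ∀ z ∈ Submodule.span R[X] S, P ((Module.AEval'.of f).symm z) from this _ hm
  intro z hz
  induction hz using Submodule.span_induction with
  | mem s hs => exact mem s hs
  | zero => rw [map_zero]; exact zero
  | add a b _ _ ha hb => rw [map_add]; exact add _ _ ha hb
  | smul p a _ ha =>
    induction p using Polynomial.induction_on' with
    | add p q hp hq => rw [add_smul, map_add]; exact add _ _ hp hq
    | monomial n c =>
      have : (Module.AEval'.of f).symm (monomial n c • a) =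
          c • (f ^ n) ((Module.AEval'.of f).symm a) := by
        rw [Module.AEval.of_symm_smul, aeval_monomial]
        rfl
      rw [this]
      refine smul _ _ ?_
      induction n with
      | zero => exact ha
      | succ n ih => rw [pow_succ', Module.End.mul_apply]; exact map _ (ih (by
          rw [Module.AEval.of_symm_smul, aeval_monomial]; rfl))

theorem isTorsion_of_pow {f : Module.End R M} {m : M} {n : ℕ} (h : (f ^ n) m = 0) :
    (X ^ n : R[X]) • Module.AEval'.of f m = 0 := by
  rw [AEval'_pow_smul_of, h, map_zero]

theorem inv_pow_apply {t t' : Module.End R M} (h : t' * t = 1) (n : ℕ) (z : M) :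
    (t' ^ n) ((t ^ n) z) = z := by
  rw [← Module.End.mul_apply, pow_mul_pow_eq_one n h]
  rfl

variable {K : Type*} [Field K] {V : Type*} [AddCommGroup V] [Module K V]

theorem finite_of_isTorsion [Module K[X] V] [IsScalarTower K K[X] V]
    (hV : Module.Finite K[X] V) (h : Module.IsTorsion K[X] V) : Module.Finite K V := by
  obtain ⟨p, hp, hp'⟩ := Submodule.annihilator_top_inter_nonZeroDivisors h
  have hp0 : p ≠ 0 := nonZeroDivisors.ne_zero hp'
  refine finite_of_monic_smul hV (monic_mul_leadingCoeff_inv hp0) fun v => ?_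
  rw [mul_comm, mul_smul, (Submodule.mem_annihilator.1 hp) v Submodule.mem_top, smul_zero]

theorem isTorsion_of_finite (f : Module.End K V) [Module.Finite K V] :
    Module.IsTorsion K[X] (Module.AEval' f) := by
  intro v
  refine ⟨⟨minpoly K f, mem_nonZeroDivisors_of_ne_zero
    (minpoly.ne_zero (Algebra.IsIntegral.isIntegral f))⟩, ?_⟩
  exact LinearMap.congr_fun (minpoly.aeval K f) ((Module.AEval'.of f).symm v)

theorem finrank_aeval_eq_zero_iff {f : Module.End K V}
    (hf : Module.Finite K[X] (Module.AEval' f)) :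
    Module.finrank K[X] (Module.AEval' f) = 0 ↔ Module.Finite K V := by
  rw [Module.finrank_eq_zero_iff_isTorsion]
  exact ⟨fun h => (finite_of_isTorsion hf h).equiv (Module.AEval'.of f).symm,
    fun _ => isTorsion_of_finite f⟩

theorem finrank_eq_add_of_exact {A M N P : Type*} [CommRing A] [IsDomain A] [AddCommGroup M]
    [Module A M] [AddCommGroup N] [Module A N] [AddCommGroup P] [Module A P] {f : M →ₗ[A] N}
    {g : N →ₗ[A] P} (hN : Module.Finite A N) (hf : Function.Injective f)
    (hex : Function.Exact f g) (hg : Function.Surjective g) :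
    Module.finrank A N = Module.finrank A M + Module.finrank A P := by
  have h₁ := Submodule.finrank_quotient_add_finrank (LinearMap.ker g)
  have h₂ := (g.quotKerEquivOfSurjective hg).finrank_eq
  have h₃ := ((LinearEquiv.ofInjective f hf).trans
    (LinearEquiv.ofEq _ _ hex.linearMap_ker_eq.symm)).finrank_eq
  omega

/-- The vectors whose coordinates with respect to a maximal free quotient have degree `< D` form a
finite-dimensional space. -/
theorem exists_coordinates {f : Module.End K V} (hf : Module.Finite K[X] (Module.AEval' f)) :
    ∃ (r : ℕ) (c : Fin r → Module.AEval' f →ₗ[K[X]] K[X]),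
      ∀ D : ℕ, ∃ W : Submodule K V, Module.Finite K W ∧
        ∀ v, (∀ i, (c i (Module.AEval'.of f v)).degree < D) → v ∈ W := by
  let T := Submodule.torsion K[X] (Module.AEval' f)
  have : Module.Free K[X] (Module.AEval' f ⧸ T) := Module.free_of_finite_type_torsion_free'
  let b := Module.finBasis K[X] (Module.AEval' f ⧸ T)
  refine ⟨_, fun i => b.coord i ∘ₗ T.mkQ, fun D => ?_⟩
  let φ : V →ₗ[K] (Fin (Module.finrank K[X] (Module.AEval' f ⧸ T)) → K[X]) :=
    LinearMap.pi fun i => ((b.coord i ∘ₗ T.mkQ).restrictScalars K) ∘ₗ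
      (Module.AEval'.of f).toLinearMap
  refine ⟨(Submodule.pi Set.univ fun _ => degreeLT K D).comap φ, ?_, fun v hv => ?_⟩
  · have hT : Module.Finite K T :=
      finite_of_isTorsion (V := T) inferInstance (Submodule.torsion_isTorsion)
    have hT' : (T.restrictScalars K).FG := Module.Finite.iff_fg.1 hT
    -- A vector all of whose coordinates vanish is torsion, and a finitely generated torsion module
    -- over `K[X]` is finite-dimensional.
    have hker : Module.Finite K (LinearMap.ker φ) := by
      have : Module.Finite K ((T.restrictScalars K).map
          (Module.AEval'.of f).symm.toLinearMap) := Module.Finite.iff_fg.2 (hT'.map _)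
      refine Submodule.finiteDimensional_of_le (S₂ := (T.restrictScalars K).map
          (Module.AEval'.of f).symm.toLinearMap) fun v hv => ?_
      refine ⟨Module.AEval'.of f v, ?_, rfl⟩
      have h0 : T.mkQ (Module.AEval'.of f v) = 0 := b.ext_elem fun i => by
        rw [map_zero]
        exact congrFun (LinearMap.mem_ker.1 hv) i
      simpa using h0
    have hpi : Module.Finite K (Submodule.pi Set.univ fun _ : Fin (Module.finrank K[X]
        (Module.AEval' f ⧸ T)) => degreeLT K D) := by
      have : Module.Finite K (degreeLT K D) := Module.Finite.equiv (degreeLTEquiv K D).symm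
      refine Module.Finite.of_injective (N := Fin (Module.finrank K[X]
        (Module.AEval' f ⧸ T)) → degreeLT K D)
        (LinearMap.pi fun i => LinearMap.codRestrict _ (LinearMap.proj i ∘ₗ Submodule.subtype _)
          fun v => v.2 i (Set.mem_univ i)) fun v w h => ?_
      ext i : 2
      exact congrArg Subtype.val (congrFun h i)
    refine Module.Finite.iff_fg.2 (Submodule.fg_of_fg_map_of_fg_inf_ker φ ?_ ?_)
    · exact Module.Finite.iff_fg.1 (Submodule.finiteDimensional_of_le
        (Submodule.map_comap_le φ _))
    · exact Module.Finite.iff_fg.1 (Submodule.finiteDimensional_of_le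
        (S₂ := LinearMap.ker φ) inf_le_right)
  · simp only [Submodule.mem_comap, Submodule.mem_pi]
    exact fun i _ => mem_degreeLT.2 (hv i)

end PolynomialModules

/-! ## Finiteness of cohomology -/

section Cohomology

variable {K : Type*} [Field K] {M₀ M₁ N : Type*} [AddCommGroup M₀] [Module K M₀] [AddCommGroup M₁]
  [Module K M₁] [AddCommGroup N] [Module K N] {x : Module.End K M₀} {y : Module.End K M₁}
  {t t' : Module.End K N} {r₀ : M₀ →ₗ[K] N} {r₁ : M₁ →ₗ[K] N}

/-- Finiteness of `H¹`. The space `N` consists of elements `t' ^ k (r₀ m)`. For `m` in a finite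
generating set these lie in the image of `r₁` as soon as `k ≥ n`, which leaves finitely many of
them; multiplying `m` by `x` only lowers `k`. -/
theorem finite_cokernel (h₀ : IsChart x t r₀) (h₁ : IsChart y t' r₁) (ht : t' * t = 1)
    (hx : Module.Finite K[X] (Module.AEval' x)) :
    Module.Finite K (N ⧸ (LinearMap.range r₀ ⊔ LinearMap.range r₁)) := by
  classical
  set C := LinearMap.range r₀ ⊔ LinearMap.range r₁ with hC
  obtain ⟨S, hS⟩ := hx.fg_top
  have hex : ∃ n : ℕ, ∀ s ∈ S, ∃ b, (t' ^ n) (r₀ ((Module.AEval'.of x).symm s)) = r₁ b := by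
    choose n b hb using fun s : Module.AEval' x =>
      h₁.surj (r₀ ((Module.AEval'.of x).symm s))
    exact ⟨S.sup n, fun s hs => h₁.surj_le ⟨_, hb s⟩ (Finset.le_sup hs)⟩
  obtain ⟨n, hn⟩ := hex
  let W : Submodule K N := Submodule.span K (↑(Finset.image (fun p : ℕ × Module.AEval' x =>
    (t' ^ p.1) (r₀ ((Module.AEval'.of x).symm p.2))) (Finset.range n ×ˢ S)) : Set N)
  have key : ∀ m : M₀, ∀ k : ℕ, (t' ^ k) (r₀ m) ∈ C ⊔ W := by
    intro m
    refine aeval_span_induction (P := fun m => ∀ k : ℕ, (t' ^ k) (r₀ m) ∈ C ⊔ W) hS ?_ ?_ ?_ ?_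
      ?_ m
    · intro s hs k
      rcases Nat.lt_or_ge k n with hk | hk
      · refine Submodule.mem_sup_right (Submodule.subset_span ?_)
        rw [Finset.mem_coe, Finset.mem_image]
        exact ⟨(k, s), Finset.mem_product.2 ⟨Finset.mem_range.2 hk, hs⟩, rfl⟩
      · obtain ⟨b, hb⟩ := h₁.surj_le ⟨_, (hn s hs).choose_spec⟩ hk
        exact Submodule.mem_sup_left (Submodule.mem_sup_right ⟨b, hb.symm⟩)
    · intro k; simp
    · intro a b ha hb k
      rw [map_add, map_add]; exact add_mem (ha k) (hb k)
    · intro c a ha k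
      rw [map_smul, map_smul]; exact Submodule.smul_mem _ _ (ha k)
    · intro a ha k
      match k with
      | 0 => exact Submodule.mem_sup_left (Submodule.mem_sup_left ⟨x a, rfl⟩)
      | k + 1 =>
        rw [h₀.comm, pow_succ, Module.End.mul_apply, ← Module.End.mul_apply t' t, ht]
        exact ha k
  have htop : C ⊔ W = ⊤ := by
    rw [eq_top_iff]
    intro z _
    obtain ⟨k, m, hm⟩ := h₀.surj z
    have := key m k
    rwa [← hm, inv_pow_apply ht] at this
  have hW : Module.Finite K W := Module.Finite.span_finset K _
  refine Module.Finite.of_surjective (C.mkQ ∘ₗ W.subtype) ?_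
  rw [← LinearMap.range_eq_top, LinearMap.range_comp, Submodule.range_subtype]
  exact (Submodule.map_mkQ_eq_top C W).2 htop

theorem degree_lt_of_X_pow_mul {p : K[X]} {n D : ℕ} 
    (h : (X ^ n * p).degree < ((D + n : ℕ) : WithBot ℕ)) :
    p.degree < D := by
  rw [mul_comm, degree_mul_X_pow, Nat.cast_add] at h
  exact lt_of_add_lt_add_right h

/-- Finiteness of `H⁰`. A section over the chart of `y` has a bounded pole in the other chart: for
every `b` some `t ^ (n + d) (r₁ b)` is `r₀ m` with the coordinates of `m` of degree below `D + d`.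
If `r₀ a = r₁ b`, the coordinates of `a` then have degree below `D`, since coordinates do not see
torsion. -/
theorem finite_kernel (h₀ : IsChart x t r₀) (h₁ : IsChart y t' r₁) (ht : t * t' = 1)
    (hx : Module.Finite K[X] (Module.AEval' x)) (hy : Module.Finite K[X] (Module.AEval' y)) :
    Module.Finite K (LinearMap.ker (r₀.coprod (-r₁))) := by
  classical
  obtain ⟨r, c, hc⟩ := exists_coordinates hx
  obtain ⟨r', c', hc'⟩ := exists_coordinates hy
  obtain ⟨S, hS⟩ := hy.fg_top
  have hex : ∃ n : ℕ, ∀ s ∈ S, ∃ a, (t ^ n) (r₁ ((Module.AEval'.of y).symm s)) = r₀ a := by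
    choose n b hb using fun s : Module.AEval' y =>
      h₀.surj (r₁ ((Module.AEval'.of y).symm s))
    exact ⟨S.sup n, fun s hs => h₀.surj_le ⟨_, hb s⟩ (Finset.le_sup hs)⟩
  obtain ⟨n, hn⟩ := hex
  choose! a ha using hn
  -- `D` exceeds the degrees of all coordinates of the numerators `a s` of the generators.
  let D : ℕ := S.sup fun s => Finset.univ.sup fun i =>
    (c i (Module.AEval'.of x (a s))).natDegree + 1
  have key : ∀ b : M₁, ∃ (d : ℕ) (m : M₀), (t ^ (n + d)) (r₁ b) = r₀ m ∧
      ∀ i, (c i (Module.AEval'.of x m)).degree < (D + d : ℕ) := by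
    intro b
    refine aeval_span_induction (P := fun b => ∃ (d : ℕ) (m : M₀), (t ^ (n + d)) (r₁ b) = r₀ m ∧
      ∀ i, (c i (Module.AEval'.of x m)).degree < (D + d : ℕ)) hS ?_ ?_ ?_ ?_ ?_ b
    · intro s hs
      refine ⟨0, a s, ha s hs, fun i => ?_⟩
      refine degree_le_natDegree.trans_lt (Nat.cast_lt.2 ?_)
      have h₁ : (c i (Module.AEval'.of x (a s))).natDegree + 1 ≤ D :=
        (Finset.le_sup (f := fun i => (c i (Module.AEval'.of x (a s))).natDegree + 1)
          (Finset.mem_univ i)).trans (Finset.le_sup (f := fun s => Finset.univ.sup fun i =>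
          (c i (Module.AEval'.of x (a s))).natDegree + 1) hs)
      omega
    · exact ⟨0, 0, by simp, fun i => by simp⟩
    · rintro b b' ⟨d, m, hm, hd⟩ ⟨d', m', hm', hd'⟩
      refine ⟨d + d', (x ^ d') m + (x ^ d) m', ?_, fun i => ?_⟩
      · rw [map_add, map_add, map_add, map_pow_of_comm h₀.comm, map_pow_of_comm h₀.comm, ← hm,
          ← hm', ← Module.End.mul_apply, ← Module.End.mul_apply, ← pow_add, ← pow_add,
          show d' + (n + d) = n + (d + d') by omega, show d + (n + d') = n + (d + d') by omega]
      · rw [map_add, map_add, ← AEval'_pow_smul_of, ← AEval'_pow_smul_of, map_smul, map_smul,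
          smul_eq_mul, smul_eq_mul, mul_comm, mul_comm (X ^ d)]
        refine (degree_add_le _ _).trans_lt (max_lt ?_ ?_)
        · rw [degree_mul_X_pow, ← add_assoc, Nat.cast_add (D + d)]
          exact WithBot.add_lt_add_right (WithBot.natCast_ne_bot d') (hd i)
        · rw [degree_mul_X_pow, add_comm d d', ← add_assoc, Nat.cast_add (D + d')]
          exact WithBot.add_lt_add_right (WithBot.natCast_ne_bot d) (hd' i)
    · rintro e b ⟨d, m, hm, hd⟩
      refine ⟨d, e • m, by rw [map_smul, map_smul, map_smul, hm], fun i => ?_⟩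
      have : c i (Module.AEval'.of x (e • m)) = e • c i (Module.AEval'.of x m) := by
        rw [map_smul, LinearMap.map_smul_of_tower]
      rw [this]
      exact (degree_smul_le _ _).trans_lt (hd i)
    · rintro b ⟨d, m, hm, hd⟩
      refine ⟨d + 1, m, ?_, fun i => (hd i).trans_le (Nat.cast_le.2 (by omega))⟩
      rw [h₁.comm, ← add_assoc, pow_succ, Module.End.mul_apply, ← Module.End.mul_apply t t', ht]
      exact hm
  obtain ⟨W, hW, hmem⟩ := hc D
  -- Degree below `0` means zero, so `W'` contains all torsion vectors. It receives the sections `b`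
  -- paired with `a = 0`, which are killed by a power of `y`.
  obtain ⟨W', hW', hmem'⟩ := hc' 0
  refine Module.Finite.iff_fg.2 (Submodule.fg_of_fg_map_of_fg_inf_ker (LinearMap.fst K M₀ M₁)
    ?_ ?_)
  · refine Module.Finite.iff_fg.1 (Submodule.finiteDimensional_of_le (S₂ := W) ?_)
    rintro _ ⟨⟨a, b⟩, hab, rfl⟩
    refine hmem _ fun i => ?_
    have hab : r₀ a = r₁ b := by
      have : r₀ a + -r₁ b = 0 := hab
      rwa [← sub_eq_add_neg, sub_eq_zero] at this
    obtain ⟨d, m, hm, hd⟩ := key b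
    rw [← hab, ← map_pow_of_comm h₀.comm, ← sub_eq_zero, ← map_sub] at hm
    obtain ⟨k, hk⟩ := h₀.ker _ hm
    have := congrArg (c i) (isTorsion_of_pow hk)
    rw [map_smul, map_zero, smul_eq_zero_iff_right (pow_ne_zero _ X_ne_zero), map_sub, map_sub,
      sub_eq_zero, ← AEval'_pow_smul_of, map_smul, smul_eq_mul] at this
    refine degree_lt_of_X_pow_mul (n := n + d) ?_
    exact this ▸ (hd i).trans_le (Nat.cast_le.2 (by omega))
  · refine Module.Finite.iff_fg.1 (Submodule.finiteDimensional_of_le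
      (S₂ := W'.map (LinearMap.inr K M₀ M₁)) ?_)
    rintro ⟨a, b⟩ ⟨hab, ha : a = 0⟩
    subst ha
    refine ⟨b, hmem' b fun i => ?_, rfl⟩
    have hb : r₁ b = 0 := by
      have : r₀ 0 + -r₁ b = 0 := hab
      simpa using this
    obtain ⟨k, hk⟩ := h₁.ker b hb
    have := congrArg (c' i) (isTorsion_of_pow hk)
    rw [map_smul, map_zero, smul_eq_zero_iff_right (pow_ne_zero _ X_ne_zero)] at this
    rw [this, degree_zero]
    exact WithBot.bot_lt_coe _

end Cohomology

end SteinbergStack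

namespace SteinbergStack

/-! ## The index of a linear map -/

section Index

variable {K : Type*} [Field K] {M₁ M₂ M₃ N₁ N₂ N₃ : Type*} [AddCommGroup M₁] [Module K M₁]
  [AddCommGroup M₂] [Module K M₂] [AddCommGroup M₃] [Module K M₃] [AddCommGroup N₁] [Module K N₁]
  [AddCommGroup N₂] [Module K N₂] [AddCommGroup N₃] [Module K N₃]
  {i₁ : M₁ →ₗ[K] N₁} {i₂ : M₂ →ₗ[K] N₂} {i₃ : M₃ →ₗ[K] N₃}

/-- The alternating sum of dimensions in the six-term kernel–cokernel sequence of the snake lemma.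
-/
theorem index_eq_add_of_exact {f₁ : M₁ →ₗ[K] M₂} {f₂ : M₂ →ₗ[K] M₃} {g₁ : N₁ →ₗ[K] N₂}
    {g₂ : N₂ →ₗ[K] N₃} (hf₁ : Function.Injective f₁) (hf : Function.Exact f₁ f₂)
    (hf₂ : Function.Surjective f₂) (hg₁ : Function.Injective g₁) (hg : Function.Exact g₁ g₂)
    (hg₂ : Function.Surjective g₂) (h₁ : ∀ m, g₁ (i₁ m) = i₂ (f₁ m))
    (h₂ : ∀ m, g₂ (i₂ m) = i₃ (f₂ m))
    (k₁ : Module.Finite K (LinearMap.ker i₁)) (k₂ : Module.Finite K (LinearMap.ker i₂))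
    (k₃ : Module.Finite K (LinearMap.ker i₃)) (c₁ : Module.Finite K (N₁ ⧸ LinearMap.range i₁))
    (c₂ : Module.Finite K (N₂ ⧸ LinearMap.range i₂))
    (c₃ : Module.Finite K (N₃ ⧸ LinearMap.range i₃)) : i₂.index = i₁.index + i₃.index := by
  have h₁' : g₁ ∘ₗ i₁ = i₂ ∘ₗ f₁ := LinearMap.ext h₁
  have h₂' : g₂ ∘ₗ i₂ = i₃ ∘ₗ f₂ := LinearMap.ext h₂
  let F₁ : LinearMap.ker i₁ →ₗ[K] LinearMap.ker i₂ := f₁.restrict fun m hm => by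
    rw [LinearMap.mem_ker] at hm ⊢; rw [← h₁, hm, map_zero]
  let F₂ : LinearMap.ker i₂ →ₗ[K] LinearMap.ker i₃ := f₂.restrict fun m hm => by
    rw [LinearMap.mem_ker] at hm ⊢; rw [← h₂, hm, map_zero]
  let G₁ : (N₁ ⧸ LinearMap.range i₁) →ₗ[K] N₂ ⧸ LinearMap.range i₂ :=
    Submodule.mapQ _ _ g₁ (by rintro _ ⟨m, rfl⟩; exact ⟨f₁ m, (h₁ m).symm⟩)
  let G₂ : (N₂ ⧸ LinearMap.range i₂) →ₗ[K] N₃ ⧸ LinearMap.range i₃ :=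
    Submodule.mapQ _ _ g₂ (by rintro _ ⟨m, rfl⟩; exact ⟨f₂ m, (h₂ m).symm⟩)
  have e₁ := SnakeLemma.exact_δ'_right i₁ i₂ i₃ f₁ f₂ hf g₁ g₂ hg h₁' h₂'
    (LinearMap.ker i₂).subtype (LinearMap.exact_subtype_ker_map i₂)
    (LinearMap.ker i₃).subtype (LinearMap.exact_subtype_ker_map i₃)
    (LinearMap.range i₁).mkQ (LinearMap.exact_map_mkQ_range i₁) hf₂ hg₁ F₂ rfl
    (Submodule.subtype_injective _)
  have e₂ := SnakeLemma.exact_δ'_left i₁ i₂ i₃ f₁ f₂ hf g₁ g₂ hg h₁' h₂'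
    (LinearMap.ker i₃).subtype (LinearMap.exact_subtype_ker_map i₃)
    (LinearMap.range i₁).mkQ (LinearMap.exact_map_mkQ_range i₁)
    (LinearMap.range i₂).mkQ (LinearMap.exact_map_mkQ_range i₂) hf₂ hg₁ G₁ rfl
    (Submodule.mkQ_surjective _)
  have a₁ : Function.Injective F₁ := fun a b h => Subtype.ext (hf₁ (congrArg Subtype.val h))
  have a₂ : Function.Exact F₁ F₂ := by
    rintro ⟨m, hm⟩
    constructor
    · intro h
      obtain ⟨a, rfl⟩ := (hf m).1 (congrArg Subtype.val h)
      exact ⟨⟨a, LinearMap.mem_ker.2 (hg₁ (by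
        rw [h₁, LinearMap.mem_ker.1 hm, map_zero]))⟩, rfl⟩
    · rintro ⟨a, ha⟩
      exact Subtype.ext ((hf m).2 ⟨a, congrArg Subtype.val ha⟩)
  have a₃ : Function.Exact G₁ G₂ := by
    intro z
    obtain ⟨z, rfl⟩ := Submodule.mkQ_surjective _ z
    constructor
    · intro h
      obtain ⟨c, hc⟩ := (Submodule.Quotient.mk_eq_zero _).1 h
      obtain ⟨b, rfl⟩ := hf₂ c
      obtain ⟨a, ha⟩ := (hg (z - i₂ b)).1 (by rw [map_sub, h₂, hc, sub_self])
      refine ⟨(LinearMap.range i₁).mkQ a, ?_⟩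
      change (LinearMap.range i₂).mkQ (g₁ a) = _
      rw [ha, map_sub, sub_eq_self]
      exact (Submodule.Quotient.mk_eq_zero _).2 ⟨b, rfl⟩
    · rintro ⟨a, ha⟩
      obtain ⟨a, rfl⟩ := Submodule.mkQ_surjective _ a
      rw [← ha]
      change (LinearMap.range i₃).mkQ (g₂ (g₁ a)) = 0
      rw [hg.apply_apply_eq_zero, map_zero]
  have a₄ : Function.Surjective G₂ := by
    intro z
    obtain ⟨z, rfl⟩ := Submodule.mkQ_surjective _ z
    obtain ⟨b, rfl⟩ := hg₂ z
    exact ⟨(LinearMap.range i₂).mkQ b, rfl⟩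
  have := Module.sum_neg_one_pow_finrank_eq_zero_of_exact_six F₁ F₂ _ G₁ G₂ a₁ a₂ e₁ e₂ a₃ a₄
  rw [LinearMap.index_eq_finrank_sub, LinearMap.index_eq_finrank_sub,
    LinearMap.index_eq_finrank_sub]
  linarith

theorem index_eq_of_equiv (e : M₁ ≃ₗ[K] M₂) (e' : N₁ ≃ₗ[K] N₂)
    (h : ∀ m, e' (i₁ m) = i₂ (e m)) : i₁.index = i₂.index := by
  have hk : (LinearMap.ker i₁).map (e : M₁ →ₗ[K] M₂) = LinearMap.ker i₂ := by
    ext m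
    constructor
    · rintro ⟨a, ha, rfl⟩
      exact LinearMap.mem_ker.2 ((h a).symm.trans (by rw [LinearMap.mem_ker.1 ha, map_zero]))
    · intro hm
      refine ⟨e.symm m, LinearMap.mem_ker.2 (e'.injective ?_), e.apply_symm_apply m⟩
      rw [h, e.apply_symm_apply, LinearMap.mem_ker.1 hm, map_zero]
  have hr : (LinearMap.range i₁).map (e' : N₁ →ₗ[K] N₂) = LinearMap.range i₂ := by
    ext m
    constructor
    · rintro ⟨_, ⟨a, rfl⟩, rfl⟩
      exact ⟨e a, (h a).symm⟩
    · rintro ⟨b, rfl⟩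
      exact ⟨_, ⟨e.symm b, rfl⟩, (h _).trans (by rw [e.apply_symm_apply])⟩
  rw [LinearMap.index_eq_finrank_sub, LinearMap.index_eq_finrank_sub,
    (Submodule.Quotient.equiv _ _ e' hr).finrank_eq, ← hk,
    (e.submoduleMap (LinearMap.ker i₁)).finrank_eq]

theorem index_baseChange (f : M₁ →ₗ[K] N₁) (L : Type*) [Field L] [Algebra K L] :
    (f.baseChange L).index = f.index := by
  have hk : Module.finrank L (LinearMap.ker (f.baseChange L)) =
      Module.finrank K (LinearMap.ker f) := by
    rw [← Module.finrank_baseChange (R := L) (S := K) (M' := LinearMap.ker f)]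
    have hex : LinearMap.ker (f.baseChange L) =
        LinearMap.range ((LinearMap.ker f).subtype.baseChange L) :=
      (LinearMap.exact_iff (f := (LinearMap.ker f).subtype.baseChange L) (g := f.baseChange L)).1
        (Module.Flat.lTensor_exact L (LinearMap.exact_subtype_ker_map f))
    rw [hex]
    exact (LinearEquiv.ofInjective ((LinearMap.ker f).subtype.baseChange L)
      (Module.Flat.lTensor_preserves_injective_linearMap _
        (Submodule.subtype_injective _))).finrank_eq.symm
  have hc : Module.finrank L ((L ⊗[K] N₁) ⧸ LinearMap.range (f.baseChange L)) =
      Module.finrank K (N₁ ⧸ LinearMap.range f) := by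
    rw [← Module.finrank_baseChange (R := L) (S := K) (M' := N₁ ⧸ LinearMap.range f)]
    have hex : LinearMap.ker ((LinearMap.range f).mkQ.baseChange L) =
        LinearMap.range (f.baseChange L) :=
      (LinearMap.exact_iff (f := f.baseChange L) (g := (LinearMap.range f).mkQ.baseChange L)).1
        (lTensor_exact L (LinearMap.exact_map_mkQ_range f) (Submodule.mkQ_surjective _))
    rw [← hex]
    exact (((LinearMap.range f).mkQ.baseChange L).quotKerEquivOfSurjective
      (LinearMap.lTensor_surjective L (Submodule.mkQ_surjective _))).finrank_eq
  rw [LinearMap.index_eq_finrank_sub, LinearMap.index_eq_finrank_sub, hk, hc]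

end Index

/-! ## The rank of a base change -/

section Rank

theorem isTorsion_baseChange {A B T : Type*} [CommRing A] [IsDomain A] [CommRing B] [IsDomain B] [Algebra A B]
    [FaithfulSMul A B] [AddCommGroup T] [Module A T] (hT : Module.IsTorsion A T) :
    Module.IsTorsion B (B ⊗[A] T) := by
  suffices ∀ u, u ∈ Submodule.torsion B (B ⊗[A] T) from fun u =>
    (Submodule.mem_torsion_iff u).1 (this u)
  intro u
  induction u with
  | zero => exact zero_mem _
  | add a b ha hb => exact add_mem ha hb
  | tmul b m =>
    obtain ⟨a, ha⟩ := hT (x := m)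
    refine (Submodule.mem_torsion_iff _).2 ⟨⟨algebraMap A B a, mem_nonZeroDivisors_of_ne_zero ?_⟩, ?_⟩
    · rw [Ne, FaithfulSMul.algebraMap_eq_zero_iff]
      exact nonZeroDivisors.ne_zero a.2
    · rw [Submonoid.mk_smul, algebraMap_smul, ← TensorProduct.tmul_smul]
      rw [Submonoid.smul_def] at ha
      rw [ha, TensorProduct.tmul_zero]

/-- The torsion submodule stays torsion after the extension and contributes nothing, while the free
quotient keeps its rank. The sequence stays exact because this quotient is flat, so flatness of `B`
plays no role. -/
theorem finrank_baseChange_of_finite {A B T : Type*} [CommRing A] [IsDomain A]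
    [IsPrincipalIdealRing A] [CommRing B] [IsDomain B] [Algebra A B]
    [FaithfulSMul A B] [AddCommGroup T] [Module A T] (hT : Module.Finite A T) :
    Module.finrank B (B ⊗[A] T) = Module.finrank A T := by
  let P := Submodule.torsion A T
  have : Module.Free A (T ⧸ P) := Module.free_of_finite_type_torsion_free'
  have h := finrank_eq_add_of_exact (f := P.subtype) (g := P.mkQ) hT
    (Submodule.subtype_injective _) (LinearMap.exact_subtype_mkQ P) (Submodule.mkQ_surjective _)
  have h' := finrank_eq_add_of_exact (f := P.subtype.baseChange B) (g := P.mkQ.baseChange B)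
    inferInstance
    (LinearMap.lTensor_injective_of_exact_of_flat P.mkQ (Submodule.mkQ_surjective _) P.subtype
      (Submodule.subtype_injective _) (LinearMap.exact_subtype_mkQ P) B)
    (lTensor_exact B (LinearMap.exact_subtype_mkQ P) (Submodule.mkQ_surjective _))
    (LinearMap.lTensor_surjective B (Submodule.mkQ_surjective _))
  have hP : Module.IsTorsion A P := Submodule.torsion_isTorsion
  rw [Module.finrank_eq_zero_iff_isTorsion.2 hP] at h
  rw [Module.finrank_eq_zero_iff_isTorsion.2 (isTorsion_baseChange (B := B) hP),
    Module.finrank_baseChange (M' := T ⧸ P)] at h'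
  omega

end Rank

end SteinbergStack

namespace SteinbergStack

/-! ## Classes of objects over a field -/

section SurjectiveChart

variable {K : Type*} [Field K] {M N : Type*} [AddCommGroup M] [Module K M] [AddCommGroup N]
  [Module K N] {x : Module.End K M} {t : Module.End K N} {r : M →ₗ[K] N}

/-- The image of `r` is finite-dimensional and stable under the injective map `t`, so `t ^ n` maps
it onto itself; an element moved into it by `t ^ n` was there already. -/
theorem IsChart.surjective_of_finite (h : IsChart x t r) (ht : IsUnit t) [Module.Finite K M] :
    Function.Surjective r := by
  intro z
  obtain ⟨n, m, hm⟩ := h.surj z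
  have hinj : Function.Injective (t ^ n) := ((Module.End.isUnit_iff _).1 (ht.pow n)).1
  have hle : (LinearMap.range r).map (t ^ n) ≤ LinearMap.range r := by
    rintro _ ⟨_, ⟨a, rfl⟩, rfl⟩
    exact ⟨(x ^ n) a, map_pow_of_comm h.comm n a⟩
  have heq : (LinearMap.range r).map (t ^ n) = LinearMap.range r :=
    Submodule.eq_of_le_of_finrank_eq hle ((LinearMap.range r).equivMapOfInjective _ hinj).finrank_eq.symm
  obtain ⟨_, ⟨a, rfl⟩, ha⟩ : r m ∈ (LinearMap.range r).map (t ^ n) := by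
    rw [heq]; exact ⟨m, rfl⟩
  exact ⟨a, hinj (ha.trans hm.symm)⟩

end SurjectiveChart

variable {K : Type u} [Field K]

/-! ### Rank and Euler characteristic on the projective line over a field. -/

namespace P1

variable {M : QRep P1Shape K}

theorem finite_ker_cech (h : IsQuasicoherent M) (hf : IsFinitelyPresented M) :
    Module.Finite K (LinearMap.ker (cech M)) := by
  obtain ⟨hr, h₀, h₁⟩ := isQuasicoherent_iff.1 h
  have f₀ := hf.1
  have f₁ := hf.2
  exact finite_kernel h₀ h₁ hr.t_tinv inferInstance inferInstance

theorem finite_coker_cech (h : IsQuasicoherent M) (hf : IsFinitelyPresented M) :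
    Module.Finite K (MOverlap M ⧸ LinearMap.range (cech M)) := by
  obtain ⟨hr, h₀, h₁⟩ := isQuasicoherent_iff.1 h
  have f₀ := hf.1
  rw [cech, LinearMap.range_coprod, LinearMap.range_neg]
  exact finite_cokernel h₀ h₁ hr.tinv_t inferInstance

theorem euler_eq_index (M : QRep P1Shape K) : euler M = (cech M).index := rfl

theorem cech_apply {R : Type u} [CommRing R] (M : QRep P1Shape R) (m : M0 M × MInfty M) :
    cech M m = res0 M m.1 - resInfty M m.2 := (sub_eq_add_neg _ _).symm

theorem euler_add {A B C : QRep P1Shape K} (S : ShortExact A B C)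
    (hA : Heart.coh.IsFamily A) (hB : Heart.coh.IsFamily B) (hC : Heart.coh.IsFamily C) :
    euler B = euler A + euler C := by
  refine index_eq_add_of_exact (f₁ := (S.f P1Vertex.zero).prodMap (S.f P1Vertex.infty))
    (f₂ := (S.g P1Vertex.zero).prodMap (S.g P1Vertex.infty)) (g₁ := S.f P1Vertex.overlap)
    (g₂ := S.g P1Vertex.overlap) ?_ ?_ ?_ (S.inj _) (S.exact _) (S.surj _) ?_ ?_
    (finite_ker_cech hA.1 hA.2) (finite_ker_cech hB.1 hB.2) (finite_ker_cech hC.1 hC.2)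
    (finite_coker_cech hA.1 hA.2) (finite_coker_cech hB.1 hB.2) (finite_coker_cech hC.1 hC.2)
  · exact (S.inj P1Vertex.zero).prodMap (S.inj P1Vertex.infty)
  · rintro ⟨a, b⟩
    constructor
    · intro h
      obtain ⟨a', rfl⟩ := (S.exact P1Vertex.zero a).1 (congrArg Prod.fst h)
      obtain ⟨b', rfl⟩ := (S.exact P1Vertex.infty b).1 (congrArg Prod.snd h)
      exact ⟨(a', b'), rfl⟩
    · rintro ⟨⟨a', b'⟩, h⟩
      exact Prod.ext ((S.exact P1Vertex.zero a).2 ⟨a', congrArg Prod.fst h⟩)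
        ((S.exact P1Vertex.infty b).2 ⟨b', congrArg Prod.snd h⟩)
  · exact (S.surj P1Vertex.zero).prodMap (S.surj P1Vertex.infty)
  · rintro ⟨a, b⟩
    rw [cech_apply, cech_apply, map_sub]
    exact congrArg₂ _ (S.f_comm P1Arrow.res0 a) (S.f_comm P1Arrow.resInfty b)
  · rintro ⟨a, b⟩
    rw [cech_apply, cech_apply, map_sub]
    exact congrArg₂ _ (S.g_comm P1Arrow.res0 a) (S.g_comm P1Arrow.resInfty b)

theorem rank_add {A B C : QRep P1Shape K} (S : ShortExact A B C)
    (hB : Heart.coh.IsFamily B) : rank B = rank A + rank C := by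
  have f₀ := hB.2.1
  rw [rank, rank, rank, ← Nat.cast_add, Nat.cast_inj]
  exact finrank_eq_add_of_exact (M := Module.AEval' (P1.x A)) (N := Module.AEval' (P1.x B))
    (P := Module.AEval' (P1.x C)) inferInstance
    (aevalMap_injective (S.f_comm P1Arrow.x) (S.inj P1Vertex.zero))
    (aevalMap_exact (S.f_comm P1Arrow.x) (S.g_comm P1Arrow.x) (S.exact P1Vertex.zero))
    (aevalMap_surjective (S.g_comm P1Arrow.x) (S.surj P1Vertex.zero))

/-- A sheaf of rank zero is finite-dimensional on the chart of `x`, so restriction from this chart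
is already onto. In particular `H¹ = 0`, and the degree is `dim H⁰ ≥ 0`. -/
theorem cech_surjective_of_rank_eq_zero (h : Heart.coh.IsFamily M) (hr : rank M = 0) :
    Function.Surjective (res0 M) ∧ Function.Surjective (cech M) := by
  obtain ⟨hrel, h₀, h₁⟩ := isQuasicoherent_iff.1 h.1
  have f₀ := h.2.1
  have : Module.Finite K (M0 M) :=
    (finrank_aeval_eq_zero_iff (f := x M) inferInstance).1 (Nat.cast_eq_zero.1 hr)
  have hs := h₀.surjective_of_finite hrel.isUnit_t
  refine ⟨hs, fun z => ?_⟩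
  obtain ⟨a, rfl⟩ := hs z
  exact ⟨(a, 0), by rw [cech_apply, map_zero, sub_zero]⟩

theorem cls_mem_pos (h : Heart.coh.IsFamily M) : Heart.coh.cls M ∈ Heart.coh.pos := by
  change 0 < rank M ∨ (rank M = 0 ∧ 0 ≤ degree M)
  rcases Nat.eq_zero_or_pos (Module.finrank K[X] (Module.AEval' (x M))) with hr | hr
  · have hr : rank M = 0 := Nat.cast_eq_zero.2 hr
    refine Or.inr ⟨hr, ?_⟩
    rw [degree, hr, euler_eq_index,
      LinearMap.index_of_surjective (cech_surjective_of_rank_eq_zero h hr).2]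
    simp
  · exact Or.inl (Nat.cast_pos.2 hr)

/-- Now `H⁰ = 0` as well, so the Čech map is injective. Every section at infinity agrees on the
overlap with some section over the other chart, hence is zero, and the rest follows. -/
theorem subsingleton_of_cls_eq_zero (h : Heart.coh.IsFamily M) (hc : Heart.coh.cls M = 0)
    (v : P1Vertex) : Subsingleton (M.obj v) := by
  have hr : rank M = 0 := congrArg Prod.fst hc
  have hd : degree M = 0 := congrArg Prod.snd hc
  obtain ⟨hs₀, hs⟩ := cech_surjective_of_rank_eq_zero h hr
  have hfin := finite_ker_cech h.1 h.2
  rw [degree, hr, euler_eq_index, LinearMap.index_of_surjective hs, sub_zero, Nat.cast_eq_zero,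
    Submodule.finrank_eq_zero, LinearMap.ker_eq_bot] at hd
  have h₁ : Subsingleton (MInfty M) := by
    refine subsingleton_of_forall_eq 0 fun b => ?_
    obtain ⟨a, ha⟩ := hs₀ (resInfty M b)
    exact congrArg Prod.snd (@hd (a, b) 0 (by rw [cech_apply, map_zero, ha, sub_self]))
  have h₂ : Subsingleton (MOverlap M) := by
    refine subsingleton_of_forall_eq 0 fun z => ?_
    obtain ⟨n, m, hm⟩ := h.1.surjInfty z
    have hinj : Function.Injective (tinv M ^ n) :=
      ((Module.End.isUnit_iff _).1 (((isQuasicoherent_iff.1 h.1).1.isUnit_tinv).pow n)).1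
    refine hinj ?_
    rw [hm, Subsingleton.elim m 0, map_zero, map_zero]
  have h₀ : Subsingleton (M0 M) := subsingleton_of_forall_eq 0 fun a =>
    congrArg Prod.fst (@hd (a, 0) 0 (Subsingleton.elim _ _))
  cases v
  exacts [h₀, h₁, h₂]

theorem euler_baseChange (M : QRep P1Shape K) (L : Type u) [Field L] [Algebra K L] :
    euler (M.baseChange L) = euler M := by
  rw [euler_eq_index, euler_eq_index, ← index_baseChange (cech M) L]
  refine (index_eq_of_equiv (TensorProduct.prodRight K L L (M0 M) (MInfty M))
    (LinearEquiv.refl L _) fun u => ?_).symm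
  induction u with
  | zero => rw [map_zero, map_zero, map_zero, map_zero]
  | add a b ha hb => rw [map_add, map_add, map_add, map_add, ha, hb]
  | tmul a m =>
    rw [cech_apply]
    change a ⊗ₜ cech M m = a ⊗ₜ res0 M m.1 - a ⊗ₜ resInfty M m.2
    rw [cech_apply, TensorProduct.tmul_sub]

attribute [local instance] Polynomial.algebra in
theorem rank_baseChange (h : Heart.coh.IsFamily M) (L : Type u) [Field L] [Algebra K L] :
    rank (M.baseChange L) = rank M := by
  have f₀ := h.2.1
  have hinj : FaithfulSMul K[X] L[X] := by
    rw [faithfulSMul_iff_algebraMap_injective]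
    exact Polynomial.map_injective _ (algebraMap K L).injective
  rw [rank, rank, Nat.cast_inj,
    ← finrank_baseChange_of_finite (A := K[X]) (B := L[X]) (T := Module.AEval' (x M)) inferInstance]
  exact (aevalBaseChange L (x M)).finrank_eq

end P1

/-! ### Additivity, positivity and strictness of the class in either kind of heart. -/

namespace Heart

variable {H : Heart}

theorem cls_add {A B C : QRep H.shape K} (S : ShortExact A B C) (hA : H.IsFamily A)
    (hB : H.IsFamily B) (hC : H.IsFamily C) : H.cls B = H.cls A + H.cls C := by
  cases H with
  | coh =>
    have h₁ := P1.rank_add S hB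
    have h₂ := P1.euler_add S hA hB hC
    refine Prod.ext h₁ ?_
    change P1.degree B = P1.degree A + P1.degree C
    rw [P1.degree, P1.degree, P1.degree, h₁, h₂]
    ring
  | rep n =>
    have h : ∀ v, KroneckerDim B v = KroneckerDim A v + KroneckerDim C v := fun v => by
      have := hB v
      rw [KroneckerDim, KroneckerDim, KroneckerDim, ← Nat.cast_add, Nat.cast_inj]
      exact finrank_eq_add_of_exact inferInstance (S.inj v) (S.exact v) (S.surj v)
    change KroneckerDim B .one • _ + KroneckerDim B .two • _ = _ + _ + (_ + _)
    rw [h, h, add_smul, add_smul]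
    abel

theorem cls_mem_pos {M : QRep H.shape K} (h : H.IsFamily M) : H.cls M ∈ H.pos := by
  cases H with
  | coh => exact P1.cls_mem_pos h
  | rep n =>
    have h₁ : 0 ≤ KroneckerDim M .one := Nat.cast_nonneg _
    have h₂ : 0 ≤ KroneckerDim M .two := Nat.cast_nonneg _
    simp only [cls, pos, Set.mem_ofPred_eq, Prod.fst_add, Prod.snd_add, Prod.smul_fst,
      Prod.smul_snd, smul_eq_mul]
    constructor <;> nlinarith

theorem subsingleton_of_cls_eq_zero {M : QRep H.shape K} (h : H.IsFamily M) (hc : H.cls M = 0)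
    (v : H.shape.V) : Subsingleton (M.obj v) := by
  cases H with
  | coh => exact P1.subsingleton_of_cls_eq_zero h hc v
  | rep n =>
    have := h v
    have h₁ := congrArg Prod.fst hc
    have h₂ := congrArg Prod.snd hc
    simp only [cls, Prod.fst_add, Prod.snd_add, Prod.smul_fst, Prod.smul_snd, smul_eq_mul,
      Prod.fst_zero, Prod.snd_zero] at h₁ h₂
    -- The classes `(1, 1 - n)` and `(-1, n)` of the simples have determinant `1`, so dimensions are
    -- integral combinations of rank and degree.
    have h₃ : KroneckerDim M .one = 0 := by linear_combination n * h₁ + h₂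
    have h₄ : KroneckerDim M .two = 0 := by linear_combination (n - 1) * h₁ + h₂
    cases v
    · exact Module.finrank_zero_iff.1 (Nat.cast_eq_zero.1 h₃)
    · exact Module.finrank_zero_iff.1 (Nat.cast_eq_zero.1 h₄)

theorem cls_baseChange {M : QRep H.shape K} (h : H.IsFamily M) (L : Type u) [Field L]
    [Algebra K L] : H.cls (M.baseChange L) = H.cls M := by
  cases H with
  | coh =>
    refine Prod.ext (P1.rank_baseChange h L) ?_
    change P1.degree _ = P1.degree M
    rw [P1.degree, P1.degree, P1.rank_baseChange h L, P1.euler_baseChange]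
  | rep n =>
    have h' (v) : KroneckerDim (M.baseChange L) v = KroneckerDim M v :=
      congrArg Nat.cast (Module.finrank_baseChange (R := L) (S := K) (M' := M.obj v))
    change KroneckerDim _ .one • _ + KroneckerDim _ .two • _ = _
    rw [h', h']
    rfl

theorem cls_of_subsingleton {M : QRep H.shape K} (h : ∀ v, Subsingleton (M.obj v)) :
    H.cls M = 0 := by
  have hM : H.IsFamily M := isFamily_of_subsingleton h
  -- For a zero object `0 → M → M → M → 0` is exact, so its class equals its double.
  have := cls_add (ShortExact.ofEquiv (A := M) (B := M) (C := M) (fun v => LinearEquiv.refl K _)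
    (fun _ _ => rfl) h) hM hM hM
  exact left_eq_add.1 this

theorem zero_mem_pos (H : Heart) : (0 : ℤ × ℤ) ∈ H.pos := by
  cases H <;> simp [pos]

theorem add_mem_pos {c d : ℤ × ℤ} (hc : c ∈ H.pos) (hd : d ∈ H.pos) : c + d ∈ H.pos := by
  cases H with
  | coh =>
    simp only [pos, Set.mem_ofPred_eq, Prod.fst_add, Prod.snd_add] at *
    omega
  | rep n =>
    simp only [pos, Set.mem_ofPred_eq, Prod.fst_add, Prod.snd_add] at *
    constructor
    · linarith [hc.1, hd.1]
    · linarith [hc.2, hd.2]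

theorem eq_zero_of_mem_pos_of_neg_mem {c : ℤ × ℤ} (hc : c ∈ H.pos) (hc' : -c ∈ H.pos) :
    c = 0 := by
  cases H with
  | coh =>
    simp only [pos, Set.mem_ofPred_eq, Prod.fst_neg, Prod.snd_neg] at *
    refine Prod.ext ?_ ?_ <;> simp only [Prod.fst_zero, Prod.snd_zero] <;> omega
  | rep n =>
    simp only [pos, Set.mem_ofPred_eq, Prod.fst_neg, Prod.snd_neg] at *
    have h₁ : c.1 = 0 := by nlinarith [hc.1, hc.2, hc'.1, hc'.2]
    have h₂ : c.2 = 0 := by rw [h₁] at hc hc'; linarith [hc.1, hc'.1]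
    exact Prod.ext h₁ h₂

end Heart

end SteinbergStack

namespace SteinbergStack

/-! ## Families of a given class -/

variable {Q : Shape} {R : Type u} [CommRing R] {H : Heart}

theorem Heart.cls_congr {K : Type u} [Field K] {A B : QRep H.shape K} (hA : H.IsFamily A)
    (e : ∀ v, A.obj v ≃ₗ[K] B.obj v) (he : ∀ a x, e _ (A.map a x) = B.map a (e _ x)) :
    H.cls A = H.cls B := by
  let S := ShortExact.ofEquiv (C := zeroRep H.shape K) e he fun v => inferInstance
  have h₀ : H.IsFamily (zeroRep H.shape K) := isFamily_of_subsingleton fun v => inferInstance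
  have hB : H.IsFamily B := IsFamily.of_shortExact S
    (hA.relations.of_surjective (fun v => (e v).toLinearMap) he fun v => (e v).surjective) hA h₀
  rw [cls_add S hA hB h₀, cls_of_subsingleton (M := zeroRep H.shape K) fun v => inferInstance,
    add_zero]

theorem cancelBaseChange_comm {M N : Type*} [AddCommGroup M] [Module R M] [AddCommGroup N]
    [Module R N] (f : M →ₗ[R] N) (R' K : Type*) [CommRing R'] [Algebra R R'] [CommRing K]
    [Algebra R K] [Algebra R' K] [IsScalarTower R R' K] (u : K ⊗[R'] (R' ⊗[R] M)) :
    AlgebraTensorModule.cancelBaseChange R R' K K N ((f.baseChange R').baseChange K u) =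
      f.baseChange K (AlgebraTensorModule.cancelBaseChange R R' K K M u) := by
  induction u with
  | zero => simp only [map_zero]
  | add u₁ u₂ h₁ h₂ => simp only [map_add, h₁, h₂]
  | tmul k u =>
    induction u with
    | zero => simp only [TensorProduct.tmul_zero, map_zero]
    | add u₁ u₂ h₁ h₂ => simp only [TensorProduct.tmul_add, map_add, h₁, h₂]
    | tmul r m => simp

namespace Heart.HasClass

theorem of_subsingleton {M : QRep H.shape R} (h : ∀ v, Subsingleton (M.obj v)) :
    H.HasClass M 0 where
  family := isFamily_of_subsingleton h
  flat v := by have := h v; infer_instance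
  fibre K _ _ := cls_of_subsingleton fun v => by
    have := h v
    exact inferInstanceAs (Subsingleton (K ⊗[R] M.obj v))

theorem of_shortExact {A B C : QRep H.shape R} (S : ShortExact A B C) (hB : H.Relations B)
    {c d : ℤ × ℤ} (hA : H.HasClass A c) (hC : H.HasClass C d) : H.HasClass B (c + d) where
  family := IsFamily.of_shortExact S hB hA.family hC.family
  flat v := by
    have := hA.flat v
    have := hC.flat v
    exact flat_of_exact (S.inj v) (S.exact v) (S.surj v)
  fibre K _ _ := by
    rw [cls_add (S.baseChange hC.flat K) (hA.family.baseChange K)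
      ((IsFamily.of_shortExact S hB hA.family hC.family).baseChange K) (hC.family.baseChange K),
      hA.fibre, hC.fibre]

theorem of_equiv {A B : QRep H.shape R} {c : ℤ × ℤ} (hA : H.HasClass A c)
    (e : ∀ v, A.obj v ≃ₗ[R] B.obj v) (he : ∀ a x, e _ (A.map a x) = B.map a (e _ x)) :
    H.HasClass B c := by
  have := of_shortExact (ShortExact.ofEquiv (C := zeroRep H.shape R) e he fun v => inferInstance)
    (hA.family.relations.of_surjective (fun v => (e v).toLinearMap) he fun v => (e v).surjective)
    hA (of_subsingleton (M := zeroRep H.shape R) fun v => inferInstance)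
  rwa [add_zero] at this

theorem baseChange {M : QRep H.shape R} {c : ℤ × ℤ} (hM : H.HasClass M c) (R' : Type u)
    [CommRing R'] [Algebra R R'] : H.HasClass (M.baseChange R') c where
  family := hM.family.baseChange R'
  flat v := by
    have := hM.flat v
    exact inferInstanceAs (Module.Flat R' (R' ⊗[R] M.obj v))
  fibre K _ _ := by
    let : Algebra R K := ((algebraMap R' K).comp (algebraMap R R')).toAlgebra
    have : IsScalarTower R R' K := IsScalarTower.of_algebraMap_eq' rfl
    rw [← hM.fibre K]
    exact cls_congr ((hM.family.baseChange R').baseChange K)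
      (fun v => AlgebraTensorModule.cancelBaseChange R R' K K (M.obj v)) fun a u =>
      cancelBaseChange_comm (M.map a) R' K u

variable {K : Type u} [Field K]

theorem cls_eq {M : QRep H.shape K} {c : ℤ × ℤ} (hM : H.HasClass M c) : H.cls M = c := by
  rw [← hM.fibre K, cls_baseChange hM.family]

end Heart.HasClass

theorem Heart.IsFamily.hasClass {K : Type u} [Field K] {M : QRep H.shape K} (h : H.IsFamily M) :
    H.HasClass M (H.cls M) :=
  ⟨h, fun _ => inferInstance, fun L _ _ => cls_baseChange h L⟩

/-! ## Subquotients -/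

namespace SubRep

variable {M : QRep Q R}

instance : IsModularLattice (SubRep M) where
  sup_inf_le_assoc_of_le {_} _ _ h v := IsModularLattice.sup_inf_le_assoc_of_le _ (h v)

variable {A B A' B' A'' B'' : SubRep M}

/-- The map of subquotients induced by the identity. -/
def subquotMap (hA : A ≤ A') (hB : A ⊓ B ≤ B') (v : Q.V) :
    (A.subquot B).obj v →ₗ[R] (A'.subquot B').obj v :=
  Submodule.mapQ _ _ (Submodule.inclusion (hA v)) fun z hz => hB v ⟨z.2, hz⟩

theorem subquotMap_comm (hA : A ≤ A') (hB : A ⊓ B ≤ B') (e : Q.E)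
    (z : (A.subquot B).obj (Q.src e)) : subquotMap hA hB _ ((A.subquot B).map e z) =
      (A'.subquot B').map e (subquotMap hA hB _ z) := by
  obtain ⟨z, rfl⟩ := Submodule.mkQ_surjective _ z
  rfl

theorem subquotMap_eq_zero (hA : A ≤ A') (hB : A ⊓ B ≤ B') {v : Q.V} {z : A.carrier v} :
    subquotMap hA hB v (Submodule.Quotient.mk z) = 0 ↔ (z : M.obj v) ∈ B'.carrier v :=
  Submodule.Quotient.mk_eq_zero _

theorem subquotMap_injective (hA : A ≤ A') (hB : A ⊓ B ≤ B') (hi : A ⊓ B' ≤ B) (v : Q.V) :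
    Function.Injective (subquotMap hA hB v) := by
  rw [injective_iff_map_eq_zero]
  intro z hz
  obtain ⟨z, rfl⟩ := Submodule.mkQ_surjective _ z
  exact (Submodule.Quotient.mk_eq_zero _).2 (hi v ⟨z.2, (subquotMap_eq_zero hA hB).1 hz⟩)

theorem subquotMap_surjective (hA : A ≤ A') (hB : A ⊓ B ≤ B') (hs : A' ≤ A ⊔ B') (v : Q.V) :
    Function.Surjective (subquotMap hA hB v) := by
  intro z
  obtain ⟨z, rfl⟩ := Submodule.mkQ_surjective _ z
  obtain ⟨a, ha, b, hb, hab⟩ := Submodule.mem_sup.1 (hs v z.2)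
  refine ⟨Submodule.Quotient.mk ⟨a, ha⟩, (Submodule.Quotient.eq _).2 ?_⟩
  change a - (z : M.obj v) ∈ B'.carrier v
  rw [← hab, sub_add_cancel_left]
  exact neg_mem hb

/-- Subquotients which are identified by the identity. -/
noncomputable def subquotEquiv (hA : A ≤ A') (hB : A ⊓ B ≤ B') (hi : A ⊓ B' ≤ B)
    (hs : A' ≤ A ⊔ B') (v : Q.V) : (A.subquot B).obj v ≃ₗ[R] (A'.subquot B').obj v :=
  LinearEquiv.ofBijective (subquotMap hA hB v)
    ⟨subquotMap_injective hA hB hi v, subquotMap_surjective hA hB hs v⟩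

theorem subsingleton_subquot_iff :
    (∀ v, Subsingleton ((A.subquot B).obj v)) ↔ A ≤ B := by
  refine forall_congr' fun v => ?_
  rw [Submodule.Quotient.subsingleton_iff, Submodule.submoduleOf_eq_top]

/-- A short exact sequence of subquotients. -/
def shortExact (hA : A ≤ A') (hB : A ⊓ B ≤ B') (hA' : A' ≤ A'') (hB' : A' ⊓ B' ≤ B'')
    (hi : A ⊓ B' ≤ B) (hz : A ≤ B'') (he : A' ⊓ B'' ≤ A ⊔ B') (hs : A'' ≤ A' ⊔ B'') :
    ShortExact (A.subquot B) (A'.subquot B') (A''.subquot B'') where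
  f := subquotMap hA hB
  g := subquotMap hA' hB'
  f_comm := subquotMap_comm hA hB
  g_comm := subquotMap_comm hA' hB'
  inj := subquotMap_injective hA hB hi
  surj := subquotMap_surjective hA' hB' hs
  exact v z := by
    obtain ⟨z, rfl⟩ := Submodule.mkQ_surjective _ z
    constructor
    · intro h
      have h := (subquotMap_eq_zero hA' hB').1 h
      obtain ⟨a, ha, b, hb, hab⟩ := Submodule.mem_sup.1 (he v ⟨z.2, h⟩)
      refine ⟨Submodule.Quotient.mk ⟨a, ha⟩, (Submodule.Quotient.eq _).2 ?_⟩
      change a - (z : M.obj v) ∈ B'.carrier v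
      rw [← hab, sub_add_cancel_left]
      exact neg_mem hb
    · rintro ⟨a, ha⟩
      obtain ⟨a, rfl⟩ := Submodule.mkQ_surjective _ a
      rw [← ha]
      exact (Submodule.Quotient.mk_eq_zero _).2 (hz v a.2)

/-- `B / A → C / A → C / B`. -/
def shortExactOfLE {A B C : SubRep M} (h : A ≤ B) (h' : B ≤ C) :
    ShortExact (B.subquot A) (C.subquot A) (C.subquot B) :=
  shortExact h' inf_le_right le_rfl (inf_le_right.trans h) inf_le_right le_rfl
    (inf_le_right.trans le_sup_left) le_sup_left

theorem subquotEquiv_comm (hA : A ≤ A') (hB : A ⊓ B ≤ B') (hi : A ⊓ B' ≤ B) (hs : A' ≤ A ⊔ B')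
    (e : Q.E) (z : (A.subquot B).obj (Q.src e)) :
    subquotEquiv hA hB hi hs _ ((A.subquot B).map e z) =
      (A'.subquot B').map e (subquotEquiv hA hB hi hs _ z) := subquotMap_comm hA hB e z

end SubRep

theorem Heart.Relations.subquot {F : QRep H.shape R} (hF : H.Relations F) (A B : SubRep F) :
    H.Relations (A.subquot B) := by
  have h : H.Relations (A.subquot ⊥) := by
    refine hF.of_injective (fun v => Submodule.liftQ _ (Submodule.subtype _) fun _ hz => hz) ?_ ?_
    · intro e z
      obtain ⟨z, rfl⟩ := Submodule.mkQ_surjective _ z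
      rfl
    · intro v
      rw [injective_iff_map_eq_zero]
      intro z hz
      obtain ⟨z, rfl⟩ := Submodule.mkQ_surjective _ z
      exact (Submodule.Quotient.mk_eq_zero _).2 hz
  exact h.of_surjective _ (SubRep.subquotMap_comm le_rfl (inf_le_right.trans bot_le))
    (SubRep.subquotMap_surjective le_rfl (inf_le_right.trans bot_le) le_sup_left)

namespace Heart.HasClass

variable {F : QRep H.shape R}

theorem subquot_add (hF : H.Relations F) {A B C : SubRep F} (h : A ≤ B) (h' : B ≤ C)
    {c d : ℤ × ℤ} (hc : H.HasClass (B.subquot A) c) (hd : H.HasClass (C.subquot B) d) :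
    H.HasClass (C.subquot A) (c + d) :=
  of_shortExact (SubRep.shortExactOfLE h h') (hF.subquot _ _) hc hd

theorem subquot_self (A : SubRep F) : H.HasClass (A.subquot A) 0 :=
  of_subsingleton (SubRep.subsingleton_subquot_iff.2 le_rfl)

theorem subquot_congr {A B A' B' : SubRep F} {c : ℤ × ℤ} (h : H.HasClass (A.subquot B) c)
    (hA : A ≤ A') (hB : A ⊓ B ≤ B') (hi : A ⊓ B' ≤ B) (hs : A' ≤ A ⊔ B') :
    H.HasClass (A'.subquot B') c :=
  h.of_equiv (SubRep.subquotEquiv hA hB hi hs) (SubRep.subquotEquiv_comm hA hB hi hs)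

theorem subquot_congr' {A B A' B' : SubRep F} {c : ℤ × ℤ} (h : H.HasClass (A'.subquot B') c)
    (hA : A ≤ A') (hB : A ⊓ B ≤ B') (hi : A ⊓ B' ≤ B) (hs : A' ≤ A ⊔ B') :
    H.HasClass (A.subquot B) c := by
  refine h.of_equiv (fun v => (SubRep.subquotEquiv hA hB hi hs v).symm) fun a x => ?_
  rw [LinearEquiv.symm_apply_eq, SubRep.subquotEquiv_comm, LinearEquiv.apply_symm_apply]

/-- Telescoping along a chain of subobjects with graded pieces of given classes. -/
theorem of_chain (hF : H.Relations F) (h : ℕ →o SubRep F) (c : ℕ → ℤ × ℤ) {m n : ℕ} (hmn : m ≤ n)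
    (hc : ∀ q, m ≤ q → q < n → H.HasClass ((h (q + 1)).subquot (h q)) (c q)) :
    H.HasClass ((h n).subquot (h m)) (∑ q ∈ Finset.Ico m n, c q) := by
  induction n, hmn using Nat.le_induction with
  | base => rw [Finset.Ico_self, Finset.sum_empty]; exact subquot_self _
  | succ n hn ih =>
    rw [Finset.sum_Ico_succ_top hn]
    exact subquot_add hF (h.monotone hn) (h.monotone n.le_succ)
      (ih fun q h₁ h₂ => hc q h₁ (h₂.trans n.lt_succ_self)) (hc n hn n.lt_succ_self)

end Heart.HasClass

/-! ## Base change of subquotients -/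

section BaseChange

variable (R' : Type u) [CommRing R'] [Algebra R R'] {M : QRep Q R}

/-- Two quotients by the same submodule are isomorphic. -/
noncomputable def equivOfKerEq {U P P' : Type*} [AddCommGroup U] [Module R U] [AddCommGroup P]
    [Module R P] [AddCommGroup P'] [Module R P'] (p : U →ₗ[R] P) (g : U →ₗ[R] P')
    (hp : Function.Surjective p) (hg : Function.Surjective g)
    (h : LinearMap.ker p = LinearMap.ker g) : P ≃ₗ[R] P' :=
  (p.quotKerEquivOfSurjective hp).symm ≪≫ₗ Submodule.quotEquivOfEq _ _ h ≪≫ₗ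
    g.quotKerEquivOfSurjective hg

theorem equivOfKerEq_apply {U P P' : Type*} [AddCommGroup U] [Module R U] [AddCommGroup P]
    [Module R P] [AddCommGroup P'] [Module R P'] {p : U →ₗ[R] P} {g : U →ₗ[R] P'}
    (hp : Function.Surjective p) (hg : Function.Surjective g)
    (h : LinearMap.ker p = LinearMap.ker g) (u : U) : equivOfKerEq p g hp hg h (p u) = g u := by
  have : (p.quotKerEquivOfSurjective hp).symm (p u) = Submodule.Quotient.mk u := by
    rw [LinearEquiv.symm_apply_eq]; rfl
  rw [equivOfKerEq, LinearEquiv.trans_apply, LinearEquiv.trans_apply, this]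
  rfl

namespace SubRep

variable (A B : SubRep M)

/-- The canonical map `R' ⊗ B → (R' ⊗ B) / (R' ⊗ A)`, the latter taken inside `R' ⊗ M`. -/
noncomputable def toSubquotBaseChange (v : Q.V) :
    R' ⊗[R] B.carrier v →ₗ[R'] ((B.baseChange R').subquot (A.baseChange R')).obj v :=
  Submodule.mkQ _ ∘ₗ LinearMap.codRestrict _ ((B.carrier v).subtype.baseChange R') fun u => by
    induction u with
    | zero => rw [map_zero]; exact zero_mem _
    | add a b ha hb => rw [map_add]; exact add_mem ha hb
    | tmul r b => exact Submodule.tmul_mem_baseChange_of_mem r b.2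

theorem range_subtype_baseChange (v : Q.V) :
    LinearMap.range ((B.carrier v).subtype.baseChange R') = (B.baseChange R').carrier v :=
  rfl

variable {A B}

theorem toSubquotBaseChange_surjective (v : Q.V) :
    Function.Surjective (toSubquotBaseChange R' A B v) := by
  refine (Submodule.mkQ_surjective _).comp ?_
  rintro ⟨u, hu⟩
  rw [← range_subtype_baseChange] at hu
  obtain ⟨u, rfl⟩ := hu
  exact ⟨u, rfl⟩

/-- Flatness of `M / B` makes `R' ⊗ B → R' ⊗ M` injective, so passing to the image inside `R' ⊗ M`
loses nothing of `R' ⊗ B`. Nothing is needed for `A` beyond `A ≤ B`. -/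
theorem ker_toSubquotBaseChange (h : A ≤ B)
    (hB : ∀ v, Module.Flat R (((⊤ : SubRep M).subquot B).obj v)) (v : Q.V) :
    LinearMap.ker (((A.carrier v).submoduleOf (B.carrier v)).mkQ.baseChange R') =
      LinearMap.ker (toSubquotBaseChange R' A B v) := by
  have hex : LinearMap.ker (((A.carrier v).submoduleOf (B.carrier v)).mkQ.baseChange R') =
      LinearMap.range (((A.carrier v).submoduleOf (B.carrier v)).subtype.baseChange R') :=
    (LinearMap.exact_iff
      (f := ((A.carrier v).submoduleOf (B.carrier v)).subtype.baseChange R')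
      (g := ((A.carrier v).submoduleOf (B.carrier v)).mkQ.baseChange R')).1
      (lTensor_exact R' (LinearMap.exact_subtype_mkQ _) (Submodule.mkQ_surjective _))
  have hinj : Function.Injective ((B.carrier v).subtype.baseChange R') := by
    have e : Module.Flat R (M.obj v ⧸ B.carrier v) := by
      have := hB v
      refine Module.Flat.of_linearEquiv (M := ((⊤ : SubRep M).subquot B).obj v)
        (Submodule.Quotient.equiv _ _ Submodule.topEquiv ?_).symm
      ext z
      constructor
      · rintro ⟨z, hz, rfl⟩; exact hz
      · intro hz; exact ⟨⟨z, trivial⟩, hz, rfl⟩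
    exact LinearMap.lTensor_injective_of_exact_of_flat (B.carrier v).mkQ
      (Submodule.mkQ_surjective _) (B.carrier v).subtype (Submodule.subtype_injective _)
      (LinearMap.exact_subtype_mkQ _) R'
  rw [hex]
  ext u
  rw [LinearMap.mem_ker, toSubquotBaseChange, LinearMap.comp_apply, Submodule.mkQ_apply,
    Submodule.Quotient.mk_eq_zero]
  change _ ↔ (B.carrier v).subtype.baseChange R' u ∈ (A.baseChange R').carrier v
  have hcomp : (B.carrier v).subtype ∘ₗ ((A.carrier v).submoduleOf (B.carrier v)).subtype =
      (A.carrier v).subtype ∘ₗ (Submodule.submoduleOfEquivOfLe (h v)).toLinearMap := rfl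
  have hcomp' := congrArg (LinearMap.baseChange R') hcomp
  rw [LinearMap.baseChange_comp, LinearMap.baseChange_comp] at hcomp'
  rw [← range_subtype_baseChange]
  constructor
  · rintro ⟨z, rfl⟩
    exact ⟨_, (LinearMap.congr_fun hcomp' z).symm⟩
  · rintro ⟨z, hz⟩
    obtain ⟨z, rfl⟩ := LinearMap.lTensor_surjective R'
      (Submodule.submoduleOfEquivOfLe (h v)).surjective z
    exact ⟨z, hinj ((LinearMap.congr_fun hcomp' z).trans hz)⟩

/-- Base change commutes with the formation of `B / A` when `M / B` is flat. -/
noncomputable def subquotBaseChange (h : A ≤ B)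
    (hB : ∀ v, Module.Flat R (((⊤ : SubRep M).subquot B).obj v)) (v : Q.V) :
    ((B.subquot A).baseChange R').obj v ≃ₗ[R']
      ((B.baseChange R').subquot (A.baseChange R')).obj v :=
  equivOfKerEq (((A.carrier v).submoduleOf (B.carrier v)).mkQ.baseChange R')
    (toSubquotBaseChange R' A B v)
    (LinearMap.lTensor_surjective R' (Submodule.mkQ_surjective _))
    (toSubquotBaseChange_surjective R' v) (ker_toSubquotBaseChange R' h hB v)

theorem subquotBaseChange_mkQ (h : A ≤ B)
    (hB : ∀ v, Module.Flat R (((⊤ : SubRep M).subquot B).obj v)) (v : Q.V)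
    (u : R' ⊗[R] B.carrier v) : subquotBaseChange R' h hB v
      (((A.carrier v).submoduleOf (B.carrier v)).mkQ.baseChange R' u) =
        toSubquotBaseChange R' A B v u :=
  equivOfKerEq_apply _ _ _ u

theorem toSubquotBaseChange_comm (e : Q.E) (u : R' ⊗[R] B.carrier (Q.src e)) :
    toSubquotBaseChange R' A B _ (((M.map e).restrict (B.stable e)).baseChange R' u) =
      ((B.baseChange R').subquot (A.baseChange R')).map e (toSubquotBaseChange R' A B _ u) := by
  induction u with
  | zero => simp only [map_zero]
  | add a b ha hb => simp only [map_add, ha, hb]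
  | tmul r b => rfl

theorem subquotBaseChange_comm (h : A ≤ B)
    (hB : ∀ v, Module.Flat R (((⊤ : SubRep M).subquot B).obj v)) (e : Q.E)
    (z : ((B.subquot A).baseChange R').obj (Q.src e)) :
    subquotBaseChange R' h hB _ (((B.subquot A).baseChange R').map e z) =
      ((B.baseChange R').subquot (A.baseChange R')).map e (subquotBaseChange R' h hB _ z) := by
  obtain ⟨u, rfl⟩ : ∃ u, ((A.carrier (Q.src e)).submoduleOf
      (B.carrier (Q.src e))).mkQ.baseChange R' u = z :=
    LinearMap.lTensor_surjective R' (Submodule.mkQ_surjective _) z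
  have h₁ : ((B.subquot A).baseChange R').map e (((A.carrier (Q.src e)).submoduleOf
      (B.carrier (Q.src e))).mkQ.baseChange R' u) = ((A.carrier (Q.tgt e)).submoduleOf
      (B.carrier (Q.tgt e))).mkQ.baseChange R' (((M.map e).restrict (B.stable e)).baseChange R' u) :=
    baseChange_comm R' (a := ((A.carrier (Q.src e)).submoduleOf (B.carrier (Q.src e))).mkQ)
      (b := ((A.carrier (Q.tgt e)).submoduleOf (B.carrier (Q.tgt e))).mkQ)
      (c := (M.map e).restrict (B.stable e)) (d := (B.subquot A).map e) (fun _ => rfl) u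
  rw [h₁, subquotBaseChange_mkQ, subquotBaseChange_mkQ, toSubquotBaseChange_comm]

variable (A B)

theorem baseChange_bot : (⊥ : SubRep M).baseChange R' = ⊥ :=
  SubRep.ext (funext fun _ => Submodule.baseChange_bot _)

theorem baseChange_top : (⊤ : SubRep M).baseChange R' = ⊤ :=
  SubRep.ext (funext fun _ => Submodule.baseChange_top _)

theorem baseChange_sup : (A ⊔ B).baseChange R' = A.baseChange R' ⊔ B.baseChange R' := by
  refine le_antisymm (fun v => ?_) (sup_le (Flagged.baseChange_mono R' le_sup_left)
    (Flagged.baseChange_mono R' le_sup_right))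
  change ((A ⊔ B).carrier v).baseChange R' ≤ _
  rw [Submodule.baseChange_eq_span]
  refine Submodule.span_le.2 ?_
  rintro _ ⟨m, hm, rfl⟩
  obtain ⟨a, ha, b, hb, rfl⟩ := Submodule.mem_sup.1 hm
  rw [map_add]
  exact add_mem (Submodule.mem_sup_left (Submodule.tmul_mem_baseChange_of_mem 1 ha))
    (Submodule.mem_sup_right (Submodule.tmul_mem_baseChange_of_mem 1 hb))

end SubRep

theorem Heart.HasClass.subquot_baseChange {F : QRep H.shape R} {A B : SubRep F} (h : A ≤ B)
    (hB : ∀ v, Module.Flat R (((⊤ : SubRep F).subquot B).obj v)) {c : ℤ × ℤ}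
    (hc : H.HasClass (B.subquot A) c) :
    H.HasClass ((B.baseChange R').subquot (A.baseChange R')) c :=
  (hc.baseChange R').of_equiv (SubRep.subquotBaseChange R' h hB)
    (SubRep.subquotBaseChange_comm R' h hB)

end BaseChange

end SteinbergStack

namespace SteinbergStack

/-! ## Vanishing of families with vanishing fibres -/

section LocalVanishing

variable {R : Type*} [CommRing R]

/-- Nakayama. The field `K` may be any extension of the residue field, since such an extension
reflects vanishing. -/
theorem subsingleton_of_tensor [IsLocalRing R] (K : Type*) [Field K] [Algebra R K]
    [IsLocalHom (algebraMap R K)] (N : Type*) [AddCommGroup N] [Module R N]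
    [Module.Finite R N] (h : Subsingleton (K ⊗[R] N)) : Subsingleton N := by
  let : Algebra (IsLocalRing.ResidueField R) K :=
    (IsLocalRing.ResidueField.lift (algebraMap R K)).toAlgebra
  have : IsScalarTower R (IsLocalRing.ResidueField R) K := IsScalarTower.of_algebraMap_eq' rfl
  have h' : Subsingleton (K ⊗[IsLocalRing.ResidueField R] (IsLocalRing.ResidueField R ⊗[R] N)) :=
    (AlgebraTensorModule.cancelBaseChange R (IsLocalRing.ResidueField R) K K N).subsingleton
  have h'' : Subsingleton (IsLocalRing.ResidueField R ⊗[R] N) :=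
    Module.FaithfullyFlat.lTensor_reflects_triviality (IsLocalRing.ResidueField R) K _
  exact IsLocalRing.subsingleton_tensorProduct.1 h''

variable {M N : Type*} [AddCommGroup M] [Module R M] [AddCommGroup N] [Module R N]

theorem map_aeval_of_comm {x : Module.End R M} {t : Module.End R N} {r : M →ₗ[R] N}
    (h : ∀ m, r (x m) = t (r m)) (p : R[X]) (m : M) : r (aeval x p m) = aeval t p (r m) := by
  induction p using Polynomial.induction_on' with
  | add p q hp hq => simp only [map_add, LinearMap.add_apply, hp, hq]
  | monomial n c =>
    simp only [aeval_monomial, Module.algebraMap_end_eq_smul_id, Module.End.mul_apply,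
      LinearMap.smul_apply, LinearMap.id_apply, map_smul, map_pow_of_comm h]

theorem aeval_reflect {A : Type*} [Ring A] [Algebra R A] {t t' : A} (h : t * t' = 1) {D : ℕ}
    {p : R[X]} (hp : p.natDegree ≤ D) : aeval t (reflect D p) = t ^ D * aeval t' p := by
  refine Polynomial.induction_with_natDegree_le
    (fun p => aeval t (reflect D p) = t ^ D * aeval t' p) D ?_ ?_ ?_ p hp
  · simp
  · intro n r _ hn
    rw [reflect_C_mul_X_pow, revAt_le hn]
    simp only [map_mul, aeval_C, map_pow, aeval_X]
    rw [← mul_assoc, ← Algebra.commutes, mul_assoc, ← Nat.sub_add_cancel hn,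
      Nat.add_sub_cancel, pow_add, mul_assoc, pow_mul_pow_eq_one n h, mul_one]
  · intro f g _ _ hf hg
    rw [reflect_add, map_add, map_add, mul_add, hf, hg]

theorem subsingleton_of_tensor_of_X_smul [IsLocalRing R] (K : Type*) [Field K] [Algebra R K]
    [IsLocalHom (algebraMap R K)] {P E : Type*} [AddCommGroup P] [Module R P] [Module R[X] P]
    [IsScalarTower R R[X] P] [AddCommGroup E] [Module R E] [Module R[X] E]
    [IsScalarTower R R[X] E] (hP : Module.Finite R[X] P) (h : Subsingleton (K ⊗[R] P))
    (π : P →ₗ[R[X]] E) (hπ : Function.Surjective π) (hX : ∀ e : E, (X : R[X]) • e = 0) :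
    Subsingleton E := by
  have hE : Module.Finite R E :=
    finite_of_monic_smul (Module.Finite.of_surjective π hπ) monic_X hX
  have hK : Subsingleton (K ⊗[R] E) :=
    (LinearMap.lTensor_surjective K (g := π.restrictScalars R) hπ).subsingleton
  exact subsingleton_of_tensor K E hK

/-- If the fibre at `X = 0` vanishes then some polynomial with constant term `1` kills. -/
theorem exists_smul_eq_zero_of_tensor [IsLocalRing R] (K : Type*) [Field K] [Algebra R K]
    [IsLocalHom (algebraMap R K)] {P : Type*} [AddCommGroup P] [Module R P] [Module R[X] P]
    [IsScalarTower R R[X] P] (hP : Module.Finite R[X] P) (h : Subsingleton (K ⊗[R] P)) :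
    ∃ q : R[X], q.coeff 0 = 1 ∧ ∀ m : P, q • m = 0 := by
  have hE : Subsingleton (P ⧸ ((Ideal.span {X} : Ideal R[X]) • ⊤ : Submodule R[X] P)) := by
    refine subsingleton_of_tensor_of_X_smul K hP h (Submodule.mkQ _)
      (Submodule.mkQ_surjective _) fun e => ?_
    obtain ⟨e, rfl⟩ := Submodule.mkQ_surjective _ e
    rw [← map_smul]
    exact (Submodule.Quotient.mk_eq_zero _).2
      (Submodule.smul_mem_smul (Ideal.mem_span_singleton_self X) trivial)
  rw [Submodule.Quotient.subsingleton_iff] at hE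
  obtain ⟨q, hq, hq'⟩ := Submodule.exists_sub_one_mem_and_smul_eq_zero_of_fg_of_le_smul
    (Ideal.span {X} : Ideal R[X]) (⊤ : Submodule R[X] P) hP.fg_top hE.ge
  refine ⟨q, ?_, fun m => hq' m trivial⟩
  rw [Ideal.mem_span_singleton, X_dvd_iff, coeff_sub, coeff_one_zero, sub_eq_zero] at hq
  exact hq

theorem exists_aeval_eq_zero [IsLocalRing R] (K : Type*) [Field K] [Algebra R K]
    [IsLocalHom (algebraMap R K)] {y : Module.End R M} (hy : Module.Finite R[X] (Module.AEval' y))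
    (h : Subsingleton (K ⊗[R] M)) : ∃ q : R[X], q.coeff 0 = 1 ∧ aeval y q = 0 := by
  have h' : Subsingleton (K ⊗[R] Module.AEval' y) :=
    ((Module.AEval'.of y).lTensor K).symm.subsingleton
  obtain ⟨q, hq, hq'⟩ := exists_smul_eq_zero_of_tensor K hy h'
  exact ⟨q, hq, LinearMap.ext fun m => hq' (Module.AEval'.of y m)⟩

variable {M₀ M₁ : Type*} [AddCommGroup M₀] [Module R M₀] [AddCommGroup M₁]
  [Module R M₁] {x : Module.End R M₀} {y : Module.End R M₁}
  {t t' : Module.End R N} {r₀ : M₀ →ₗ[R] N} {r₁ : M₁ →ₗ[R] N}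

/-- As `p` kills the localization, `p • m` is killed by a power of `X` for each `m`; finite
generation makes the exponent uniform. -/
theorem IsChart.exists_pow_mul_aeval_eq_zero (h : IsChart x t r₀)
    (hx : Module.Finite R[X] (Module.AEval' x)) {p : R[X]} (hp : aeval t p = 0) :
    ∃ k : ℕ, ∀ m : Module.AEval' x, (X ^ k * p) • m = 0 := by
  obtain ⟨S, hS⟩ := hx.fg_top
  have : ∀ m, ∃ k, (x ^ k) (aeval x p m) = 0 := fun m => h.ker _ (by
    rw [map_aeval_of_comm h.comm, hp, LinearMap.zero_apply])
  choose k hk using this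
  refine ⟨S.sup fun s => k ((Module.AEval'.of x).symm s), fun m => ?_⟩
  have hm : m ∈ Submodule.span R[X] (S : Set (Module.AEval' x)) := hS ▸ trivial
  induction hm using Submodule.span_induction with
  | zero => rw [smul_zero]
  | add a b _ _ ha hb => rw [smul_add, ha, hb, add_zero]
  | smul a b _ hb => rw [smul_comm, hb, smul_zero]
  | mem s hs =>
    obtain ⟨j, hj⟩ := Nat.exists_eq_add_of_le' (Finset.le_sup
      (f := fun s => k ((Module.AEval'.of x).symm s)) hs)
    rw [hj, pow_add, mul_assoc, mul_smul]
    suffices (X ^ k ((Module.AEval'.of x).symm s) * p) • s = 0 by rw [this, smul_zero]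
    rw [mul_smul]
    exact isTorsion_of_pow (hk ((Module.AEval'.of x).symm s))

/-- The support of a family with zero special fibre misses the special fibre, and properness of the
projective line makes it empty. Concretely, a polynomial `q` with constant term `1` kills the chart
of `y`. Over the overlap, the reversed polynomial in `t` vanishes; it is monic, so the chart of `x`
becomes finite over `R` and Nakayama applies to it. The overlap vanishes next, the chart of `y` is
then killed by a power of `y`, and Nakayama applies again. -/
theorem subsingleton_of_charts [IsLocalRing R] (K : Type*) [Field K] [Algebra R K]
    [IsLocalHom (algebraMap R K)] (h₀ : IsChart x t r₀) (h₁ : IsChart y t' r₁) (ht : t * t' = 1)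
    (ht' : t' * t = 1) (hx : Module.Finite R[X] (Module.AEval' x))
    (hy : Module.Finite R[X] (Module.AEval' y)) (k₀ : Subsingleton (K ⊗[R] M₀))
    (k₁ : Subsingleton (K ⊗[R] M₁)) : Subsingleton M₀ ∧ Subsingleton M₁ ∧ Subsingleton N := by
  obtain ⟨q, hq, hqy⟩ := exists_aeval_eq_zero K hy k₁
  have hqt' : aeval t' q = 0 := by
    refine LinearMap.ext fun z => ?_
    obtain ⟨n, m, hm⟩ := h₁.surj z
    have h : (t' ^ n) (aeval t' q z) = 0 := by
      have hc : t' ^ n * aeval t' q = aeval t' q * t' ^ n := by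
        have := congrArg (aeval t') (mul_comm (X ^ n) q)
        rwa [map_mul, map_mul, map_pow, aeval_X] at this
      rw [← Module.End.mul_apply, hc, Module.End.mul_apply, hm, ← map_aeval_of_comm h₁.comm, hqy,
        LinearMap.zero_apply, map_zero]
    rw [← inv_pow_apply ht n (aeval t' q z), h, map_zero, LinearMap.zero_apply]
  have hqt : aeval t q.reverse = 0 := by
    rw [reverse, aeval_reflect ht le_rfl, hqt', mul_zero]
  obtain ⟨k, hk⟩ := h₀.exists_pow_mul_aeval_eq_zero hx hqt
  -- Reversal turns the constant term `1` of `q` into the leading coefficient.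
  have hmonic : (X ^ k * q.reverse).Monic := by
    refine (monic_X_pow k).mul ?_
    rw [Monic, reverse_leadingCoeff, trailingCoeff,
      natTrailingDegree_eq_zero_of_constantCoeff_ne_zero, hq]
    rw [constantCoeff_apply, hq]
    exact one_ne_zero
  have f₀ : Module.Finite R M₀ :=
    (finite_of_monic_smul (M := Module.AEval' x) hx hmonic hk).equiv (Module.AEval'.of x).symm
  have s₀ : Subsingleton M₀ := subsingleton_of_tensor K M₀ k₀
  have s : Subsingleton N := by
    refine subsingleton_of_forall_eq 0 fun z => ?_
    obtain ⟨n, m, hm⟩ := h₀.surj z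
    rw [← inv_pow_apply ht' n z, hm, Subsingleton.elim m 0, map_zero, map_zero]
  obtain ⟨k', hk'⟩ := h₁.exists_pow_mul_aeval_eq_zero hy (p := 1) (Subsingleton.elim _ _)
  have f₁ : Module.Finite R M₁ :=
    (finite_of_monic_smul (M := Module.AEval' y) hy ((monic_X_pow k').mul monic_one) hk').equiv
      (Module.AEval'.of y).symm
  exact ⟨s₀, subsingleton_of_tensor K M₁ k₁, s⟩

end LocalVanishing

variable {R : Type u} [CommRing R] {H : Heart}

/-! ### Vanishing of quasi-coherent families of finite type at a point, near it, and everywhere. -/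

namespace Heart

/-- The underlying diagram is quasi-coherent. -/
def IsQC : (H : Heart) → {R : Type u} → [CommRing R] → QRep H.shape R → Prop
  | coh, _, _, M => P1.IsQuasicoherent M
  | rep _, _, _, _ => True

/-- Finite generation. -/
def IsFin : (H : Heart) → {R : Type u} → [CommRing R] → QRep H.shape R → Prop
  | coh, R, _, M => Module.Finite R[X] (Module.AEval' (P1.x M)) ∧
      Module.Finite R[X] (Module.AEval' (P1.y M))
  | rep _, R, _, M => ∀ v, Module.Finite R (M.obj v)

theorem IsFamily.isQC {M : QRep H.shape R} (h : H.IsFamily M) : H.IsQC M := by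
  cases H with
  | coh => exact h.1
  | rep n => trivial

theorem IsFamily.isFin {M : QRep H.shape R} (h : H.IsFamily M) : H.IsFin M := by
  cases H with
  | coh =>
    have h₀ := h.2.1
    have h₁ := h.2.2
    exact ⟨inferInstance, inferInstance⟩
  | rep n => exact fun v => have := h v; inferInstance

theorem IsQC.baseChange {M : QRep H.shape R} (h : H.IsQC M) (R' : Type u) [CommRing R']
    [Algebra R R'] : H.IsQC (M.baseChange R') := by
  cases H with
  | coh =>
    obtain ⟨hr, h₀, h₁⟩ := P1.isQuasicoherent_iff.1 h
    exact P1.isQuasicoherent_iff.2 ⟨Relations.baseChange (H := coh) hr R',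
      h₀.baseChange hr.isUnit_t R', h₁.baseChange hr.isUnit_tinv R'⟩
  | rep n => trivial

theorem IsFin.baseChange {M : QRep H.shape R} (h : H.IsFin M) (R' : Type u) [CommRing R']
    [Algebra R R'] : H.IsFin (M.baseChange R') := by
  cases H with
  | coh =>
    have h₀ := h.1
    have h₁ := h.2
    exact ⟨finite_aeval_baseChange R' (P1.x M), finite_aeval_baseChange R' (P1.y M)⟩
  | rep n =>
    intro v
    have := h v
    exact inferInstanceAs (Module.Finite R' (R' ⊗[R] M.obj v))

theorem subsingleton_of_fibre [IsLocalRing R] {M : QRep H.shape R} (h : H.IsQC M) (hf : H.IsFin M)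
    (K : Type u) [Field K] [Algebra R K] [IsLocalHom (algebraMap R K)]
    (hK : ∀ v, Subsingleton ((M.baseChange K).obj v)) (v : H.shape.V) :
    Subsingleton (M.obj v) := by
  cases H with
  | coh =>
    obtain ⟨hr, h₀, h₁⟩ := P1.isQuasicoherent_iff.1 h
    obtain ⟨s₀, s₁, s₂⟩ := subsingleton_of_charts K h₀ h₁ hr.t_tinv hr.tinv_t hf.1 hf.2
      (hK P1Vertex.zero) (hK P1Vertex.infty)
    cases v
    exacts [s₀, s₁, s₂]
  | rep n =>
    have := hf v
    exact subsingleton_of_tensor K (M.obj v) (hK v)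

/-- If every element of a family of finite type is killed by an element of the multiplicative set
`S`, a single element kills the whole family. -/
theorem exists_smul_eq_zero {M : QRep H.shape R} (h : H.IsQC M) (hf : H.IsFin M)
    (S : Submonoid R) (hS : ∀ v (m : M.obj v), ∃ s ∈ S, s • m = 0) :
    ∃ s ∈ S, ∀ v (m : M.obj v), s • m = 0 := by
  classical
  have key : ∀ {A N : Type u} [CommRing A] [Algebra R A] [AddCommGroup N] [Module R N]
      [Module A N] [IsScalarTower R A N], Module.Finite A N → (∀ m : N, ∃ s ∈ S, s • m = 0) →
      ∃ s ∈ S, ∀ m : N, s • m = 0 := by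
    intro A N _ _ _ _ _ _ hN hm
    choose s hs hs' using hm
    obtain ⟨T, hT⟩ := hN.fg_top
    refine ⟨∏ n ∈ T, s n, prod_mem fun n _ => hs n, fun m => ?_⟩
    have hm : m ∈ Submodule.span A (T : Set N) := hT ▸ trivial
    induction hm using Submodule.span_induction with
    | zero => rw [smul_zero]
    | add a b _ _ ha hb => rw [smul_add, ha, hb, add_zero]
    | smul a b _ hb => rw [smul_comm, hb, smul_zero]
    | mem n hn =>
      rw [← Finset.prod_erase_mul T s hn, mul_smul, hs', smul_zero]
  cases H with
  | coh =>
    obtain ⟨hr, h₀, h₁⟩ := P1.isQuasicoherent_iff.1 h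
    obtain ⟨s₀, hs₀, hs₀'⟩ := key (A := R[X]) (N := Module.AEval' (P1.x M)) hf.1 fun m =>
      hS P1Vertex.zero ((Module.AEval'.of (P1.x M)).symm m)
    obtain ⟨s₁, hs₁, hs₁'⟩ := key (A := R[X]) (N := Module.AEval' (P1.y M)) hf.2 fun m =>
      hS P1Vertex.infty ((Module.AEval'.of (P1.y M)).symm m)
    have a₀ : ∀ m : P1.M0 M, s₀ • m = 0 := fun m => hs₀' (Module.AEval'.of (P1.x M) m)
    have a₁ : ∀ m : P1.MInfty M, s₁ • m = 0 := fun m => hs₁' (Module.AEval'.of (P1.y M) m)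
    refine ⟨s₀ * s₁, mul_mem hs₀ hs₁, fun v m => ?_⟩
    match v, m with
    | .zero, m => rw [mul_comm, mul_smul]; exact (congrArg _ (a₀ m)).trans (smul_zero _)
    | .infty, m => rw [mul_smul]; exact (congrArg _ (a₁ m)).trans (smul_zero _)
    | .overlap, m =>
      obtain ⟨n, a, ha⟩ := h₀.surj m
      have : s₀ • m = 0 := by
        rw [← inv_pow_apply hr.tinv_t n m, ha, ← map_smul, ← map_smul, a₀, map_zero, map_zero]
      rw [mul_comm, mul_smul]
      exact (congrArg _ this).trans (smul_zero _)
  | rep n =>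
    have key' := fun v => key (A := R) (N := M.obj v) (hf v) (hS v)
    obtain ⟨s₁, hs₁, hs₁'⟩ := key' KroneckerVertex.one
    obtain ⟨s₂, hs₂, hs₂'⟩ := key' KroneckerVertex.two
    refine ⟨s₁ * s₂, mul_mem hs₁ hs₂, fun v m => ?_⟩
    match v, m with
    | .one, m => rw [mul_comm, mul_smul, hs₁', smul_zero]
    | .two, m => rw [mul_smul, hs₂', smul_zero]

/-- A family of finite type which vanishes at a point vanishes in a neighbourhood. -/
theorem exists_smul_eq_zero_of_fibre {M : QRep H.shape R} (h : H.IsQC M) (hf : H.IsFin M)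
    (K : Type u) [Field K] [Algebra R K] (hK : ∀ v, Subsingleton ((M.baseChange K).obj v)) :
    ∃ r : R, algebraMap R K r ≠ 0 ∧ ∀ v (m : M.obj v), r • m = 0 := by
  let p : Ideal R := RingHom.ker (algebraMap R K)
  have : p.IsPrime := RingHom.ker_isPrime _
  let R' := Localization.AtPrime p
  have hu : ∀ s : p.primeCompl, IsUnit (algebraMap R K s) := fun s => IsUnit.mk0 _ s.2
  let φ : R' →+* K := IsLocalization.lift hu
  let : Algebra R' K := φ.toAlgebra
  have : IsScalarTower R R' K := IsScalarTower.of_algebraMap_eq fun r =>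
    (IsLocalization.lift_eq hu r).symm
  have hloc : IsLocalHom (algebraMap R' K) := by
    constructor
    intro z hz
    obtain ⟨⟨a, s⟩, has⟩ := IsLocalization.surj p.primeCompl z
    have ha : algebraMap R K a ≠ 0 := by
      rw [IsScalarTower.algebraMap_apply R R' K, ← has, map_mul,
        ← IsScalarTower.algebraMap_apply R R' K]
      exact mul_ne_zero hz.ne_zero s.2
    have : IsUnit (algebraMap R R' a) := IsLocalization.map_units R' (⟨a, ha⟩ : p.primeCompl)
    rw [← has] at this
    exact isUnit_of_mul_isUnit_left this
  have hv : ∀ v, Subsingleton ((M.baseChange R').obj v) :=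
    subsingleton_of_fibre (h.baseChange R') (hf.baseChange R') K fun v => by
      have := hK v
      exact (AlgebraTensorModule.cancelBaseChange R R' K K (M.obj v)).subsingleton
  -- The family vanishes after localization at `p`, so each element is killed by something outside
  -- `p`, and by finiteness one such scalar serves for all.
  obtain ⟨s, hs, hs'⟩ := exists_smul_eq_zero h hf p.primeCompl fun v m => by
    have := hv v
    obtain ⟨c, hc⟩ := (IsLocalizedModule.eq_zero_iff p.primeCompl
      (TensorProduct.mk R R' (M.obj v) 1)).1 (Subsingleton.elim (TensorProduct.mk R R' _ 1 m) 0)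
    exact ⟨c, c.2, hc⟩
  exact ⟨s, hs, hs'⟩

/-- The open set where a family of finite type vanishes. -/
theorem exists_opens_vanishing {M : QRep H.shape R} (h : H.IsQC M) (hf : H.IsFin M) :
    ∃ V : TopologicalSpace.Opens (PrimeSpectrum R), ∀ (R' : Type u) [CommRing R'] [Algebra R R'],
      (∀ v, Subsingleton ((M.baseChange R').obj v)) ↔
        Set.range (PrimeSpectrum.comap (algebraMap R R')) ⊆ V := by
  -- The open set is the complement of the zero locus of the common annihilator.
  let J : Set R := {r | ∀ v (m : M.obj v), r • m = 0}
  refine ⟨⟨(PrimeSpectrum.zeroLocus J)ᶜ, (PrimeSpectrum.isClosed_zeroLocus J).isOpen_compl⟩,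
    fun R' _ _ => ⟨?_, ?_⟩⟩
  · rintro hR' _ ⟨q, rfl⟩ hq
    let K := q.asIdeal.ResidueField
    obtain ⟨r, hr, hr'⟩ := exists_smul_eq_zero_of_fibre h hf K fun v => by
      have := hR' v
      have h' : Subsingleton (K ⊗[R'] (R' ⊗[R] M.obj v)) := inferInstance
      exact (AlgebraTensorModule.cancelBaseChange R R' K K (M.obj v)).symm.subsingleton
    refine hr ?_
    rw [IsScalarTower.algebraMap_apply R R' K, Ideal.algebraMap_residueField_eq_zero]
    exact hq hr'
  · intro hV v
    -- If the annihilator were proper, it would lie in a maximal ideal of `R'`. The image of that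
    -- ideal in `Spec R` would be in the zero locus of `J`, since `J` annihilates after extension as
    -- well.
    have hann : Submodule.annihilator (⊤ : Submodule R' (R' ⊗[R] M.obj v)) = ⊤ := by
      by_contra hne
      obtain ⟨m, hm, hle⟩ := Ideal.exists_le_maximal _ hne
      have : m.IsPrime := hm.isPrime
      refine hV ⟨⟨m, this⟩, rfl⟩ fun r hr => ?_
      refine hle (Submodule.mem_annihilator.2 fun u _ => ?_)
      induction u with
      | zero => rw [smul_zero]
      | add a b ha hb => rw [smul_add, ha trivial, hb trivial, add_zero]
      | tmul a b => rw [algebraMap_smul, ← TensorProduct.tmul_smul, hr, TensorProduct.tmul_zero]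
    refine subsingleton_of_forall_eq 0 fun u => ?_
    have h1 : (1 : R') ∈ Submodule.annihilator (⊤ : Submodule R' (R' ⊗[R] M.obj v)) := by
      rw [hann]; trivial
    rw [← one_smul R' u]
    exact Submodule.mem_annihilator.1 h1 u trivial

/-- A family of finite type all of whose fibres vanish is zero. -/
theorem subsingleton_of_fibres {M : QRep H.shape R} (h : H.IsQC M) (hf : H.IsFin M)
    (hK : ∀ (K : Type u) [Field K] [Algebra R K], ∀ v, Subsingleton ((M.baseChange K).obj v))
    (v : H.shape.V) : Subsingleton (M.obj v) := by
  let J : Ideal R := Submodule.annihilator (⊤ : Submodule R (M.obj v))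
  have hJ : J = ⊤ := by
    by_contra hne
    obtain ⟨m, hm, hle⟩ := Ideal.exists_le_maximal _ hne
    have : m.IsPrime := hm.isPrime
    obtain ⟨r, hr, hr'⟩ := exists_smul_eq_zero_of_fibre h hf m.ResidueField (hK _)
    exact hr (Ideal.algebraMap_residueField_eq_zero.2
      (hle (Submodule.mem_annihilator.2 fun u _ => hr' v u)))
  refine subsingleton_of_forall_eq 0 fun u => ?_
  have h1 : (1 : R) ∈ J := by rw [hJ]; trivial
  rw [← one_smul R u]
  exact Submodule.mem_annihilator.1 h1 u trivial

/-- A flat family of class `0` is zero. -/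
theorem HasClass.subsingleton {M : QRep H.shape R} (h : H.HasClass M 0) (v : H.shape.V) :
    Subsingleton (M.obj v) :=
  subsingleton_of_fibres h.family.isQC h.family.isFin
    (fun K _ _ => subsingleton_of_cls_eq_zero (h.family.baseChange K) (h.fibre K)) v

end Heart

end SteinbergStack

namespace SteinbergStack

/-! ## Quasi-coherent subobjects -/

section Localizes

variable {R : Type*} [CommRing R] {M N : Type*} [AddCommGroup M] [Module R M] [AddCommGroup N]
  [Module R N] {x : Module.End R M} {t : Module.End R N} {r : M →ₗ[R] N}

/-- The submodule `B` of the localization is generated by `A`. -/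
def Localizes (t : Module.End R N) (r : M →ₗ[R] N) (A : Submodule R M) (B : Submodule R N) :
    Prop := ∀ z ∈ B, ∃ (n : ℕ), ∃ m ∈ A, (t ^ n) z = r m

theorem pow_mem_of_le_comap {x : Module.End R M} {A : Submodule R M} (h : A ≤ A.comap x) (n : ℕ)
    {m : M} (hm : m ∈ A) : (x ^ n) m ∈ A := by
  induction n with
  | zero => exact hm
  | succ n ih => rw [pow_succ', Module.End.mul_apply]; exact h ih

theorem Localizes.le {A : Submodule R M} (hA : A ≤ A.comap x) (hr : ∀ m, r (x m) = t (r m)) {z : N}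
    {n : ℕ} (h : ∃ m ∈ A, (t ^ n) z = r m) {n' : ℕ} (hn : n ≤ n') :
    ∃ m ∈ A, (t ^ n') z = r m := by
  obtain ⟨k, rfl⟩ := Nat.exists_eq_add_of_le' hn
  obtain ⟨m, hm, hmz⟩ := h
  exact ⟨(x ^ k) m, pow_mem_of_le_comap hA k hm, by
    rw [map_pow_of_comm hr, pow_add, Module.End.mul_apply, hmz]⟩

theorem localizes_bot : Localizes t r ⊥ ⊥ := by
  rintro z (rfl : z = 0)
  exact ⟨0, 0, zero_mem _, by rw [map_zero, map_zero]⟩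

theorem IsChart.localizes_top (h : IsChart x t r) : Localizes t r ⊤ ⊤ := fun z _ => by
  obtain ⟨n, m, hm⟩ := h.surj z
  exact ⟨n, m, trivial, hm⟩

theorem Localizes.sup {A A' : Submodule R M} {B B' : Submodule R N} (hr : ∀ m, r (x m) = t (r m))
    (hA : A ≤ A.comap x) (hA' : A' ≤ A'.comap x) (h : Localizes t r A B)
    (h' : Localizes t r A' B') : Localizes t r (A ⊔ A') (B ⊔ B') := by
  intro z hz
  obtain ⟨b, hb, b', hb', rfl⟩ := Submodule.mem_sup.1 hz
  obtain ⟨n, hn⟩ := h b hb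
  obtain ⟨n', hn'⟩ := h' b' hb'
  obtain ⟨m, hm, e⟩ := Localizes.le hA hr hn (le_max_left n n')
  obtain ⟨m', hm', e'⟩ := Localizes.le hA' hr hn' (le_max_right n n')
  exact ⟨max n n', m + m', Submodule.add_mem_sup hm hm', by rw [map_add, map_add, e, e']⟩

/-- The two numerators obtained from `A` and `A'` agree only in the localization; one more power of
`x` makes them equal. This is why the kernel condition of a chart is needed here but not for sums.
-/
theorem Localizes.inf {A A' : Submodule R M} {B B' : Submodule R N} (hc : IsChart x t r)
    (hA : A ≤ A.comap x) (hA' : A' ≤ A'.comap x) (h : Localizes t r A B)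
    (h' : Localizes t r A' B') : Localizes t r (A ⊓ A') (B ⊓ B') := by
  rintro z ⟨hz, hz'⟩
  obtain ⟨n, hn⟩ := h z hz
  obtain ⟨n', hn'⟩ := h' z hz'
  obtain ⟨m, hm, e⟩ := Localizes.le hA hc.comm hn (le_max_left n n')
  obtain ⟨m', hm', e'⟩ := Localizes.le hA' hc.comm hn' (le_max_right n n')
  obtain ⟨k, hk⟩ := hc.ker (m - m') (by rw [map_sub, ← e, ← e', sub_self])
  rw [map_sub, sub_eq_zero] at hk
  refine ⟨k + max n n', (x ^ k) m, ⟨pow_mem_of_le_comap hA k hm, ?_⟩, ?_⟩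
  · rw [hk]; exact pow_mem_of_le_comap hA' k hm'
  · rw [map_pow_of_comm hc.comm, pow_add, Module.End.mul_apply, e]

variable {M' N' M'' N'' : Type*} [AddCommGroup M'] [Module R M'] [AddCommGroup N']
  [Module R N'] [AddCommGroup M''] [Module R M''] [AddCommGroup N''] [Module R N'']
  {x' : Module.End R M'} {t' : Module.End R N'} {r' : M' →ₗ[R] N'}
  {x'' : Module.End R M''} {t'' : Module.End R N''} {r'' : M'' →ₗ[R] N''}

/-- Subquotients of charts. -/
theorem IsChart.of_subquotient (h : IsChart x t r) {ι : M' →ₗ[R] M} {κ : N' →ₗ[R] N}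
    {π : M' →ₗ[R] M''} {ρ : N' →ₗ[R] N''} (hιx : ∀ m, ι (x' m) = x (ι m))
    (hκr : ∀ m, κ (r' m) = r (ι m)) (hr' : ∀ m, r' (x' m) = t' (r' m))
    (hπx : ∀ m, π (x' m) = x'' (π m)) (hρt : ∀ z, ρ (t' z) = t'' (ρ z))
    (hρr : ∀ m, ρ (r' m) = r'' (π m)) (hι : Function.Injective ι)
    (hπ : Function.Surjective π) (hρ : Function.Surjective ρ) (hs : Localizes t' r' ⊤ ⊤)
    (hk : Localizes t' r' (LinearMap.ker π) (LinearMap.ker ρ)) : IsChart x'' t'' r'' where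
  comm m := by
    obtain ⟨m, rfl⟩ := hπ m
    rw [← hπx, ← hρr, hr', hρt, hρr]
  ker m hm := by
    obtain ⟨m, rfl⟩ := hπ m
    obtain ⟨n, a, ha, hn⟩ := hk (r' m) (LinearMap.mem_ker.2 (by rw [hρr, hm]))
    obtain ⟨k, hk⟩ := h.ker (ι ((x' ^ n) m - a)) (by
      rw [← hκr, map_sub, map_pow_of_comm hr', hn, sub_self, map_zero])
    rw [← map_pow_of_comm hιx, ← map_zero ι] at hk
    have hk := congrArg π (hι hk)
    rw [map_pow_of_comm hπx, map_sub, map_pow_of_comm hπx, LinearMap.mem_ker.1 ha, sub_zero,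
      map_zero] at hk
    exact ⟨k + n, by rw [pow_add, Module.End.mul_apply, hk]⟩
  surj z := by
    obtain ⟨z, rfl⟩ := hρ z
    obtain ⟨n, m, -, hm⟩ := hs z trivial
    exact ⟨n, π m, by rw [← map_pow_of_comm hρt, hm, hρr]⟩

/-- An extension of localizing submodules localizes. -/
theorem Localizes.of_quotient {A : Submodule R M} {A' : Submodule R N}
    {ι : M' →ₗ[R] M} {κ : N' →ₗ[R] N} {π : M' →ₗ[R] M''} {ρ : N' →ₗ[R] N''}
    (hr : ∀ m, r (x m) = t (r m)) (hιx : ∀ m, ι (x' m) = x (ι m)) (hκt : ∀ z, κ (t' z) = t (κ z))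
    (hκr : ∀ m, κ (r' m) = r (ι m)) (hρt : ∀ z, ρ (t' z) = t'' (ρ z))
    (hρr : ∀ m, ρ (r' m) = r'' (π m)) (hπ : Function.Surjective π) (h : IsChart x'' t'' r'')
    (hA : Localizes t r A A') (hAι : A ≤ LinearMap.range ι)
    (hAκ : (LinearMap.ker ρ).map κ ≤ A') :
    Localizes t r (LinearMap.range ι) (LinearMap.range κ) := by
  rintro _ ⟨z, rfl⟩
  obtain ⟨n, m, hm⟩ := h.surj (ρ z)
  obtain ⟨m, rfl⟩ := hπ m
  rw [← map_pow_of_comm hρt, ← hρr, ← sub_eq_zero, ← map_sub] at hm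
  obtain ⟨k, a, ha, hk⟩ := hA _ (hAκ ⟨_, hm, rfl⟩)
  obtain ⟨a, rfl⟩ := hAι ha
  rw [map_sub, map_sub, sub_eq_iff_eq_add, map_pow_of_comm hκt, ← Module.End.mul_apply,
    ← pow_add, hκr, ← map_pow_of_comm hr, ← map_add, ← map_pow_of_comm hιx, ← map_add] at hk
  exact ⟨k + n, _, ⟨_, rfl⟩, hk⟩

end Localizes

variable {R : Type u} [CommRing R] {H : Heart}

namespace Heart

/-- Quasi-coherent subobjects. -/
def Good : (H : Heart) → {R : Type u} → [CommRing R] → {F : QRep H.shape R} → SubRep F → Prop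
  | coh, _, _, F, A =>
      Localizes (P1.t F) (P1.res0 F) (A.carrier P1Vertex.zero) (A.carrier P1Vertex.overlap) ∧
      Localizes (P1.tinv F) (P1.resInfty F) (A.carrier P1Vertex.infty)
        (A.carrier P1Vertex.overlap)
  | rep _, _, _, _, _ => True

variable {F : QRep H.shape R}

theorem good_bot : H.Good (⊥ : SubRep F) := by
  cases H with
  | coh => exact ⟨localizes_bot, localizes_bot⟩
  | rep n => trivial

theorem good_top (hF : H.IsQC F) : H.Good (⊤ : SubRep F) := by
  cases H with
  | coh =>
    obtain ⟨-, h₀, h₁⟩ := P1.isQuasicoherent_iff.1 hF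
    exact ⟨h₀.localizes_top, h₁.localizes_top⟩
  | rep n => trivial

theorem Good.sup (hF : H.Relations F) {A B : SubRep F} (hA : H.Good A) (hB : H.Good B) :
    H.Good (A ⊔ B) := by
  cases H with
  | coh =>
    exact ⟨hA.1.sup hF.res0_x (A.stable P1Arrow.x) (B.stable P1Arrow.x) hB.1,
      hA.2.sup hF.resInfty_y (A.stable P1Arrow.y) (B.stable P1Arrow.y) hB.2⟩
  | rep n => trivial

theorem Good.inf (hF : H.IsQC F) {A B : SubRep F} (hA : H.Good A) (hB : H.Good B) :
    H.Good (A ⊓ B) := by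
  cases H with
  | coh =>
    obtain ⟨-, h₀, h₁⟩ := P1.isQuasicoherent_iff.1 hF
    exact ⟨hA.1.inf h₀ (A.stable P1Arrow.x) (B.stable P1Arrow.x) hB.1,
      hA.2.inf h₁ (A.stable P1Arrow.y) (B.stable P1Arrow.y) hB.2⟩
  | rep n => trivial

theorem localizes_restrict {M N : Type*} [AddCommGroup M] [Module R M] [AddCommGroup N]
    [Module R N] {t : Module.End R N} {r : M →ₗ[R] N} {A B : Submodule R M} {A' B' : Submodule R N}
    (hr : B ≤ B'.comap r) (ht : B' ≤ B'.comap t) (h : Localizes t r A A') (hA : A ≤ B) :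
    Localizes (t.restrict ht) (r.restrict hr) (A.submoduleOf B) (A'.submoduleOf B') := by
  rintro z hz
  obtain ⟨n, m, hm, e⟩ := h z hz
  refine ⟨n, ⟨m, hA hm⟩, hm, Subtype.ext ?_⟩
  exact (map_pow_of_comm (x := t.restrict ht) (t := t) (r := B'.subtype) (fun _ => rfl) n z).trans e

theorem Good.isQC_subquot (hF : H.IsQC F) {A B : SubRep F} (hA : H.Good A) (hB : H.Good B)
    (hAB : A ≤ B) : H.IsQC (B.subquot A) := by
  cases H with
  | coh =>
    obtain ⟨hr, h₀, h₁⟩ := P1.isQuasicoherent_iff.1 hF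
    have hr' := Relations.subquot (H := coh) hr B A
    refine P1.isQuasicoherent_iff.2 ⟨hr', ?_, ?_⟩
    · refine h₀.of_subquotient
        (x' := (F.map P1Arrow.x).restrict (B.stable P1Arrow.x))
        (t' := (F.map P1Arrow.t).restrict (B.stable P1Arrow.t))
        (r' := (F.map P1Arrow.res0).restrict (B.stable P1Arrow.res0))
        (ι := (B.carrier P1Vertex.zero).subtype)
        (κ := (B.carrier P1Vertex.overlap).subtype)
        (π := ((A.carrier P1Vertex.zero).submoduleOf (B.carrier P1Vertex.zero)).mkQ)
        (ρ := ((A.carrier P1Vertex.overlap).submoduleOf (B.carrier P1Vertex.overlap)).mkQ)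
        (fun _ => rfl) (fun _ => rfl) (fun m => Subtype.ext (hr.res0_x m)) (fun _ => rfl)
        (fun _ => rfl) (fun _ => rfl) (Submodule.subtype_injective _)
        (Submodule.mkQ_surjective _) (Submodule.mkQ_surjective _) ?_ ?_
      · have := localizes_restrict (B.stable P1Arrow.res0) (B.stable P1Arrow.t) hB.1 le_rfl
        rw [Submodule.submoduleOf_self, Submodule.submoduleOf_self] at this
        exact this
      · have := localizes_restrict (B.stable P1Arrow.res0) (B.stable P1Arrow.t) hA.1
          (hAB P1Vertex.zero)
        rw [Submodule.ker_mkQ, Submodule.ker_mkQ]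
        exact this
    · refine h₁.of_subquotient
        (x' := (F.map P1Arrow.y).restrict (B.stable P1Arrow.y))
        (t' := (F.map P1Arrow.tinv).restrict (B.stable P1Arrow.tinv))
        (r' := (F.map P1Arrow.resInfty).restrict (B.stable P1Arrow.resInfty))
        (ι := (B.carrier P1Vertex.infty).subtype)
        (κ := (B.carrier P1Vertex.overlap).subtype)
        (π := ((A.carrier P1Vertex.infty).submoduleOf (B.carrier P1Vertex.infty)).mkQ)
        (ρ := ((A.carrier P1Vertex.overlap).submoduleOf (B.carrier P1Vertex.overlap)).mkQ)
        (fun _ => rfl) (fun _ => rfl) (fun m => Subtype.ext (hr.resInfty_y m)) (fun _ => rfl)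
        (fun _ => rfl) (fun _ => rfl) (Submodule.subtype_injective _)
        (Submodule.mkQ_surjective _) (Submodule.mkQ_surjective _) ?_ ?_
      · have := localizes_restrict (B.stable P1Arrow.resInfty) (B.stable P1Arrow.tinv) hB.2 le_rfl
        rw [Submodule.submoduleOf_self, Submodule.submoduleOf_self] at this
        exact this
      · have := localizes_restrict (B.stable P1Arrow.resInfty) (B.stable P1Arrow.tinv) hA.2
          (hAB P1Vertex.infty)
        rw [Submodule.ker_mkQ, Submodule.ker_mkQ]
        exact this
  | rep n => trivial

/-- Allows climbing a chain: once the graded pieces are quasi-coherent, so are all members. -/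
theorem Good.of_subquot (hF : H.Relations F) {A B : SubRep F} (hA : H.Good A)
    (h : H.IsQC (B.subquot A)) (hAB : A ≤ B) : H.Good B := by
  cases H with
  | coh =>
    obtain ⟨-, h₀, h₁⟩ := P1.isQuasicoherent_iff.1 h
    constructor
    · have := Localizes.of_quotient (x := P1.x F) (t := P1.t F) (r := P1.res0 F)
        (x' := (F.map P1Arrow.x).restrict (B.stable P1Arrow.x))
        (t' := (F.map P1Arrow.t).restrict (B.stable P1Arrow.t))
        (r' := (F.map P1Arrow.res0).restrict (B.stable P1Arrow.res0))
        (ι := (B.carrier P1Vertex.zero).subtype)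
        (κ := (B.carrier P1Vertex.overlap).subtype)
        (π := ((A.carrier P1Vertex.zero).submoduleOf (B.carrier P1Vertex.zero)).mkQ)
        (ρ := ((A.carrier P1Vertex.overlap).submoduleOf (B.carrier P1Vertex.overlap)).mkQ)
        hF.res0_x (fun _ => rfl) (fun _ => rfl) (fun _ => rfl) (fun _ => rfl) (fun _ => rfl)
        (Submodule.mkQ_surjective _) h₀ hA.1
        (by rw [Submodule.range_subtype]; exact hAB P1Vertex.zero)
        (by rw [Submodule.ker_mkQ]; rintro _ ⟨z, hz, rfl⟩; exact hz)
      rwa [Submodule.range_subtype, Submodule.range_subtype] at this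
    · have := Localizes.of_quotient (x := P1.y F) (t := P1.tinv F) (r := P1.resInfty F)
        (x' := (F.map P1Arrow.y).restrict (B.stable P1Arrow.y))
        (t' := (F.map P1Arrow.tinv).restrict (B.stable P1Arrow.tinv))
        (r' := (F.map P1Arrow.resInfty).restrict (B.stable P1Arrow.resInfty))
        (ι := (B.carrier P1Vertex.infty).subtype)
        (κ := (B.carrier P1Vertex.overlap).subtype)
        (π := ((A.carrier P1Vertex.infty).submoduleOf (B.carrier P1Vertex.infty)).mkQ)
        (ρ := ((A.carrier P1Vertex.overlap).submoduleOf (B.carrier P1Vertex.overlap)).mkQ)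
        hF.resInfty_y (fun _ => rfl) (fun _ => rfl) (fun _ => rfl) (fun _ => rfl) (fun _ => rfl)
        (Submodule.mkQ_surjective _) h₁ hA.2
        (by rw [Submodule.range_subtype]; exact hAB P1Vertex.infty)
        (by rw [Submodule.ker_mkQ]; rintro _ ⟨z, hz, rfl⟩; exact hz)
      rwa [Submodule.range_subtype, Submodule.range_subtype] at this
  | rep n => trivial

/-! ## Finiteness of subquotients -/

theorem IsFin.of_surjective {A B : QRep H.shape R} (h : H.IsFin A)
    (g : ∀ v, A.obj v →ₗ[R] B.obj v) (hg : ∀ e x, g _ (A.map e x) = B.map e (g _ x))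
    (hs : ∀ v, Function.Surjective (g v)) : H.IsFin B := by
  cases H with
  | coh =>
    have h₀ := h.1
    have h₁ := h.2
    exact ⟨Module.Finite.of_surjective (M := Module.AEval' (P1.x A)) (P := Module.AEval' (P1.x B))
        (aevalMap (g P1Vertex.zero) (hg P1Arrow.x)) (hs P1Vertex.zero),
      Module.Finite.of_surjective (M := Module.AEval' (P1.y A)) (P := Module.AEval' (P1.y B))
        (aevalMap (g P1Vertex.infty) (hg P1Arrow.y)) (hs P1Vertex.infty)⟩
  | rep n =>
    intro v
    have := h v
    exact Module.Finite.of_surjective (g v) (hs v)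

/-- The kernel of a map from a finitely generated module onto a finitely presented one is finitely
generated, without noetherian assumptions. -/
theorem finite_of_exact {A M N P : Type*} [CommRing A] [AddCommGroup M]
    [Module A M] [AddCommGroup N] [Module A N] [AddCommGroup P] [Module A P] {f : M →ₗ[A] N}
    {g : N →ₗ[A] P} (hN : Module.Finite A N) (hP : Module.FinitePresentation A P)
    (hf : Function.Injective f) (hex : Function.Exact f g) (hg : Function.Surjective g) :
    Module.Finite A M := by
  have := Module.Finite.iff_fg.2 (Module.FinitePresentation.fg_ker g hg)
  exact Module.Finite.equiv ((LinearEquiv.ofInjective f hf).trans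
    (LinearEquiv.ofEq _ _ hex.linearMap_ker_eq.symm)).symm

theorem IsFin.of_shortExact {A B C : QRep H.shape R} (S : ShortExact A B C) (hB : H.IsFin B)
    (hC : H.IsFamily C) : H.IsFin A := by
  cases H with
  | coh =>
    exact ⟨finite_of_exact (M := Module.AEval' (P1.x A)) (N := Module.AEval' (P1.x B))
        (P := Module.AEval' (P1.x C)) hB.1 hC.2.1
        (aevalMap_injective (S.f_comm P1Arrow.x) (S.inj P1Vertex.zero))
        (aevalMap_exact (S.f_comm P1Arrow.x) (S.g_comm P1Arrow.x) (S.exact P1Vertex.zero))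
        (aevalMap_surjective (S.g_comm P1Arrow.x) (S.surj P1Vertex.zero)),
      finite_of_exact (M := Module.AEval' (P1.y A)) (N := Module.AEval' (P1.y B))
        (P := Module.AEval' (P1.y C)) hB.2 hC.2.2
        (aevalMap_injective (S.f_comm P1Arrow.y) (S.inj P1Vertex.infty))
        (aevalMap_exact (S.f_comm P1Arrow.y) (S.g_comm P1Arrow.y) (S.exact P1Vertex.infty))
        (aevalMap_surjective (S.g_comm P1Arrow.y) (S.surj P1Vertex.infty))⟩
  | rep n => exact fun v => finite_of_exact (hB v) (hC v) (S.inj v) (S.exact v) (S.surj v)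

/-! ### Over a field: quasi-coherent subobjects and their classes. -/

section Field

variable {K : Type u} [Field K]

theorem isFamily_of_isFin {M : QRep H.shape K} (h : H.IsQC M) (hf : H.IsFin M) :
    H.IsFamily M := by
  cases H with
  | coh =>
    have h₀ := hf.1
    have h₁ := hf.2
    exact ⟨h, Module.finitePresentation_of_finite _ _, Module.finitePresentation_of_finite _ _⟩
  | rep n =>
    intro v
    have := hf v
    exact Module.finitePresentation_of_finite _ _

theorem IsFin.of_injective {A B : QRep H.shape K} (h : H.IsFin B)
    (f : ∀ v, A.obj v →ₗ[K] B.obj v) (hf : ∀ e x, f _ (A.map e x) = B.map e (f _ x))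
    (hi : ∀ v, Function.Injective (f v)) : H.IsFin A := by
  cases H with
  | coh =>
    have h₀ := h.1
    have h₁ := h.2
    exact ⟨Module.Finite.of_injective (M := Module.AEval' (P1.x A)) (N := Module.AEval' (P1.x B))
        (aevalMap (f P1Vertex.zero) (hf P1Arrow.x)) (hi P1Vertex.zero),
      Module.Finite.of_injective (M := Module.AEval' (P1.y A)) (N := Module.AEval' (P1.y B))
        (aevalMap (f P1Vertex.infty) (hf P1Arrow.y)) (hi P1Vertex.infty)⟩
  | rep n =>
    intro v
    have := h v
    exact Module.Finite.of_injective (f v) (hi v)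

variable {F : QRep H.shape K}

theorem IsFamily.subquot (hF : H.IsFamily F) {A B : SubRep F} (hA : H.Good A) (hB : H.Good B)
    (hAB : A ≤ B) : H.IsFamily (B.subquot A) := by
  refine isFamily_of_isFin (hA.isQC_subquot hF.isQC hB hAB) ?_
  have h₁ : H.IsFin (B.subquot ⊥) := by
    refine hF.isFin.of_injective
      (fun v => Submodule.liftQ _ (Submodule.subtype _) fun _ hz => hz) ?_ ?_
    · intro e z
      obtain ⟨z, rfl⟩ := Submodule.mkQ_surjective _ z
      rfl
    · intro v
      rw [injective_iff_map_eq_zero]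
      intro z hz
      obtain ⟨z, rfl⟩ := Submodule.mkQ_surjective _ z
      exact (Submodule.Quotient.mk_eq_zero _).2 hz
  exact h₁.of_surjective _ (SubRep.subquotMap_comm le_rfl (inf_le_right.trans bot_le))
    (SubRep.subquotMap_surjective le_rfl (inf_le_right.trans bot_le) le_sup_left)

/-- The class of a subobject. -/
noncomputable def subCls (H : Heart) {F : QRep H.shape K} (A : SubRep F) : ℤ × ℤ :=
  H.cls (A.subquot ⊥)

theorem subCls_add (hF : H.IsFamily F) {A B : SubRep F} (hA : H.Good A) (hB : H.Good B)
    (hAB : A ≤ B) : H.subCls B = H.subCls A + H.cls (B.subquot A) :=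
  cls_add (SubRep.shortExactOfLE bot_le hAB) (hF.subquot good_bot hA bot_le)
    (hF.subquot good_bot hB bot_le) (hF.subquot hA hB hAB)

/-- Modularity is the second isomorphism theorem, monotonicity is positivity of classes, and
strictness holds because an object of class zero vanishes. -/
theorem isClassFunction (hF : H.IsFamily F) :
    IsClassFunction (H.Good (F := F)) H.pos H.subCls where
  zero_mem := zero_mem_pos H
  add_mem _ hx _ hy := add_mem_pos hx hy
  eq_zero _ := eq_zero_of_mem_pos_of_neg_mem
  good_inf _ _ hA hB := hA.inf hF.isQC hB
  good_sup _ _ hA hB := hA.sup hF.relations hB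
  map_bot := cls_of_subsingleton (SubRep.subsingleton_subquot_iff.2 le_rfl)
  mono A B hA hB hAB := by
    rw [subCls_add hF hA hB hAB, add_sub_cancel_left]
    exact cls_mem_pos (hF.subquot hA hB hAB)
  modular A B hA hB := by
    have hI := hA.inf hF.isQC hB
    have hS := hA.sup hF.relations hB
    have h₁ := subCls_add hF hI hA inf_le_left
    have h₂ := subCls_add hF hB hS le_sup_right
    have h₃ : H.cls (A.subquot (A ⊓ B)) = H.cls ((A ⊔ B).subquot B) :=
      cls_congr (hF.subquot hI hA inf_le_left)
        (SubRep.subquotEquiv le_sup_left (inf_le_right.trans inf_le_right) le_rfl le_rfl)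
        (SubRep.subquotEquiv_comm _ _ _ _)
    rw [h₁, h₂, h₃]
    abel
  eq_of_le A B hA hB hAB h := by
    refine le_antisymm hAB (SubRep.subsingleton_subquot_iff.1 ?_)
    refine subsingleton_of_cls_eq_zero (hF.subquot hA hB hAB) ?_
    rw [subCls_add hF hA hB hAB] at h
    exact left_eq_add.1 h

end Field

end Heart

end SteinbergStack

namespace SteinbergStack

/-! ## Chains with prescribed graded pieces -/

variable {R : Type u} [CommRing R] {H : Heart} {F : QRep H.shape R}

/-- A chain of subobjects with graded pieces of the classes listed in `β`. -/
structure IsChain (H : Heart) {F : QRep H.shape R} (β : List (ℤ × ℤ)) (h : ℕ →o SubRep F) :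
    Prop where
  zero : h 0 = ⊥
  last : h β.length = ⊤
  gr : ∀ q c, β[q]? = some c → H.HasClass ((h (q + 1)).subquot (h q)) c

theorem IsChain.eq_top {β : List (ℤ × ℤ)} {h : ℕ →o SubRep F} (hh : IsChain H β h) {q : ℕ}
    (hq : β.length ≤ q) : h q = ⊤ := top_le_iff.1 (hh.last.symm.le.trans (h.monotone hq))

/-- The number of entries in the first `i` blocks. -/
def blockOffset (B : List (List (ℤ × ℤ))) (i : ℕ) : ℕ := (B.take i).flatten.length

theorem blockOffset_zero (B : List (List (ℤ × ℤ))) : blockOffset B 0 = 0 := rfl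

theorem blockOffset_length (B : List (List (ℤ × ℤ))) :
    blockOffset B B.length = B.flatten.length := by
  rw [blockOffset, List.take_length]

theorem blockOffset_mono (B : List (List (ℤ × ℤ))) : Monotone (blockOffset B) := by
  refine monotone_nat_of_le_succ fun i => ?_
  rw [blockOffset, blockOffset, List.take_add_one, List.flatten_append, List.length_append]
  exact Nat.le_add_right _ _

theorem blockOffset_le (B : List (List (ℤ × ℤ))) (i : ℕ) :
    blockOffset B i ≤ B.flatten.length := by
  rcases le_total i B.length with h | h
  · exact (blockOffset_mono B h).trans (blockOffset_length B).le
  · rw [blockOffset, List.take_of_length_le h]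

/-- The entries of the split matrix. -/
def splitEntry (B : List (List (ℤ × ℤ))) : Matrix (Fin B.length) (Fin B.flatten.length) (ℤ × ℤ) :=
  fun i q =>
    if blockOffset B i ≤ q ∧ (q : ℕ) < blockOffset B (i + 1) then B.flatten.get q else 0

theorem splitEntry_apply (B : List (List (ℤ × ℤ))) (i : Fin B.length)
    (q : Fin B.flatten.length) : splitEntry B i q =
      if blockOffset B i ≤ q ∧ (q : ℕ) < blockOffset B (i + 1) then B.flatten.get q else 0 := rfl

theorem exists_block (B : List (List (ℤ × ℤ))) {q : ℕ} (hq : q < B.flatten.length) :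
    ∃ i : Fin B.length, blockOffset B i ≤ q ∧ q < blockOffset B (i + 1) := by
  have hex : ∃ i, q < blockOffset B i := ⟨B.length, by rwa [blockOffset_length]⟩
  classical
  have h₁ := Nat.find_spec hex
  have h₀ : Nat.find hex ≠ 0 := fun h => by
    rw [h, blockOffset_zero] at h₁
    exact Nat.not_lt_zero _ h₁
  obtain ⟨i, hi⟩ := Nat.exists_eq_succ_of_ne_zero h₀
  have h₂ : blockOffset B i ≤ q := not_lt.1 (Nat.find_min hex (by omega))
  rw [hi] at h₁
  refine ⟨⟨i, ?_⟩, h₂, h₁⟩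
  by_contra hlt
  have : blockOffset B i = B.flatten.length := by
    rw [blockOffset, List.take_of_length_le (not_lt.1 hlt)]
  omega

theorem sum_splitEntry_col (B : List (List (ℤ × ℤ))) (q : Fin B.flatten.length) :
    ∑ i, splitEntry B i q = B.flatten.get q := by
  obtain ⟨i, h₁, h₂⟩ := exists_block B q.2
  rw [Finset.sum_eq_single i]
  · rw [splitEntry_apply, if_pos ⟨h₁, h₂⟩]
  · intro i' _ hne
    rw [splitEntry_apply, if_neg]
    rintro ⟨h₃, h₄⟩
    refine hne (Fin.ext ?_)
    by_contra hne
    rcases Nat.lt_or_gt_of_ne hne with h | h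
    · exact absurd (blockOffset_mono B h) (by simp only [Nat.succ_eq_add_one]; omega)
    · exact absurd (blockOffset_mono B h) (by simp only [Nat.succ_eq_add_one]; omega)
  · exact fun h => absurd (Finset.mem_univ _) h

theorem sum_splitEntry_row (B : List (List (ℤ × ℤ))) (i : Fin B.length) :
    ∑ q, splitEntry B i q =
      ∑ q ∈ Finset.Ico (blockOffset B i) (blockOffset B (i + 1)), B.flatten.getD q 0 := by
  have h : ∀ q : Fin B.flatten.length, splitEntry B i q =
      (fun q : ℕ => if blockOffset B i ≤ q ∧ q < blockOffset B (i + 1) then B.flatten.getD q 0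
        else 0) q := fun q => by
    simp only [splitEntry_apply, List.getD_eq_getElem _ _ q.2, List.get_eq_getElem]
  rw [Finset.sum_congr rfl fun q _ => h q]
  refine (Fin.sum_univ_eq_sum_range (fun q : ℕ => if blockOffset B i ≤ q ∧
    q < blockOffset B (i + 1) then B.flatten.getD q 0 else 0) B.flatten.length).trans ?_
  rw [← Finset.sum_filter]
  refine Finset.sum_congr ?_ fun _ _ => rfl
  ext q
  simp only [Finset.mem_filter, Finset.mem_range, Finset.mem_Ico]
  have := blockOffset_le B (i + 1)
  omega

/-! ## Relative position of a chain and a coarsening -/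

theorem relPos_comm (f g : ℕ →o SubRep F) (i j : ℕ) : relPos f g i j = relPos g f j i := by
  rw [relPos, relPos, inf_comm (f (i + 1)) (g (j + 1)), inf_comm (f i), inf_comm (f (i + 1)),
    sup_comm]

theorem inCell_symm {s l : ℕ} {α : Fin s → ℤ × ℤ} {α' : Fin l → ℤ × ℤ}
    {w : Matrix (Fin s) (Fin l) (ℤ × ℤ)} {f g : ℕ →o SubRep F} (h : InCell H α α' w f g) :
    InCell H α' α w.transpose g f where
  left := h.right
  right := h.left
  position j i := by
    rw [relPos_comm]
    exact h.position i j

theorem inf_le_of_hasClass_zero {f g : ℕ →o SubRep F} {i j : ℕ} (h : H.HasClass (relPos f g i j) 0) :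
    f (i + 1) ⊓ g (j + 1) ≤ f i ⊓ g (j + 1) ⊔ f (i + 1) ⊓ g j :=
  SubRep.subsingleton_subquot_iff.1 h.subsingleton

/-- A vanishing relative position at `(i, q)` means that `f` has no jump at `i` inside the step `q`
of `g`. Outside the block `o i ≤ q < o (i + 1)` this holds everywhere. So `f i` adds nothing to `g`
beyond `o i`, and `g (o i)` adds nothing to `f` beyond `i`; descending from the tops of the two
chains gives the two inclusions. -/
theorem eq_of_relPos_le {f g : ℕ →o SubRep F} {o : ℕ → ℕ} (ho : Monotone o) {s N : ℕ}
    (hf0 : f 0 = ⊥) (hg0 : g 0 = ⊥) (hf : f s = ⊤) (hg : g N = ⊤)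
    (h : ∀ i < s, ∀ q < N, ¬ (o i ≤ q ∧ q < o (i + 1)) →
      f (i + 1) ⊓ g (q + 1) ≤ f i ⊓ g (q + 1) ⊔ f (i + 1) ⊓ g q) {i : ℕ} (hi : i ≤ s)
    (hoN : ∀ i, o i ≤ N) : f i = g (o i) := by
  refine le_antisymm ?_ ?_
  · have h₁ : ∀ i ≤ s, ∀ q, o i ≤ q → q < N → f i ⊓ g (q + 1) ≤ g q := by
      intro i
      induction i with
      | zero => intro _ q _ _; rw [hf0, bot_inf_eq]; exact bot_le
      | succ i ih =>
        intro hi q hq hqN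
        refine (h i (by omega) q hqN (by omega)).trans (sup_le ?_ inf_le_right)
        exact ih (by omega) q ((ho i.le_succ).trans hq) hqN
    have h₂ : ∀ d q, q + d = N → o i ≤ q → f i ≤ g q := by
      intro d
      induction d with
      | zero => intro q hq _; rw [show q = N from hq, hg]; exact le_top
      | succ d ih =>
        intro q hq hoq
        exact (le_inf le_rfl (ih (q + 1) (by omega) (by omega))).trans
          (h₁ i hi q hoq (by omega))
    exact h₂ (N - o i) (o i) (by have := hoN i; omega) le_rfl
  · have h₁ : ∀ i < s, ∀ q ≤ o i, f (i + 1) ⊓ g q ≤ f i := by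
      intro i hi q
      induction q with
      | zero => intro _; rw [hg0, inf_bot_eq]; exact bot_le
      | succ q ih =>
        intro hq
        have := hoN i
        exact (h i hi q (by omega) (by omega)).trans
          (sup_le inf_le_left (ih (by omega)))
    have h₂ : ∀ d i', i' + d = s → i ≤ i' → g (o i) ≤ f i' := by
      intro d
      induction d with
      | zero => intro i' hi' _; rw [show i' = s from hi', hf]; exact le_top
      | succ d ih =>
        intro i' hi' hii
        exact (le_inf (ih (i' + 1) (by omega) (by omega)) le_rfl).trans
          (h₁ i' (by omega) (o i) (ho hii))
    exact h₂ (s - i) i (by omega) le_rfl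

/-- Two flags are in relative position `m`, being of the types prescribed by `m`. -/
def Cell (H : Heart) {F : QRep H.shape R} (m : SizedMatrix) (f g : ℕ →o SubRep F) : Prop :=
  InCell H (fun i => ∑ j, m.mat i j) (fun j => ∑ i, m.mat i j) m.mat f g

/-- The zero entries of a split matrix force the coarse flag to consist of members of the fine one;
the remaining entries then repeat the graded pieces of the fine flag. -/
theorem cell_split_iff (hF : H.Relations F) (B : List (List (ℤ × ℤ))) {f g : ℕ →o SubRep F} :
    Cell H (splitMatrix B) f g ↔
      IsChain H B.flatten g ∧ ∀ i ≤ B.length, f i = g (blockOffset B i) := by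
  have hcell : Cell H (splitMatrix B) f g ↔ InCell H (fun i => ∑ q, splitEntry B i q)
    (fun q => ∑ i, splitEntry B i q) (splitEntry B) f g := Iff.rfl
  rw [hcell]
  constructor
  · intro h
    have hchain : IsChain H B.flatten g := by
      refine ⟨h.right.zero, h.right.last, fun q c hq => ?_⟩
      obtain ⟨hlt, rfl⟩ := List.getElem?_eq_some_iff.1 hq
      have := h.right.gr ⟨q, hlt⟩
      rwa [sum_splitEntry_col B ⟨q, hlt⟩] at this
    refine ⟨hchain, fun i hi => eq_of_relPos_le (blockOffset_mono B) h.left.zero h.right.zero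
      h.left.last h.right.last ?_ hi (blockOffset_le B)⟩
    intro i hi q hq hnot
    have := h.position ⟨i, hi⟩ ⟨q, hq⟩
    rw [splitEntry_apply B ⟨i, hi⟩ ⟨q, hq⟩, if_neg hnot] at this
    exact inf_le_of_hasClass_zero this
  · rintro ⟨hg, hfg⟩
    refine ⟨⟨?_, ?_, fun i => ?_⟩, ⟨hg.zero, hg.last, fun q => ?_⟩, fun i q => ?_⟩
    · rw [hfg 0 (Nat.zero_le _), blockOffset_zero, hg.zero]
    · exact (hfg B.length le_rfl).trans (by rw [blockOffset_length, hg.last])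
    · have hi : (i : ℕ) < B.length := i.2
      rw [sum_splitEntry_row B i, hfg i hi.le, hfg (i + 1) hi]
      refine Heart.HasClass.of_chain hF g _ (blockOffset_mono B (Nat.le_succ _)) fun q _ hq => ?_
      have hq : q < B.flatten.length := hq.trans_le (blockOffset_le B _)
      refine hg.gr q _ ?_
      rw [List.getD_eq_getElem _ _ hq, List.getElem?_eq_getElem hq]
    · rw [sum_splitEntry_col]
      exact hg.gr q _ (List.getElem?_eq_getElem q.2)
    · have hi : (i : ℕ) < B.length := i.2
      rw [splitEntry_apply B i q, relPos, hfg i hi.le, hfg (i + 1) hi]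
      split_ifs with h
      · have h₁ : g (blockOffset B (i + 1)) ⊓ g (q + 1) = g (q + 1) :=
          inf_eq_right.2 (g.monotone h.2)
        have h₂ : g (blockOffset B i) ⊓ g (q + 1) ⊔ g (blockOffset B (i + 1)) ⊓ g q = g q := by
          rw [inf_eq_right.2 (g.monotone h.2.le)]
          exact sup_eq_right.2 (inf_le_left.trans (g.monotone h.1))
        rw [h₁, h₂]
        exact hg.gr q _ (List.getElem?_eq_getElem q.2)
      · refine Heart.HasClass.of_subsingleton (SubRep.subsingleton_subquot_iff.2 ?_)
        rcases lt_or_ge (q : ℕ) (blockOffset B i) with hq | hq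
        · exact le_sup_of_le_left (le_inf (inf_le_right.trans (g.monotone hq)) inf_le_right)
        · exact le_sup_of_le_right (le_inf inf_le_left
            (inf_le_left.trans (g.monotone (not_lt.1 fun h' => h ⟨hq, h'⟩))))

theorem cell_merge_iff (hF : H.Relations F) (B : List (List (ℤ × ℤ))) {f g : ℕ →o SubRep F} :
    Cell H (mergeMatrix B) f g ↔
      IsChain H B.flatten f ∧ ∀ i ≤ B.length, g i = f (blockOffset B i) := by
  rw [← cell_split_iff hF]
  exact ⟨inCell_symm, inCell_symm⟩

/-! ## Offsets of the blocks -/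

/-- The increasing map which omits the value `p + 1`. -/
def skip (p q : ℕ) : ℕ := if q ≤ p then q else q + 1

theorem skip_mono (p : ℕ) : Monotone (skip p) := fun a b h => by
  unfold skip
  split_ifs <;> omega

theorem flatten_map_singleton {A : Type} (L : List A) : (L.map fun c => [c]).flatten = L := by
  induction L with
  | nil => rfl
  | cons a L ih => simp [ih]

theorem flatten_pairBlocks {A : Type} (p : ℕ) (L : List A) : (pairBlocks p L).flatten = L := by
  induction p generalizing L with
  | zero =>
    match L with
    | [] => rfl
    | [a] => rfl
    | a :: b :: L => simp [pairBlocks, flatten_map_singleton]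
  | succ p ih =>
    match L with
    | [] => rfl
    | a :: L => simp [pairBlocks, ih]

theorem length_pairBlocks {A : Type} {p : ℕ} {L : List A} (h : p + 1 < L.length) :
    (pairBlocks p L).length = L.length - 1 := by
  induction p generalizing L with
  | zero =>
    match L with
    | [] => simp at h
    | [a] => simp at h
    | a :: b :: L => simp [pairBlocks]
  | succ p ih =>
    match L with
    | [] => simp at h
    | a :: L =>
      simp only [List.length_cons] at h
      rw [pairBlocks, List.length_cons, ih (by omega), List.length_cons]
      omega

theorem blockOffset_pairBlocks {p : ℕ} {L : List (ℤ × ℤ)} (h : p + 1 < L.length) {i : ℕ}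
    (hi : i < L.length) : blockOffset (pairBlocks p L) i = skip p i := by
  induction p generalizing L i with
  | zero =>
    match L with
    | [] => simp at h
    | [a] => simp at h
    | a :: b :: L =>
      cases i with
      | zero => rfl
      | succ i =>
        simp only [List.length_cons] at hi
        simp only [blockOffset, pairBlocks, List.take_succ_cons, List.flatten_cons,
          List.length_append, ← List.map_take, flatten_map_singleton, List.length_take, skip,
          List.length_cons, List.length_nil]
        split_ifs <;> omega
  | succ p ih =>
    match L with
    | [] => simp at h
    | a :: L =>
      cases i with
      | zero => rfl
      | succ i =>
        simp only [List.length_cons] at h hi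
        have := ih (L := L) (i := i) (by omega) (by omega)
        rw [blockOffset] at this
        simp only [blockOffset, pairBlocks, List.take_succ_cons, List.flatten_cons,
          List.length_append, this, List.length_cons, List.length_nil, skip]
        split_ifs <;> omega

theorem blockOffset_map {ι : Type} (L : List ι) (b : ι → List (ℤ × ℤ)) {n : ℕ}
    (hb : ∀ i, (b i).length = n) {i : ℕ} (hi : i ≤ L.length) : blockOffset (L.map b) i = i * n := by
  rw [blockOffset, ← List.map_take, List.length_flatten, List.map_map,
    List.map_congr_left (f := List.length ∘ b) (g := fun _ => n) fun a _ => hb a, List.map_const', List.sum_replicate,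
    List.length_take, min_eq_left hi, smul_eq_mul]

/-! ## Sequences of cells -/

/-- Consecutive flags are in the relative positions listed in `ms`. -/
def Linked (H : Heart) {F : QRep H.shape R} (ms : List SizedMatrix) (φ : ℕ → ℕ →o SubRep F) : Prop :=
  ∀ k (hk : k < ms.length), Cell H ms[k] (φ k) (φ (k + 1))

theorem linked_nil (φ : ℕ → ℕ →o SubRep F) : Linked H [] φ := fun _ hk => absurd hk (by simp)

theorem linked_cons {m : SizedMatrix} {ms : List SizedMatrix} {φ : ℕ → ℕ →o SubRep F} :
    Linked H (m :: ms) φ ↔ Cell H m (φ 0) (φ 1) ∧ Linked H ms fun k => φ (k + 1) := by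
  constructor
  · intro h
    exact ⟨h 0 (by simp), fun k hk => h (k + 1) (by simpa using hk)⟩
  · rintro ⟨h₁, h₂⟩ (_ | k) hk
    · exact h₁
    · exact h₂ k (by simpa using hk)

theorem linked_append {ms : List SizedMatrix} {m : SizedMatrix} {φ : ℕ → ℕ →o SubRep F} :
    Linked H (ms ++ [m]) φ ↔
      Linked H ms φ ∧ Cell H m (φ ms.length) (φ (ms.length + 1)) := by
  induction ms generalizing φ with
  | nil => simp [linked_cons, linked_nil]
  | cons m' ms ih => rw [List.cons_append, linked_cons, linked_cons, ih, and_assoc]; rfl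

theorem length_crossings (word : List ℕ) (β : List (ℤ × ℤ)) :
    (crossings word β).length = 2 * word.length := by
  induction word generalizing β with
  | nil => rfl
  | cons p word ih => simp only [crossings, List.length_cons, ih]; omega

/-- The merge makes the middle flag the old chain with place `p + 1` omitted, and the split makes it
the new chain with the same place omitted. So a crossing says that two chains share all members but
one. -/
theorem linked_crossings_iff (hF : H.Relations F) {word : List ℕ} {β : List (ℤ × ℤ)}
    (hword : ∀ p ∈ word, p + 1 < β.length) {φ : ℕ → ℕ →o SubRep F} :
    IsChain H β (φ 0) ∧ Linked H (crossings word β) φ ↔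
      (∀ k ≤ word.length,
        IsChain H ((word.take k).foldl (fun L p => swapAt p L) β) (φ (2 * k))) ∧
      ∀ k (hk : k < word.length), ∀ q < β.length,
        φ (2 * k + 1) q = φ (2 * k) (skip word[k] q) ∧
        φ (2 * k + 1) q = φ (2 * (k + 1)) (skip word[k] q) := by
  induction word generalizing β φ with
  | nil =>
    constructor
    · rintro ⟨h, -⟩
      refine ⟨fun k hk => ?_, fun k hk => absurd hk (by simp)⟩
      rw [List.length_nil, Nat.le_zero] at hk
      subst hk
      exact h
    · exact fun h => ⟨h.1 0 le_rfl, linked_nil φ⟩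
  | cons p word ih =>
    have hp : p + 1 < β.length := hword p List.mem_cons_self
    have hlen : (swapAt p β).length = β.length := length_swapAt p β
    have hp' : p + 1 < (swapAt p β).length := by rwa [hlen]
    have ih' := ih (β := swapAt p β) (φ := fun k => φ (k + 2)) fun q hq => by
      rw [hlen]; exact hword q (List.mem_cons_of_mem _ hq)
    rw [crossings, linked_cons, linked_cons, cell_merge_iff hF, cell_split_iff hF,
      flatten_pairBlocks, flatten_pairBlocks, length_pairBlocks hp, length_pairBlocks hp']
    constructor
    · rintro ⟨h₀, ⟨-, h₁⟩, ⟨h₂, h₃⟩, h₄⟩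
      obtain ⟨h₅, h₆⟩ := ih'.1 ⟨h₂, h₄⟩
      refine ⟨?_, ?_⟩
      · rintro (_ | k) hk
        · exact h₀
        · exact h₅ k (by simpa using hk)
      · rintro (_ | k) hk q hq
        · refine ⟨?_, ?_⟩
          · have := h₁ q (by omega)
            rw [blockOffset_pairBlocks hp hq] at this
            exact this
          · have := h₃ q (by omega)
            rw [blockOffset_pairBlocks hp' (by omega)] at this
            exact this
        · exact h₆ k (by simpa using hk) q (by omega)
    · rintro ⟨h₁, h₂⟩
      obtain ⟨h₅, h₆⟩ := ih'.2 ⟨fun k hk => h₁ (k + 1) (by simpa using hk),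
        fun k hk q hq => h₂ (k + 1) (by simpa using hk) q (by omega)⟩
      have h₀ := h₁ 0 (Nat.zero_le _)
      have h := h₂ 0 (by simp)
      refine ⟨h₀, ⟨h₀, fun i hi => ?_⟩, ⟨h₅, fun i hi => ?_⟩, h₆⟩
      · rw [blockOffset_pairBlocks hp (by omega)]
        exact (h i (by omega)).1
      · rw [blockOffset_pairBlocks hp' (by omega)]
        exact (h i (by omega)).2

variable {s l : ℕ} {w : Matrix (Fin s) (Fin l) (ℤ × ℤ)} {word : List ℕ}

/-- Position `2 * k + 1` carries the full chain of stage `k`, position `2 * k + 2` the merged chain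
between stages `k` and `k + 1`. The two extreme positions carry the given flags. -/
theorem linked_matrixSeq_iff (hF : H.Relations F) (hword : IsReducedWord s l word)
    {φ : ℕ → ℕ →o SubRep F} :
    Linked H (matrixSeq w word) φ ↔
      (∀ k ≤ word.length,
        IsChain H ((stage s l word k).map fun a => w a.1 a.2) (φ (2 * k + 1))) ∧
      (∀ k (hk : k < word.length), ∀ q < s * l,
        φ (2 * k + 2) q = φ (2 * k + 1) (skip word[k] q) ∧
        φ (2 * k + 2) q = φ (2 * k + 3) (skip word[k] q)) ∧
      (∀ i ≤ s, φ 0 i = φ 1 (i * l)) ∧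
      ∀ j ≤ l, φ (2 * word.length + 2) j = φ (2 * word.length + 1) (j * s) := by
  have hrow : ((List.finRange s).map fun i => (List.finRange l).map fun j => w i j).flatten =
      (rowOrder s l).map fun a => w a.1 a.2 := by
    simp only [rowOrder, List.flatMap_def, List.map_flatten, List.map_map, Function.comp_def]
  have hcol : ((List.finRange l).map fun j => (List.finRange s).map fun i => w i j).flatten =
      (colOrder s l).map fun a => w a.1 a.2 := by
    simp only [colOrder, List.flatMap_def, List.map_flatten, List.map_map, Function.comp_def]
  have hfold : ∀ k, (word.take k).foldl (fun L p => swapAt p L)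
      ((rowOrder s l).map fun a => w a.1 a.2) = (stage s l word k).map fun a => w a.1 a.2 := by
    intro k
    rw [stage]
    generalize rowOrder s l = L
    induction word.take k generalizing L with
    | nil => rfl
    | cons p ps ih => rw [List.foldl_cons, ← map_swapAt, ih]; rfl
  have hlen : ((rowOrder s l).map fun a => w a.1 a.2).length = s * l := by
    rw [List.length_map, length_rowOrder]
  have hcr := linked_crossings_iff hF (word := word) (β := (rowOrder s l).map fun a => w a.1 a.2)
    (φ := fun k => φ (k + 1)) fun p hp => by rw [hlen]; exact hword.1.1 p hp
  rw [matrixSeq, linked_cons, linked_append, cell_split_iff hF, cell_merge_iff hF, hrow, hcol,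
    length_crossings, List.length_map, List.length_map, List.length_finRange, List.length_finRange]
  have hoff₁ : ∀ i ≤ s, blockOffset ((List.finRange s).map fun i =>
      (List.finRange l).map fun j => w i j) i = i * l := fun i hi =>
    blockOffset_map _ _ (fun _ => by simp) (by simpa using hi)
  have hoff₂ : ∀ j ≤ l, blockOffset ((List.finRange l).map fun j =>
      (List.finRange s).map fun i => w i j) j = j * s := fun i hi =>
    blockOffset_map _ _ (fun _ => by simp) (by simpa using hi)
  have hlast := hword.stage_length
  constructor
  · rintro ⟨⟨h₁, h₂⟩, h₃, h₄, h₅⟩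
    obtain ⟨h₆, h₇⟩ := hcr.1 ⟨h₁, h₃⟩
    refine ⟨fun k hk => ?_, fun k hk q hq => ?_, fun i hi => ?_, fun j hj => ?_⟩
    · rw [← hfold]; exact h₆ k hk
    · exact h₇ k hk q (by omega)
    · rw [h₂ i hi, hoff₁ i hi]
    · rw [h₅ j hj, hoff₂ j hj]
  · rintro ⟨h₁, h₂, h₃, h₄⟩
    obtain ⟨h₅, h₆⟩ := hcr.2 ⟨fun k hk => by rw [hfold]; exact h₁ k hk,
      fun k hk q hq => h₂ k hk q (by omega)⟩
    refine ⟨⟨h₅, fun i hi => ?_⟩, h₆, ?_, fun j hj => ?_⟩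
    · rw [hoff₁ i hi, h₃ i hi]
    · rw [← hlast]; exact h₁ _ le_rfl
    · rw [hoff₂ j hj]; exact h₄ j hj

end SteinbergStack

namespace SteinbergStack

/-! ## Partial sums over the orders of the entries -/

section Sums

variable {s l : ℕ} {u : Fin s × Fin l → ℤ × ℤ}

theorem headSum_eq_sum {L : List (Fin s × Fin l)} (hL : L.Perm (rowOrder s l)) {q : ℕ}
    {P : Fin s × Fin l → Prop} [DecidablePred P] (h : ∀ c, c ∈ L.take q ↔ P c) :
    headSum u L q = ∑ c, if P c then u c else 0 := by
  have hnd : (L.take q).Nodup := (hL.nodup_iff.2 rowOrder_nodup).sublist (List.take_sublist q L)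
  rw [headSum, ← List.sum_toFinset u hnd, ← Finset.sum_filter]
  refine Finset.sum_congr ?_ fun _ _ => rfl
  ext c
  simp [h]

theorem headSum_rowOrder (i : ℕ) :
    headSum u (rowOrder s l) (i * l) = ∑ c, if (c.1 : ℕ) < i then u c else 0 :=
  headSum_eq_sum (List.Perm.refl _) fun _ => mem_take_rowOrder

theorem headSum_colOrder (j : ℕ) :
    headSum u (colOrder s l) (j * s) = ∑ c, if (c.2 : ℕ) < j then u c else 0 :=
  headSum_eq_sum colOrder_perm fun _ => mem_take_colOrder

theorem headSum_hookOrder (i j : ℕ) :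
    headSum u (hookOrder s l i j)
      ((rowOrder s l).filter (fun c => decide ((c.1 : ℕ) < i ∨ (c.2 : ℕ) < j))).length =
      ∑ c, if (c.1 : ℕ) < i ∨ (c.2 : ℕ) < j then u c else 0 :=
  headSum_eq_sum (hookOrder_perm i j) fun c => by
    rw [hookOrder, List.take_left]
    simp [mem_rowOrder]

theorem sum_row_sub (i : Fin s) : (∑ c, if (c.1 : ℕ) < i + 1 then u c else 0) -
    (∑ c, if (c.1 : ℕ) < i then u c else 0) = ∑ j, u (i, j) := by
  rw [← Finset.sum_sub_distrib, Fintype.sum_prod_type, Finset.sum_eq_single i]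
  · simp
  · intro i' _ hne
    refine Finset.sum_eq_zero fun j _ => ?_
    have : (i' : ℕ) ≠ i := fun h => hne (Fin.ext h)
    by_cases h : (i' : ℕ) < i
    · simp [h, h.trans (Nat.lt_succ_self _)]
    · have : ¬ (i' : ℕ) < i + 1 := by omega
      simp [h, this]
  · simp

theorem sum_col_sub (j : Fin l) : (∑ c : Fin s × Fin l, if (c.2 : ℕ) < j + 1 then u c else 0) -
    (∑ c : Fin s × Fin l, if (c.2 : ℕ) < j then u c else 0) = ∑ i, u (i, j) := by
  rw [← Finset.sum_sub_distrib, Fintype.sum_prod_type_right, Finset.sum_eq_single j]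
  · simp
  · intro j' _ hne
    refine Finset.sum_eq_zero fun i _ => ?_
    have : (j' : ℕ) ≠ j := fun h => hne (Fin.ext h)
    by_cases h : (j' : ℕ) < j
    · simp [h, h.trans (Nat.lt_succ_self _)]
    · have : ¬ (j' : ℕ) < j + 1 := by omega
      simp [h, this]
  · simp

theorem sum_or (i j : ℕ) : (∑ c : Fin s × Fin l, if (c.1 : ℕ) < i ∨ (c.2 : ℕ) < j then u c else 0) +
    (∑ c : Fin s × Fin l, if (c.2 : ℕ) < j then if (c.1 : ℕ) < i then u c else 0 else 0) =
    (∑ c : Fin s × Fin l, if (c.1 : ℕ) < i then u c else 0) +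
      ∑ c : Fin s × Fin l, if (c.2 : ℕ) < j then u c else 0 := by
  rw [← Finset.sum_add_distrib, ← Finset.sum_add_distrib]
  refine Finset.sum_congr rfl fun c _ => ?_
  by_cases h₁ : (c.1 : ℕ) < i <;> by_cases h₂ : (c.2 : ℕ) < j <;> simp [h₁, h₂]

theorem cornerSum_eq (w : Matrix (Fin s) (Fin l) (ℤ × ℤ)) (i : Fin s) (j : Fin l) :
    cornerSum w i j = ∑ c : Fin s × Fin l, if (c.2 : ℕ) < j + 1 then
      if (c.1 : ℕ) < i + 1 then w c.1 c.2 else 0 else 0 := by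
  have hle {n : ℕ} (p q : Fin n) : p ∈ Finset.Iic q ↔ (p : ℕ) < q + 1 := by
    rw [Finset.mem_Iic, Fin.le_def, Nat.lt_succ_iff]
  rw [cornerSum, Fintype.sum_prod_type, ← Finset.sum_filter_add_sum_filter_not Finset.univ
    (fun i' : Fin s => (i' : ℕ) < i + 1) (fun i' => ∑ j', _)]
  rw [Finset.sum_eq_zero (s := Finset.univ.filter fun i' : Fin s => ¬ (i' : ℕ) < i + 1), add_zero]
  · refine Finset.sum_congr (Finset.ext fun i' => by rw [hle, Finset.mem_filter]; simp)
      fun i' hi' => ?_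
    rw [Finset.mem_filter] at hi'
    simp only [hi'.2, if_true]
    rw [← Finset.sum_filter]
    exact Finset.sum_congr (Finset.ext fun j' => by rw [hle, Finset.mem_filter]; simp)
      fun _ _ => rfl
  · intro i' hi'
    simp [(Finset.mem_filter.1 hi').2]

end Sums

/-! ## Chains attached to a list of entries -/

variable {R : Type u} [CommRing R] {H : Heart} {F : QRep H.shape R}

section Chain

variable {ι : Type} {u : ι → ℤ × ℤ} {L : List ι} {h : ℕ →o SubRep F}

theorem IsChain.gr_map (hh : IsChain H (L.map u) h) {q : ℕ} {a : ι} (ha : L[q]? = some a) :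
    H.HasClass ((h (q + 1)).subquot (h q)) (u a) :=
  hh.gr q _ (by rw [List.getElem?_map, ha]; rfl)

theorem isChain_map (h0 : h 0 = ⊥) (hlast : h L.length = ⊤)
    (hgr : ∀ q a, L[q]? = some a → H.HasClass ((h (q + 1)).subquot (h q)) (u a)) :
    IsChain H (L.map u) h where
  zero := h0
  last := by rw [List.length_map, hlast]
  gr q c hc := by
    rw [List.getElem?_map, Option.map_eq_some_iff] at hc
    obtain ⟨a, ha, rfl⟩ := hc
    exact hgr q a ha

theorem IsChain.hasClass_subquot (hF : H.Relations F) (hh : IsChain H (L.map u) h) {m n : ℕ}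
    (hmn : m ≤ n) (hn : n ≤ L.length) :
    H.HasClass ((h n).subquot (h m)) (headSum u L n - headSum u L m) := by
  induction n, hmn using Nat.le_induction with
  | base => rw [sub_self]; exact Heart.HasClass.subquot_self _
  | succ n hmn ih =>
    have ha := List.getElem?_eq_getElem (l := L) (i := n) (by omega)
    rw [headSum_succ ha, add_sub_right_comm]
    exact Heart.HasClass.subquot_add hF (h.monotone hmn) (h.monotone n.le_succ) (ih (by omega))
      (hh.gr_map ha)

theorem IsChain.hasClass_bot (hF : H.Relations F) (hh : IsChain H (L.map u) h) {n : ℕ}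
    (hn : n ≤ L.length) : H.HasClass ((h n).subquot ⊥) (headSum u L n) := by
  have := hh.hasClass_subquot hF n.zero_le hn
  rwa [hh.zero, headSum, headSum, List.take_zero, List.map_nil, List.sum_nil, sub_zero] at this

/-- The quotient by a member is an iterated extension of flat graded pieces. This is the hypothesis
under which subquotients commute with base change. -/
theorem IsChain.flat_top (hF : H.Relations F) (hh : IsChain H (L.map u) h) (n : ℕ) (v : H.shape.V) :
    Module.Flat R (((⊤ : SubRep F).subquot (h n)).obj v) := by
  rcases le_total n L.length with hn | hn
  · have := (hh.hasClass_subquot hF hn le_rfl).flat v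
    have hlast := hh.last
    rw [List.length_map] at hlast
    rwa [hlast] at this
  · rw [hh.eq_top (by rwa [List.length_map])]
    exact (Heart.HasClass.subquot_self _).flat v

theorem IsChain.good (hF : H.IsQC F) (hF' : H.Relations F) (hh : IsChain H (L.map u) h) (q : ℕ) :
    H.Good (h q) := by
  induction q with
  | zero => rw [hh.zero]; exact Heart.good_bot
  | succ q ih =>
    rcases Nat.lt_or_ge q L.length with hq | hq
    · exact ih.of_subquot hF' (hh.gr_map (List.getElem?_eq_getElem hq)).family.isQC
        (h.monotone q.le_succ)
    · rw [hh.eq_top (by rw [List.length_map]; omega)]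
      exact Heart.good_top hF

theorem IsChain.subCls_sub {K : Type u} [Field K] {F : QRep H.shape K} {h : ℕ →o SubRep F}
    (hF : H.IsFamily F) (hh : IsChain H (L.map u) h) {q : ℕ} {a : ι} (ha : L[q]? = some a) :
    H.subCls (h (q + 1)) - H.subCls (h q) = u a := by
  have hg := hh.good hF.isQC hF.relations
  rw [Heart.subCls_add hF (hg q) (hg (q + 1)) (h.monotone q.le_succ), add_sub_cancel_left]
  exact (hh.gr_map ha).cls_eq

/-- Pullback of a chain of subobjects. -/
def chainBaseChange (R' : Type u) [CommRing R'] [Algebra R R'] (h : ℕ →o SubRep F) :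
    ℕ →o SubRep (F.baseChange R') :=
  ⟨fun n => (h n).baseChange R', fun _ _ hmn => Flagged.baseChange_mono R' (h.monotone hmn)⟩

theorem IsChain.baseChange (hF : H.Relations F) (hh : IsChain H (L.map u) h) (R' : Type u)
    [CommRing R'] [Algebra R R'] : IsChain H (L.map u) (chainBaseChange R' h) where
  zero := (congrArg _ hh.zero).trans (SubRep.baseChange_bot R')
  last := (congrArg _ hh.last).trans (SubRep.baseChange_top R')
  gr q c hc := (hh.gr q c hc).subquot_baseChange R' (h.monotone q.le_succ) (hh.flat_top hF (q + 1))

end Chain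

/-! ## Paths of chains -/

variable {s l : ℕ}

/-- The chains between two flags which make up a point of the convolution stack. -/
structure IsPathOfType (H : Heart) {F : QRep H.shape R} (w : Fin s × Fin l → ℤ × ℤ) (word : List ℕ)
    (f g : ℕ →o SubRep F) (h : ℕ → ℕ →o SubRep F) : Prop where
  path : IsPath (s := s) (l := l) word f g h
  chain : ∀ k ≤ word.length, IsChain H ((stage s l word k).map w) (h k)

variable {w : Fin s × Fin l → ℤ × ℤ} {word : List ℕ} {f g : ℕ →o SubRep F}
  {h : ℕ → ℕ →o SubRep F}

/-- By the second isomorphism theorem the step which adds the intersection of `a` has as graded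
piece the relative position at `a`, the denominator being given by `cellInf_inf_cellFlag`. -/
theorem isChain_cellFlag {α : Fin s → ℤ × ℤ} {α' : Fin l → ℤ × ℤ}
    (hfg : InCell H α α' (fun i j => w (i, j)) f g) {L : List (Fin s × Fin l)}
    (hL : L.Perm (rowOrder s l)) (hadm : Admissible L) : IsChain H (L.map w) (cellFlag f g L) := by
  refine isChain_map cellFlag_zero ?_ fun q a ha => ?_
  · rw [hL.length_eq, length_rowOrder]
    exact cellFlag_eq_top hfg.left.zero hfg.right.zero hfg.left.last hfg.right.last hL
  · have h₁ : H.HasClass (relPos f g a.1 a.2) (w a) := hfg.position a.1 a.2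
    have h₂ := cellInf_inf_cellFlag hfg.left.zero hfg.right.zero hL hadm ha
    refine h₁.subquot_congr (A := cellInf f g a) ?_ ?_ ?_ ?_
    · rw [cellFlag_succ ha]; exact le_sup_right
    · rw [← h₂]; exact inf_le_right.trans inf_le_right
    · exact h₂.le
    · rw [cellFlag_succ ha, sup_comm]

theorem isPathOfType_cellFlag {α : Fin s → ℤ × ℤ} {α' : Fin l → ℤ × ℤ}
    (hfg : InCell H α α' (fun i j => w (i, j)) f g) (hw : IsReducedWord s l word) :
    IsPathOfType H w word f g fun k => cellFlag f g (stage s l word k) where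
  path := isPath_cellFlag hfg.left.zero hfg.right.zero hfg.left.last hfg.right.last hw
  chain k hk := isChain_cellFlag hfg (stage_perm word k) (hw.admissible_stage hk)

namespace IsPathOfType

variable {α : Fin s → ℤ × ℤ} {α' : Fin l → ℤ × ℤ}

theorem isFlag_left (hP : IsPathOfType H w word f g h) (hF : H.Relations F)
    (hα : ∀ i, ∑ j, w (i, j) = α i) : IsFlag H α f where
  zero := by rw [hP.path.left 0 (Nat.zero_le _), zero_mul, hP.path.zero 0 (Nat.zero_le _)]
  last := by rw [hP.path.left s le_rfl, hP.path.top 0 (Nat.zero_le _)]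
  gr i := by
    have hle : ((i : ℕ) + 1) * l ≤ s * l := Nat.mul_le_mul_right _ i.2
    have := (hP.chain 0 (Nat.zero_le _)).hasClass_subquot hF
      (Nat.mul_le_mul_right l (Nat.le_succ i)) (by rwa [length_stage])
    rw [stage_zero, headSum_rowOrder, headSum_rowOrder, sum_row_sub, hα] at this
    rwa [hP.path.left i i.2.le, hP.path.left (i + 1) i.2]

theorem isFlag_right (hP : IsPathOfType H w word f g h) (hF : H.Relations F)
    (hw : IsReducedWord s l word) (hα' : ∀ j, ∑ i, w (i, j) = α' j) : IsFlag H α' g where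
  zero := by rw [hP.path.right 0 (Nat.zero_le _), zero_mul, hP.path.zero _ le_rfl]
  last := by rw [hP.path.right l le_rfl, mul_comm, hP.path.top _ le_rfl]
  gr j := by
    have hle : ((j : ℕ) + 1) * s ≤ s * l := by
      rw [mul_comm s]; exact Nat.mul_le_mul_right _ j.2
    have := (hP.chain _ le_rfl).hasClass_subquot hF
      (Nat.mul_le_mul_right s (Nat.le_succ j)) (by rwa [length_stage])
    rw [hw.stage_length, headSum_colOrder, headSum_colOrder, sum_col_sub, hα'] at this
    rwa [hP.path.right j j.2.le, hP.path.right (j + 1) j.2]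

/-- Transversal paths connect flags in relative position `w`. -/
theorem inCell (hP : IsPathOfType H w word f g h) (hF : H.Relations F)
    (hw : IsReducedWord s l word) (hα : ∀ i, ∑ j, w (i, j) = α i)
    (hα' : ∀ j, ∑ i, w (i, j) = α' j) (hT : IsTransversal word h) :
    InCell H α α' (fun i j => w (i, j)) f g where
  left := hP.isFlag_left hF hα
  right := hP.isFlag_right hF hw hα'
  position i j := by
    have ha : (stage s l word 0)[rowKey (i, j)]? = some (i, j) := getElem?_rowOrder.2 rfl
    have h₀ := Nat.zero_le word.length
    have h₁ := hP.path.succ_eq_sup hT hw h₀ ha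
    have h₂ := hP.path.cellInf_inf_eq hT hw h₀ ha
    refine ((hP.chain 0 h₀).gr_map ha).subquot_congr' (A := cellInf f g (i, j)) ?_ ?_ ?_ ?_
    · rw [h₁]; exact le_sup_right
    · refine inf_le_right.trans ?_
      change f i ⊓ g (j + 1) ⊔ f (i + 1) ⊓ g j ≤ _
      exact h₂.symm.le.trans inf_le_right
    · exact h₂.le
    · rw [h₁, sup_comm]

theorem good_left (hP : IsPathOfType H w word f g h) (hF : H.IsQC F) (hF' : H.Relations F) (i : ℕ) :
    H.Good (f i) := by
  rcases le_total i s with hi | hi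
  · rw [hP.path.left i hi]
    exact (hP.chain 0 (Nat.zero_le _)).good hF hF' _
  -- Flags are indexed by all natural numbers, and past their last index they stay at the whole
  -- object.
  · have : f s = ⊤ := by rw [hP.path.left s le_rfl, hP.path.top 0 (Nat.zero_le _)]
    rw [top_le_iff.1 (this.symm.le.trans (f.monotone hi))]
    exact Heart.good_top hF

theorem good_right (hP : IsPathOfType H w word f g h) (hF : H.IsQC F) (hF' : H.Relations F)
    (j : ℕ) : H.Good (g j) := by
  rcases le_total j l with hj | hj
  · rw [hP.path.right j hj]
    exact (hP.chain _ le_rfl).good hF hF' _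
  · have : g l = ⊤ := by rw [hP.path.right l le_rfl, mul_comm, hP.path.top _ le_rfl]
    rw [top_le_iff.1 (this.symm.le.trans (g.monotone hj))]
    exact Heart.good_top hF

theorem baseChange (hP : IsPathOfType H w word f g h) (hF : H.Relations F) (R' : Type u)
    [CommRing R'] [Algebra R R'] :
    IsPathOfType H w word (chainBaseChange R' f) (chainBaseChange R' g)
      fun k => chainBaseChange R' (h k) where
  path :=
    { zero := fun k hk =>
        (congrArg (SubRep.baseChange R') (hP.path.zero k hk)).trans (SubRep.baseChange_bot R')
      top := fun k hk =>
        (congrArg (SubRep.baseChange R') (hP.path.top k hk)).trans (SubRep.baseChange_top R')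
      left := fun i hi => congrArg (SubRep.baseChange R') (hP.path.left i hi)
      right := fun j hj => congrArg (SubRep.baseChange R') (hP.path.right j hj)
      step := fun k hk q hq => congrArg (SubRep.baseChange R') (hP.path.step k hk q hq) }
  chain k hk := (hP.chain k hk).baseChange hF R'

/-! ### Over a field -/

section Field

variable {K : Type u} [Field K] {F : QRep H.shape K} {f g : ℕ →o SubRep F}
  {h : ℕ → ℕ →o SubRep F}

theorem subCls_left (hP : IsPathOfType H w word f g h) (hF : H.IsFamily F) {i : ℕ} (hi : i ≤ s) :
    H.subCls (f i) = ∑ c, if (c.1 : ℕ) < i then w c else 0 := by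
  rw [← headSum_rowOrder, hP.path.left i hi]
  exact ((hP.chain 0 (Nat.zero_le _)).hasClass_bot hF.relations (by
    rw [length_stage]; exact Nat.mul_le_mul_right _ hi)).cls_eq

theorem subCls_right (hP : IsPathOfType H w word f g h) (hF : H.IsFamily F)
    (hw : IsReducedWord s l word) {j : ℕ} (hj : j ≤ l) :
    H.subCls (g j) = ∑ c : Fin s × Fin l, if (c.2 : ℕ) < j then w c else 0 := by
  rw [← headSum_colOrder, hP.path.right j hj, ← hw.stage_length]
  exact ((hP.chain _ le_rfl).hasClass_bot hF.relations (by
    rw [length_stage, mul_comm s]; exact Nat.mul_le_mul_right _ hj)).cls_eq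

theorem subCls_inf_sub_mem_pos (hP : IsPathOfType H w word f g h) (hF : H.IsFamily F)
    (hw : IsReducedWord s l word) (i : ℕ) {j : ℕ} (hj : j ≤ l) :
    H.subCls (f i ⊓ g j) - (∑ c : Fin s × Fin l, if (c.2 : ℕ) < j then
      if (c.1 : ℕ) < i then w c else 0 else 0) ∈ H.pos := by
  have hle : j * s ≤ s * l := by rw [mul_comm s]; exact Nat.mul_le_mul_right _ hj
  have := hP.path.defect_mem_pos hw (Heart.isClassFunction hF)
    (hP.good_left hF.isQC hF.relations) (w := w)
    (fun k hk => (hP.chain k hk).good hF.isQC hF.relations)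
    (fun k hk q a ha => (hP.chain k hk).subCls_sub hF ha) le_rfl i hle
  rwa [defect, hw.stage_length, headSum_colOrder, ← hP.path.right j hj] at this

/-- Inclusion–exclusion turns the classes of the sums into those of the intersections, so the final
defects vanish. The hypothesis is put on sums because these, unlike intersections, always commute
with base change. -/
theorem isTransversal_of_subCls_sup (hP : IsPathOfType H w word f g h) (hF : H.IsFamily F)
    (hw : IsReducedWord s l word)
    (hsup : ∀ i ≤ s, ∀ j ≤ l, H.subCls (f i ⊔ g j) =
      ∑ c : Fin s × Fin l, if (c.1 : ℕ) < i ∨ (c.2 : ℕ) < j then w c else 0) :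
    IsTransversal word h := by
  refine hP.path.isTransversal_of_defect hw (Heart.isClassFunction hF)
    (hP.good_left hF.isQC hF.relations) (w := w)
    (fun k hk => (hP.chain k hk).good hF.isQC hF.relations)
    (fun k hk q a ha => (hP.chain k hk).subCls_sub hF ha) fun i hi j hj => ?_
  rw [defect, headSum_colOrder, ← hP.path.right j hj, sub_eq_zero]
  have h₁ := (Heart.isClassFunction hF).modular (f i) (g j)
    (hP.good_left hF.isQC hF.relations i) (hP.good_right hF.isQC hF.relations j)
  rw [hsup i hi j hj, hP.subCls_left hF hi, hP.subCls_right hF hw hj, ← sum_or, add_comm] at h₁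
  exact add_left_cancel h₁

end Field

end IsPathOfType

end SteinbergStack

namespace SteinbergStack

/-! ## Transversality over a base -/

variable {R : Type u} [CommRing R] {H : Heart} {F : QRep H.shape R}

theorem SubRep.subsingleton_baseChange_subquot_iff (R' : Type u) [CommRing R'] [Algebra R R']
    {A B : SubRep F} (h : A ≤ B) (hB : ∀ v, Module.Flat R (((⊤ : SubRep F).subquot B).obj v)) :
    (∀ v, Subsingleton (((B.subquot A).baseChange R').obj v)) ↔
      B.baseChange R' ≤ A.baseChange R' := by
  rw [← SubRep.subsingleton_subquot_iff]
  exact forall_congr' fun v => (SubRep.subquotBaseChange R' h hB v).toEquiv.subsingleton_congr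

/-- The kernel of an epimorphism between objects of the same class vanishes. -/
theorem ShortExact.subsingleton_of_hasClass {A B C : QRep H.shape R} (S : ShortExact A B C)
    (hA : H.IsQC A) {c : ℤ × ℤ} (hB : H.HasClass B c) (hC : H.HasClass C c) (v : H.shape.V) :
    Subsingleton (A.obj v) := by
  have hf : H.IsFin A := Heart.IsFin.of_shortExact S hB.family.isFin hC.family
  refine Heart.subsingleton_of_fibres hA hf (fun K _ _ => ?_) v
  have hA' := Heart.isFamily_of_isFin (hA.baseChange K) (hf.baseChange K)
  refine Heart.subsingleton_of_cls_eq_zero hA' ?_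
  -- Flatness of the cokernel keeps the sequence exact on fibres, where additivity leaves class zero
  -- for the kernel.
  have := Heart.cls_add (S.baseChange hC.flat K) hA' (hB.family.baseChange K)
    (hC.family.baseChange K)
  rw [hB.fibre K, hC.fibre K] at this
  exact right_eq_add.1 this

variable {s l : ℕ} {w : Fin s × Fin l → ℤ × ℤ} {word : List ℕ} {f g : ℕ →o SubRep F}
  {h : ℕ → ℕ →o SubRep F}

/-- The obstruction to the transversality of neighbouring chains at the position `p`. -/
abbrev pathCoker (h : ℕ → ℕ →o SubRep F) (k p : ℕ) : QRep H.shape R :=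
  (h k (p + 2)).subquot (h k (p + 1) ⊔ h (k + 1) (p + 1))

namespace IsPathOfType

theorem sup_le (hP : IsPathOfType H w word f g h) {k : ℕ} (hk : k < word.length) :
    h k (word[k] + 1) ⊔ h (k + 1) (word[k] + 1) ≤ h k (word[k] + 2) := by
  refine _root_.sup_le ((h k).monotone (Nat.le_succ _)) ?_
  rw [← hP.path.step k hk (word[k] + 2) (by omega)]
  exact (h (k + 1)).monotone (Nat.le_succ _)

theorem isQC_pathCoker (hP : IsPathOfType H w word f g h) (hF : H.IsFamily F) {k : ℕ}
    (hk : k < word.length) : H.IsQC (pathCoker h k word[k]) :=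
  have h₁ := (hP.chain k hk.le).good hF.isQC hF.relations
  have h₂ := (hP.chain (k + 1) hk).good hF.isQC hF.relations
  ((h₁ _).sup hF.relations (h₂ _)).isQC_subquot hF.isQC (h₁ _) (hP.sup_le hk)

/-- The entry `b` labels the second step before the exchange and the first step after it, so these
two graded pieces have the same class. -/
theorem hasClass_exchange (hP : IsPathOfType H w word f g h) (hw : IsReducedWord s l word) {k : ℕ}
    (hk : k < word.length) :
    ∃ c, H.HasClass ((h k (word[k] + 2)).subquot (h k (word[k] + 1))) c ∧
      H.HasClass ((h (k + 1) (word[k] + 1)).subquot (h k word[k])) c := by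
  obtain ⟨L₁, a, b, L₂, h₁, h₂, h₃, -⟩ := hw.exists_exchange hk
  refine ⟨w b, (hP.chain k hk.le).gr_map ?_, ?_⟩
  · rw [h₁, List.getElem?_append_right (by omega), h₃, Nat.add_sub_cancel_left]
    rfl
  · rw [← hP.path.step k hk word[k] (by omega)]
    refine (hP.chain (k + 1) hk).gr_map ?_
    rw [h₂, List.getElem?_append_right (by omega), h₃, Nat.sub_self]
    rfl

theorem isFin_pathCoker (hP : IsPathOfType H w word f g h) (hw : IsReducedWord s l word) {k : ℕ}
    (hk : k < word.length) : H.IsFin (pathCoker h k word[k]) := by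
  obtain ⟨c, hc, -⟩ := hP.hasClass_exchange hw hk
  exact hc.family.isFin.of_surjective
    (SubRep.subquotMap le_rfl (inf_le_right.trans le_sup_left))
    (SubRep.subquotMap_comm _ _) (SubRep.subquotMap_surjective _ _ le_sup_left)

theorem subsingleton_pathCoker_iff (hP : IsPathOfType H w word f g h) (hF : H.Relations F)
    {k : ℕ} (hk : k < word.length) (R' : Type u) [CommRing R'] [Algebra R R'] :
    (∀ v, Subsingleton (((pathCoker h k word[k]).baseChange R').obj v)) ↔
      chainBaseChange R' (h k) (word[k] + 2) ≤
        chainBaseChange R' (h k) (word[k] + 1) ⊔ chainBaseChange R' (h (k + 1)) (word[k] + 1) := by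
  rw [SubRep.subsingleton_baseChange_subquot_iff R' (hP.sup_le hk)
    ((hP.chain k hk.le).flat_top hF _), SubRep.baseChange_sup]
  rfl

/-- Spanning makes the map `h (k + 1) (p + 1) / h k p → h k (p + 2) / h k (p + 1)` surjective.
Source and target are flat families of the same class, so its kernel, the obstruction to the
intersection condition, vanishes. -/
theorem isTransversal_of_le_sup (hP : IsPathOfType H w word f g h) (hF : H.IsFamily F)
    (hw : IsReducedWord s l word) (hs : ∀ k (hk : k < word.length),
      h k (word[k] + 2) ≤ h k (word[k] + 1) ⊔ h (k + 1) (word[k] + 1)) :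
    IsTransversal word h where
  le_sup := hs
  inf_le k hk := by
    obtain ⟨c, hc, hc'⟩ := hP.hasClass_exchange hw hk
    have hp : h k word[k] ≤ h (k + 1) (word[k] + 1) := by
      rw [← hP.path.step k hk word[k] (by omega)]
      exact (h (k + 1)).monotone (Nat.le_succ _)
    have hp' : h k word[k] ≤ h k (word[k] + 1) := (h k).monotone (Nat.le_succ _)
    have S : ShortExact ((h k (word[k] + 1) ⊓ h (k + 1) (word[k] + 1)).subquot (h k word[k]))
        ((h (k + 1) (word[k] + 1)).subquot (h k word[k]))
        ((h k (word[k] + 2)).subquot (h k (word[k] + 1))) :=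
      SubRep.shortExact inf_le_right inf_le_right (le_sup_right.trans (hP.sup_le hk))
        (inf_le_right.trans hp') inf_le_right inf_le_left (inf_comm _ _ |>.le.trans le_sup_left)
        ((hs k hk).trans (sup_comm _ _).le)
    have h₁ := (hP.chain k hk.le).good hF.isQC hF.relations
    have h₂ := (hP.chain (k + 1) hk).good hF.isQC hF.relations
    exact SubRep.subsingleton_subquot_iff.1 (S.subsingleton_of_hasClass
      ((h₁ _).isQC_subquot hF.isQC ((h₁ _).inf hF.isQC (h₂ _)) (le_inf hp' hp)) hc' hc)

/-- It suffices that the cokernels vanish on fibres, where the counting applies once the classes of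
the sums of the two flags are known. -/
theorem isTransversal (hP : IsPathOfType H w word f g h) (hF : H.IsFamily F)
    (hw : IsReducedWord s l word) {α : Fin s → ℤ × ℤ} {α' : Fin l → ℤ × ℤ}
    (hfg : InCell H α α' (fun i j => w (i, j)) f g) : IsTransversal word h := by
  refine hP.isTransversal_of_le_sup hF hw fun k hk => ?_
  refine SubRep.subsingleton_subquot_iff.1 (Heart.subsingleton_of_fibres (hP.isQC_pathCoker hF hk)
    (hP.isFin_pathCoker hw hk) fun K _ _ => ?_)
  rw [hP.subsingleton_pathCoker_iff hF.relations hk]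
  refine ((hP.baseChange hF.relations K).isTransversal_of_subCls_sup (hF.baseChange K) hw
    fun i hi j hj => ?_).le_sup k hk
  -- The hook order exhibits `f i ⊔ g j` as a member of a chain with flat graded pieces, so its
  -- class on every fibre is the expected sum.
  have hc := isChain_cellFlag hfg (hookOrder_perm i j) (admissible_hookOrder i j)
  have hle := List.length_filter_le (fun c => decide ((c.1 : ℕ) < i ∨ (c.2 : ℕ) < j)) (rowOrder s l)
  rw [← (hookOrder_perm i j).length_eq] at hle
  have h₁ := hc.hasClass_bot hF.relations hle
  have h₂ := hc.flat_top hF.relations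
    ((rowOrder s l).filter (fun c => decide ((c.1 : ℕ) < i ∨ (c.2 : ℕ) < j))).length
  rw [cellFlag_hookOrder hfg.left.zero hfg.right.zero hfg.left.last hfg.right.last hi hj] at h₁ h₂
  rw [headSum_hookOrder] at h₁
  have h₃ := (h₁.subquot_baseChange K bot_le h₂).cls_eq
  rw [SubRep.baseChange_bot, SubRep.baseChange_sup] at h₃
  exact h₃

end IsPathOfType

end SteinbergStack

namespace SteinbergStack

/-! ## The flags determined by a pair of flags -/

section CellFlags

variable {s l : ℕ} {𝓛 𝓛' : Type*} [Lattice 𝓛] [BoundedOrder 𝓛] [Lattice 𝓛'] [BoundedOrder 𝓛']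

/-- The flags in a transversal convolution of `f` and `g`. -/
def cellFlags (s l : ℕ) (word : List ℕ) (f g : ℕ →o 𝓛) (n : ℕ) : ℕ →o 𝓛 :=
  if n = 0 then f else if n = 2 * word.length + 2 then g else
    if n % 2 = 1 then cellFlag f g (stage s l word (n / 2)) else
      -- For `n = 2 * k + 2` this is the chain of stage `k` with place `word[k] + 1` omitted; the
      -- default `0` is irrelevant for `k < word.length`.
      (cellFlag f g (stage s l word (n / 2 - 1))).comp ⟨skip (word.getD (n / 2 - 1) 0), skip_mono _⟩

variable {word : List ℕ} {f g : ℕ →o 𝓛}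

theorem cellFlags_zero : cellFlags s l word f g 0 = f := if_pos rfl

theorem cellFlags_last : cellFlags s l word f g (2 * word.length + 2) = g := by
  rw [cellFlags, if_neg (by omega), if_pos rfl]

theorem cellFlags_odd (k : ℕ) :
    cellFlags s l word f g (2 * k + 1) = cellFlag f g (stage s l word k) := by
  rw [cellFlags, if_neg (by omega), if_neg (by omega), if_pos (by omega),
    show (2 * k + 1) / 2 = k by omega]

theorem cellFlags_even {k : ℕ} (hk : k < word.length) (q : ℕ) :
    cellFlags s l word f g (2 * k + 2) q = cellFlag f g (stage s l word k) (skip word[k] q) := by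
  rw [cellFlags, if_neg (by omega), if_neg (by omega), if_neg (by omega)]
  change cellFlag f g (stage s l word ((2 * k + 2) / 2 - 1))
    (skip (word.getD ((2 * k + 2) / 2 - 1) 0) q) = _
  rw [show (2 * k + 2) / 2 - 1 = k by omega, List.getD_eq_getElem _ _ hk]

variable {f' g' : ℕ →o 𝓛'} (Φ : BoundedLatticeHom 𝓛 𝓛')

theorem map_cellFlag (hf : ∀ i, Φ (f i) = f' i) (hg : ∀ j, Φ (g j) = g' j)
    (L : List (Fin s × Fin l)) (q : ℕ) : Φ (cellFlag f g L q) = cellFlag f' g' L q := by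
  rw [cellFlag_apply, cellFlag_apply, map_finset_sup]
  refine Finset.sup_congr rfl fun c _ => ?_
  rw [Function.comp_apply, cellInf, cellInf, map_inf, hf, hg]

theorem map_cellFlags (hf : ∀ i, Φ (f i) = f' i) (hg : ∀ j, Φ (g j) = g' j) (n q : ℕ) :
    Φ (cellFlags s l word f g n q) = cellFlags s l word f' g' n q := by
  unfold cellFlags
  split_ifs
  · exact hf q
  · exact hg q
  · exact map_cellFlag Φ hf hg _ q
  · exact map_cellFlag Φ hf hg _ _

end CellFlags

variable {R : Type u} [CommRing R] {H : Heart} {F : QRep H.shape R} {s l : ℕ}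
  {w : Matrix (Fin s) (Fin l) (ℤ × ℤ)} {word : List ℕ}

theorem isChain_stage_eq_top {w : Fin s × Fin l → ℤ × ℤ} {k : ℕ} {h : ℕ →o SubRep F}
    (hh : IsChain H ((stage s l word k).map w) h) {q : ℕ} (hq : s * l ≤ q) : h q = ⊤ :=
  hh.eq_top (by rwa [List.length_map, length_stage])

theorem Linked.isPathOfType (hF : H.Relations F) (hword : IsReducedWord s l word)
    {φ : ℕ → ℕ →o SubRep F} (hφ : Linked H (matrixSeq w word) φ) :
    IsPathOfType H (fun c : Fin s × Fin l => w c.1 c.2) word (φ 0) (φ (2 * word.length + 2))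
      fun k => φ (2 * k + 1) := by
  obtain ⟨h₁, h₂, h₃, h₄⟩ := (linked_matrixSeq_iff hF hword).1 hφ
  refine ⟨⟨fun k hk => (h₁ k hk).zero, fun k hk => isChain_stage_eq_top (h₁ k hk) le_rfl,
    h₃, h₄, fun k hk q hq => ?_⟩, h₁⟩
  change φ (2 * k + 3) q = φ (2 * k + 1) q
  have hp := hword.1.1 _ (List.getElem_mem hk)
  rcases Nat.lt_or_ge (s * l) q with hlt | hle
  · rw [isChain_stage_eq_top (h₁ k hk.le) hlt.le]
    exact isChain_stage_eq_top (h₁ (k + 1) hk) hlt.le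
  -- `skip` misses only `word[k] + 1`: a larger `q` is the image of `q - 1`, a smaller one the image
  -- of itself.
  rcases Nat.lt_or_ge word[k] q with hlt | hle'
  · have := h₂ k hk (q - 1) (by omega)
    have hs : skip word[k] (q - 1) = q := by rw [skip, if_neg (by omega)]; omega
    rw [hs] at this
    exact this.2.symm.trans this.1
  · have := h₂ k hk q (by omega)
    have hs : skip word[k] q = q := by rw [skip, if_pos hle']
    rw [hs] at this
    exact this.2.symm.trans this.1

/-- Each step of a transversal chain is forced by `IsPath.succ_eq_sup`, and the even flags are the
odd ones with a place omitted. -/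
theorem Linked.eq_cellFlags (hF : H.Relations F) (hword : IsReducedWord s l word)
    {φ : ℕ → ℕ →o SubRep F} (hφ : Linked H (matrixSeq w word) φ)
    (hT : IsTransversal word fun k => φ (2 * k + 1)) {n : ℕ} (hn : n ≤ 2 * word.length + 2) (q : ℕ) :
    φ n q = cellFlags s l word (φ 0) (φ (2 * word.length + 2)) n q := by
  have hP := hφ.isPathOfType hF hword
  obtain ⟨h₁, h₂, h₃, h₄⟩ := (linked_matrixSeq_iff hF hword).1 hφ
  have hodd : ∀ k ≤ word.length, ∀ q, φ (2 * k + 1) q =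
      cellFlag (φ 0) (φ (2 * word.length + 2)) (stage s l word k) q := by
    intro k hk q
    induction q with
    | zero => rw [cellFlag_zero, (h₁ k hk).zero]
    | succ q ih =>
      rcases Nat.lt_or_ge q (s * l) with hq | hq
      · have ha := List.getElem?_eq_getElem (l := stage s l word k) (i := q) (by rwa [length_stage])
        rw [cellFlag_succ ha, ← ih]
        exact hP.path.succ_eq_sup hT hword hk ha
      · rw [isChain_stage_eq_top (h₁ k hk) hq] at ih
        rw [isChain_stage_eq_top (h₁ k hk) (hq.trans q.le_succ)]
        exact (top_le_iff.1 (ih.le.trans ((cellFlag _ _ _).monotone q.le_succ))).symm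
  rcases Nat.eq_zero_or_pos n with rfl | hpos
  · rw [cellFlags_zero]
  rcases Nat.even_or_odd' n with ⟨k, rfl | rfl⟩
  · obtain ⟨k, rfl⟩ := Nat.exists_eq_succ_of_ne_zero (show k ≠ 0 by omega)
    rcases Nat.lt_or_ge k word.length with hk | hk
    · change φ (2 * k + 2) q = cellFlags s l word _ _ (2 * k + 2) q
      rw [cellFlags_even hk, ← hodd k hk.le]
      rcases Nat.lt_or_ge q (s * l) with hq | hq
      · exact (h₂ k hk q hq).1
      -- Equality is needed at all natural indices. The merged chain has one member fewer and is
      -- already `⊤` at `s * l - 1`, hence ever after.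
      · have hp := hword.1.1 _ (List.getElem_mem hk)
        have hs : skip word[k] (s * l - 1) = s * l := by rw [skip, if_neg (by omega)]; omega
        have hlast := (h₂ k hk (s * l - 1) (by omega)).1
        rw [hs, isChain_stage_eq_top (h₁ k hk.le) le_rfl] at hlast
        rw [isChain_stage_eq_top (h₁ k hk.le) (by rw [skip]; split_ifs <;> omega)]
        exact top_le_iff.1 (hlast.symm.le.trans ((φ (2 * k + 2)).monotone (by omega)))
    · obtain rfl : k = word.length := by omega
      change φ (2 * word.length + 2) q = cellFlags s l word _ _ (2 * word.length + 2) q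
      rw [cellFlags_last]
  · rw [cellFlags_odd, hodd k (by omega)]

theorem linked_cellFlags (hF : H.Relations F) (hword : IsReducedWord s l word)
    {α : Fin s → ℤ × ℤ} {α' : Fin l → ℤ × ℤ} {f g : ℕ →o SubRep F} (hfg : InCell H α α' w f g) :
    Linked H (matrixSeq w word) (cellFlags s l word f g) := by
  have hP := isPathOfType_cellFlag (w := fun c : Fin s × Fin l => w c.1 c.2) hfg hword
  refine (linked_matrixSeq_iff hF hword).2 ⟨fun k hk => ?_, fun k hk q hq => ⟨?_, ?_⟩,
    fun i hi => ?_, fun j hj => ?_⟩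
  · rw [cellFlags_odd]
    exact hP.chain k hk
  · rw [cellFlags_even hk, cellFlags_odd]
  · rw [cellFlags_even hk, show 2 * k + 3 = 2 * (k + 1) + 1 by ring, cellFlags_odd]
    exact (hP.path.step k hk _ (by rw [skip]; split_ifs <;> omega)).symm
  · rw [cellFlags_zero, show (1 : ℕ) = 2 * 0 + 1 by rfl, cellFlags_odd]
    exact hP.path.left i hi
  · rw [cellFlags_last, cellFlags_odd]
    exact hP.path.right j hj

theorem Linked.baseChange (hF : H.Relations F) (hword : IsReducedWord s l word)
    {φ : ℕ → ℕ →o SubRep F} (hφ : Linked H (matrixSeq w word) φ) (R' : Type u) [CommRing R']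
    [Algebra R R'] : Linked H (matrixSeq w word) fun n => chainBaseChange R' (φ n) := by
  obtain ⟨h₁, h₂, h₃, h₄⟩ := (linked_matrixSeq_iff hF hword).1 hφ
  exact (linked_matrixSeq_iff (hF.baseChange R') hword).2
    ⟨fun k hk => (h₁ k hk).baseChange hF R',
      fun k hk q hq => ⟨congrArg (SubRep.baseChange R') (h₂ k hk q hq).1,
        congrArg (SubRep.baseChange R') (h₂ k hk q hq).2⟩,
      fun i hi => congrArg (SubRep.baseChange R') (h₃ i hi),
      fun j hj => congrArg (SubRep.baseChange R') (h₄ j hj)⟩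

/-! ## The convolution stack -/

theorem length_matrixSeq (w : Matrix (Fin s) (Fin l) (ℤ × ℤ)) (word : List ℕ) :
    (matrixSeq w word).length = 2 * word.length + 2 := by
  rw [matrixSeq, List.length_cons, List.length_append, length_crossings]
  rfl

/-- The flags of an object, indexed by natural numbers. -/
def flagAt {Q : Shape} {t : ℕ} (X : Flagged Q R (Fin (t + 1))) (n : ℕ) : ℕ →o SubRep X.F :=
  X.flag (Fin.ofNat (t + 1) n)

theorem flagAt_val {Q : Shape} {t : ℕ} (X : Flagged Q R (Fin (t + 1))) (k : Fin (t + 1)) :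
    flagAt X k = X.flag k := by
  rw [flagAt]
  congr 1
  exact Fin.ext (Nat.mod_eq_of_lt k.2)

theorem flagAt_last {Q : Shape} {t : ℕ} (X : Flagged Q R (Fin (t + 1))) :
    flagAt X t = X.flag (Fin.last t) := flagAt_val X (Fin.last t)

variable {a : ℤ × ℤ}

theorem sStack_iff {X : Flagged H.shape R (Fin ((matrixSeq w word).length + 1))} :
    SStack H a w word R X ↔ H.HasClass X.F a ∧ Linked H (matrixSeq w word) (flagAt X) := by
  refine and_congr_right fun _ => ⟨fun h k hk => ?_, fun h k => ?_⟩
  · have := h ⟨k, hk⟩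
    rw [← flagAt_val X, ← flagAt_val X] at this
    exact this
  · have := h k k.2
    rw [← flagAt_val X, ← flagAt_val X]
    exact this

theorem SStack.baseChange (hword : IsReducedWord s l word)
    {X : Flagged H.shape R (Fin ((matrixSeq w word).length + 1))} (hX : SStack H a w word R X)
    (R' : Type u) [CommRing R'] [Algebra R R'] : SStack H a w word R' (X.baseChange R') := by
  rw [sStack_iff] at hX ⊢
  exact ⟨hX.1.baseChange R', hX.2.baseChange hX.1.family.relations hword R'⟩

theorem SStack.isPathOfType (hword : IsReducedWord s l word)
    {X : Flagged H.shape R (Fin ((matrixSeq w word).length + 1))} (hX : SStack H a w word R X) :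
    IsPathOfType H (fun c : Fin s × Fin l => w c.1 c.2) word (X.flag 0) (X.flag (Fin.last _))
      fun k => flagAt X (2 * k + 1) := by
  have := (sStack_iff.1 hX).2.isPathOfType hX.1.family.relations hword
  rwa [← length_matrixSeq w, flagAt_last] at this

/-- The crux: lying over the cell of `w` forces transversality by counting on fibres, and
transversality puts the end flags in relative position `w` by the lattice argument. -/
theorem uStack_iff {α : Fin s → ℤ × ℤ} {α' : Fin l → ℤ × ℤ} (hw : w ∈ W α α')
    (hword : IsReducedWord s l word) {X : Flagged H.shape R (Fin ((matrixSeq w word).length + 1))}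
    (hX : SStack H a w word R X) :
    UStack H a α α' w word R X ↔ IsTransversal word fun k => flagAt X (2 * k + 1) := by
  have hP := hX.isPathOfType hword
  constructor
  · intro h
    exact hP.isTransversal hX.1.family hword h.2.2
  · intro h
    exact ⟨hX, hX.1, hP.inCell hX.1.family.relations hword hw.1 hw.2 h⟩

end SteinbergStack

namespace SteinbergStack

variable {R : Type u} [CommRing R] {H : Heart} {s l : ℕ}
  {w : Matrix (Fin s) (Fin l) (ℤ × ℤ)} {word : List ℕ} {a : ℤ × ℤ}
  {α : Fin s → ℤ × ℤ} {α' : Fin l → ℤ × ℤ}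

/-! ## Relative positions of points of the convolution stack -/

section Points

variable {K : Type u} [Field K] {F : QRep H.shape K} {f g : ℕ →o SubRep F}

theorem sum_Iic_fin {n : ℕ} {A : Type*} [AddCommMonoid A] (i : Fin n) (φ : ℕ → A) :
    ∑ i' ∈ Finset.Iic i, φ i' = ∑ m ∈ Finset.range (i + 1), φ m := by
  rw [Nat.range_succ_eq_Iic, ← Fin.map_valEmbedding_Iic, Finset.sum_map]
  rfl

theorem inf_sup_inf_le (f g : ℕ →o SubRep F) (i j : ℕ) :
    f i ⊓ g (j + 1) ⊔ f (i + 1) ⊓ g j ≤ f (i + 1) ⊓ g (j + 1) :=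
  sup_le (inf_le_inf_right _ (f.monotone i.le_succ)) (inf_le_inf_left _ (g.monotone j.le_succ))

theorem isFamily_relPos (hF : H.IsFamily F) (hf : ∀ i, H.Good (f i)) (hg : ∀ j, H.Good (g j))
    (i j : ℕ) : H.IsFamily (relPos f g i j) :=
  hF.subquot (((hf _).inf hF.isQC (hg _)).sup hF.relations ((hf _).inf hF.isQC (hg _)))
    ((hf _).inf hF.isQC (hg _)) (inf_sup_inf_le f g i j)

/-- The class is a second difference of the classes of the intersections, so row sums and corner
sums telescope. -/
theorem cls_relPos (hF : H.IsFamily F) (hf : ∀ i, H.Good (f i)) (hg : ∀ j, H.Good (g j))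
    (i j : ℕ) : H.cls (relPos f g i j) =
      (H.subCls (f (i + 1) ⊓ g (j + 1)) - H.subCls (f i ⊓ g (j + 1))) -
        (H.subCls (f (i + 1) ⊓ g j) - H.subCls (f i ⊓ g j)) := by
  have hI : ∀ i j, H.Good (f i ⊓ g j) := fun i j => (hf i).inf hF.isQC (hg j)
  have h₁ := Heart.subCls_add hF ((hI i (j + 1)).sup hF.relations (hI (i + 1) j))
    (hI (i + 1) (j + 1)) (inf_sup_inf_le f g i j)
  have h₂ := (Heart.isClassFunction hF).modular _ _ (hI i (j + 1)) (hI (i + 1) j)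
  have h₃ : f i ⊓ g (j + 1) ⊓ (f (i + 1) ⊓ g j) = f i ⊓ g j :=
    le_antisymm (le_inf (inf_le_left.trans inf_le_left) (inf_le_right.trans inf_le_right))
      (le_inf (inf_le_inf_left _ (g.monotone j.le_succ))
        (inf_le_inf_right _ (f.monotone i.le_succ)))
  rw [h₃] at h₂
  rw [relPos, ← add_right_inj, ← h₁, ← sub_eq_zero, ← neg_eq_zero]
  rw [← sub_eq_zero] at h₂
  rw [← h₂]
  abel

theorem subCls_bot (hF : H.IsFamily F) : H.subCls (⊥ : SubRep F) = 0 :=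
  (Heart.isClassFunction hF).map_bot

theorem sum_cls_relPos_row (hF : H.IsFamily F) (hf : ∀ i, H.Good (f i)) (hg : ∀ j, H.Good (g j))
    (hg₀ : g 0 = ⊥) (i j : ℕ) : ∑ j' ∈ Finset.range j, H.cls (relPos f g i j') =
      H.subCls (f (i + 1) ⊓ g j) - H.subCls (f i ⊓ g j) := by
  simp only [cls_relPos hF hf hg]
  rw [Finset.sum_range_sub fun j => H.subCls (f (i + 1) ⊓ g j) - H.subCls (f i ⊓ g j)]
  simp only [hg₀, inf_bot_eq, sub_self, sub_zero]

theorem IsFlag.subCls_sub (hF : H.IsFamily F) (hflag : IsFlag H α f) (hf : ∀ i, H.Good (f i))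
    (i : Fin s) : H.subCls (f (i + 1)) - H.subCls (f i) = α i := by
  rw [Heart.subCls_add hF (hf i) (hf (i + 1)) (f.monotone (Nat.le_succ _)), add_sub_cancel_left]
  exact (hflag.gr i).cls_eq

theorem sum_cls_relPos (hF : H.IsFamily F) (hf : ∀ i, H.Good (f i)) (hg : ∀ j, H.Good (g j))
    (hflag : IsFlag H α f) (hflag' : IsFlag H α' g) (i : Fin s) :
    ∑ j : Fin l, H.cls (relPos f g i j) = α i := by
  rw [Fin.sum_univ_eq_sum_range fun j => H.cls (relPos f g i j),
    sum_cls_relPos_row hF hf hg hflag'.zero, hflag'.last, inf_top_eq, inf_top_eq,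
    hflag.subCls_sub hF hf]

theorem cornerSum_cls_relPos (hF : H.IsFamily F) (hf : ∀ i, H.Good (f i)) (hg : ∀ j, H.Good (g j))
    (hf₀ : f 0 = ⊥) (hg₀ : g 0 = ⊥) (i : Fin s) (j : Fin l) :
    cornerSum (fun i j => H.cls (relPos f g i j)) i j = H.subCls (f (i + 1) ⊓ g (j + 1)) := by
  unfold cornerSum
  have h : ∀ i' : ℕ, ∑ j' ∈ Finset.Iic j, H.cls (relPos f g i' j') =
      H.subCls (f (i' + 1) ⊓ g (j + 1)) - H.subCls (f i' ⊓ g (j + 1)) := fun i' => by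
    rw [sum_Iic_fin j fun j' => H.cls (relPos f g i' j'), sum_cls_relPos_row hF hf hg hg₀]
  simp only [h]
  rw [sum_Iic_fin i fun i' => H.subCls (f (i' + 1) ⊓ g (j + 1)) - H.subCls (f i' ⊓ g (j + 1)),
    Finset.sum_range_sub fun i => H.subCls (f i ⊓ g (j + 1)), hf₀, bot_inf_eq,
    subCls_bot hF, sub_zero]

/-- The smaller matrix is the matrix of actual classes of the relative positions. Its corner sums
are the classes of `f (i + 1) ⊓ g (j + 1)`, and their excess over those of `w` is a defect of the
last chain. -/
theorem SStack.zLE (hw : w ∈ W α α') (hword : IsReducedWord s l word)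
    {X : Flagged H.shape K (Fin ((matrixSeq w word).length + 1))} (hX : SStack H a w word K X) :
    ZLE H a α α' w K ((Pi0t _).obj X) := by
  have hF := hX.1.family
  have hP := hX.isPathOfType hword
  have hf := hP.good_left hF.isQC hF.relations
  have hg := hP.good_right hF.isQC hF.relations
  have hl := hP.isFlag_left hF.relations hw.1
  have hr := hP.isFlag_right hF.relations hword hw.2
  refine ⟨fun i j => H.cls (relPos (X.flag 0) (X.flag (Fin.last _)) i j), ⟨fun i => ?_, fun j => ?_⟩,
    fun i j => ?_, hX.1, hl, hr, fun i j => (isFamily_relPos hF hf hg i j).hasClass⟩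
  · exact sum_cls_relPos hF hf hg hl hr i
  · simp only [relPos_comm (X.flag 0)]
    exact sum_cls_relPos hF hg hf hr hl j
  · rw [cornerSum_cls_relPos hF hf hg hl.zero hr.zero, cornerSum_eq]
    exact hP.subCls_inf_sub_mem_pos hF hword (i + 1) j.2

end Points

/-! ## The open substack -/

/-- By `uStack_iff` the condition is transversality, that is, the vanishing of finitely many
cokernels of finite type. Each has an open vanishing locus that describes its vanishing after every
base change. -/
theorem exists_opens_uStack (hw : w ∈ W α α') (hword : IsReducedWord s l word)
    {X : Flagged H.shape R (Fin ((matrixSeq w word).length + 1))} (hX : SStack H a w word R X) :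
    ∃ V : TopologicalSpace.Opens (PrimeSpectrum R), ∀ (R' : Type u) [CommRing R'] [Algebra R R'],
      UStack H a α α' w word R' (X.baseChange R') ↔
        Set.range (PrimeSpectrum.comap (algebraMap R R')) ⊆ V := by
  have hF := hX.1.family
  have hP := hX.isPathOfType hword
  choose V hV using fun k : Fin word.length =>
    Heart.exists_opens_vanishing (hP.isQC_pathCoker hF k.2) (hP.isFin_pathCoker hword k.2)
  refine ⟨⟨⋂ k, V k, isOpen_iInter_of_finite fun k => (V k).2⟩, fun R' _ _ => ?_⟩
  have hX' := hX.baseChange hword R'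
  have hP' := hX'.isPathOfType hword
  rw [uStack_iff hw hword hX']
  change _ ↔ _ ⊆ ⋂ k, (V k : Set (PrimeSpectrum R))
  rw [Set.subset_iInter_iff]
  simp only [← hV]
  constructor
  · intro hT k
    exact (hP.subsingleton_pathCoker_iff hF.relations k.2 R').2 (hT.le_sup k k.2)
  · intro hT
    exact hP'.isTransversal_of_le_sup hX'.1.family hword fun k hk =>
      (hP.subsingleton_pathCoker_iff hF.relations hk R').1 (hT ⟨k, hk⟩)

/-! ## The isomorphism onto the cell -/

/-- Transport of subobjects along an isomorphism. -/
def SubRep.mapEquiv {Q : Shape} {M N : QRep Q R} (e : ∀ v, M.obj v ≃ₗ[R] N.obj v)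
    (he : ∀ i x, e (Q.tgt i) (M.map i x) = N.map i (e (Q.src i) x)) :
    BoundedLatticeHom (SubRep M) (SubRep N) where
  toFun A := ⟨fun v => (A.carrier v).map (e v).toLinearMap, fun i => by
    rintro _ ⟨x, hx, rfl⟩
    exact ⟨M.map i x, A.stable i hx, he i x⟩⟩
  map_sup' _ _ := SubRep.ext (funext fun _ => Submodule.map_sup _ _ _)
  map_inf' _ _ := SubRep.ext (funext fun v => Submodule.map_inf _ (e v).injective)
  map_top' := SubRep.ext (funext fun v => by
    exact (Submodule.map_top _).trans (e v).range)
  map_bot' := SubRep.ext (funext fun _ => Submodule.map_bot _)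

theorem UStack.flagAt_eq (hw : w ∈ W α α') (hword : IsReducedWord s l word)
    {X : Flagged H.shape R (Fin ((matrixSeq w word).length + 1))}
    (hX : UStack H a α α' w word R X) (k : Fin ((matrixSeq w word).length + 1)) (q : ℕ) :
    X.flag k q = cellFlags s l word (X.flag 0) (X.flag (Fin.last _)) k q := by
  have h := (sStack_iff.1 hX.1).2.eq_cellFlags hX.1.1.family.relations hword
    ((uStack_iff hw hword hX.1).1 hX) (n := k)
    (by rw [← length_matrixSeq w]; exact Nat.le_of_lt_succ k.2) q
  rw [← length_matrixSeq w, flagAt_last, flagAt_val] at h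
  exact h

/-- Morphisms are isomorphisms of underlying objects, so faithfulness is immediate. The intermediate
flags are lattice expressions in the two end flags, so an isomorphism respecting the ends respects
them all, and for a pair in the cell the same expressions provide a preimage. -/
theorem piU_isEquivalence (hw : w ∈ W α α') (hword : IsReducedWord s l word) :
    (PiU H a α α' w word R).IsEquivalence where
  faithful :=
    { map_injective := fun {X Y f g} hfg => by
        have h := congrArg (fun φ => φ.hom.equiv) hfg
        exact ObjectProperty.hom_ext _ (Flagged.Hom.ext h) }
  full :=
    { map_surjective := fun {X Y} f => by
        let e : ∀ v, X.obj.F.obj v ≃ₗ[R] Y.obj.F.obj v := f.hom.equiv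
        -- Transport of subobjects preserves joins and meets, hence the expressions `cellFlags`.
        let Φ : BoundedLatticeHom (SubRep X.obj.F) (SubRep Y.obj.F) :=
          SubRep.mapEquiv e f.hom.comm
        have hf : ∀ i, Φ (X.obj.flag 0 i) = Y.obj.flag 0 i := fun i =>
          SubRep.ext (funext (f.hom.flag 0 i))
        have hg : ∀ i, Φ (X.obj.flag (Fin.last _) i) = Y.obj.flag (Fin.last _) i := fun i =>
          SubRep.ext (funext (f.hom.flag 1 i))
        refine ⟨ObjectProperty.homMk ⟨e, f.hom.comm, fun k q v => ?_⟩, rfl⟩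
        have h := map_cellFlags (s := s) (l := l) (word := word) Φ hf hg k q
        rw [← X.property.flagAt_eq hw hword, ← Y.property.flagAt_eq hw hword] at h
        exact congrFun (congrArg SubRep.carrier h) v }
  essSurj :=
    { mem_essImage := fun Z => by
        let φ := cellFlags s l word (Z.obj.flag 0) (Z.obj.flag 1)
        let X : Flagged H.shape R (Fin ((matrixSeq w word).length + 1)) := ⟨Z.obj.F, fun k => φ k⟩
        have hX : SStack H a w word R X := by
          refine ⟨Z.property.1, fun k => ?_⟩
          exact linked_cellFlags Z.property.1.family.relations hword Z.property.2 k k.2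
        have h₁ : X.flag (Fin.last _) = Z.obj.flag 1 := by
          change φ (matrixSeq w word).length = _
          rw [length_matrixSeq]
          exact cellFlags_last
        have hX' : UStack H a α α' w word R X := by
          refine ⟨hX, Z.property.1, ?_⟩
          change InCell H α α' w (φ 0) (X.flag (Fin.last _))
          rw [h₁]
          exact Z.property.2
        let e : (Pi0t _).obj X ⟶ Z.obj :=
          ⟨fun v => LinearEquiv.refl R _, fun _ _ => rfl, fun i n v => by
            refine (Submodule.map_id _).trans ?_
            fin_cases i
            · rfl
            · exact congrArg (fun c : ℕ →o SubRep Z.obj.F => (c n).carrier v) h₁⟩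
        exact ⟨⟨X, hX'⟩, ⟨ObjectProperty.isoMk _ ((Groupoid.isoEquivHom _ _).symm e)⟩⟩ }

end SteinbergStack

open SteinbergStack in
theorem mainTheorem7 (H : Heart) {s l : ℕ} (a : ℤ × ℤ)
    (α : Fin s → ℤ × ℤ) (α' : Fin l → ℤ × ℤ) (hα : IsSeq a α) (hα' : IsSeq a α')
    (w : Matrix (Fin s) (Fin l) (ℤ × ℤ)) (hw : w ∈ W α α')
    (word : List ℕ) (hword : IsReducedWord s l word) :
    -- every point of `S(w)` is mapped into `Z(≤ w)`
    (∀ (K : Type u) [Field K] [Algebra ℂ K]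
        (X : Flagged H.shape K (Fin ((matrixSeq w word).length + 1))),
      SStack H a w word K X → ZLE H a α α' w K ((Pi0t _).obj X)) ∧
    -- `U(w) → Z(w)` is an isomorphism of stacks
    (∀ (R : Type u) [CommRing R] [Algebra ℂ R], (PiU H a α α' w word R).IsEquivalence) ∧
    -- `U(w)` is an open substack of `S(w)`
    (∀ (R : Type u) [CommRing R] [Algebra ℂ R]
        (X : Flagged H.shape R (Fin ((matrixSeq w word).length + 1))),
      SStack H a w word R X →
      ∃ V : TopologicalSpace.Opens (PrimeSpectrum R),
        ∀ (R' : Type u) [CommRing R'] [Algebra ℂ R'] [Algebra R R'] [IsScalarTower ℂ R R'],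
          UStack H a α α' w word R' (X.baseChange R') ↔
            Set.range (PrimeSpectrum.comap (algebraMap R R')) ⊆ V) := by
  refine ⟨fun K _ _ X hX => hX.zLE hw hword, fun R _ _ => piU_isEquivalence hw hword,
    fun R _ _ X hX => ?_⟩
  obtain ⟨V, hV⟩ := exists_opens_uStack (α := α) (α' := α') hw hword hX
  exact ⟨V, fun R' _ _ _ _ => hV R'⟩
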